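/- Let $\theta\in(0,\frac{\pi}{2})$ and let $$\Omega_\theta=\Big\{(x_1,x_2)\in\mathbb{R}^2:\ x_1\tan\theta<|x_2|<\Big(x_1+\frac{\pi}{\sin\theta}\Big)\tan\theta\Big\},\qquad \Omega_\theta^+=\{(x_1,x_2)\in\Omega_\theta:\ x_2>0\}.$$ For an open set $U\subset\mathbb{R}^2$ and a part $\Gamma$ of its boundary, let $V$ be the space of all $u\in H^1(U)$ with $u=0$ on $\Gamma$ (the closure in $H^1(U)$ of the restrictions to $U$ of the functions of $C_c^\infty(\mathbb{R}^2)$ whose support does not meet $\Gamma$). The positive Laplacian on $U$ with Dirichlet conditions on $\Gamma$ and Neumann conditions on the rest of the boundary is the unbounded operator $A$ on the complex Hilbert space $L^2(U)$ associated with the form $b(u,v)=\int_U\nabla u\cdot\overline{\nabla v}$ on $V$: one has $u\in\mathsf{Dom}(A)$ and $Au=f$ if and only if $u\in V$, $f\in L^2(U)$ and $b(u,v)=\langle f,v\rangle_{L^2(U)}$ for all $v\in V$. Let $\Delta^{\mathsf{Dir}}_{\Omega_\theta}$ be this operator for $U=\Omega_\theta$, $\Gamma=\partial\Omega_\theta$,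 and $\Delta^{\mathsf{Mix}}_{\Omega_\theta^+}$ this operator for $U=\Omega_\theta^+$, $\Gamma=\partial\Omega_\theta\cap\partial\Omega_\theta^+$ (so with Neumann conditions on the symmetry axis $x_2=0$). The discrete spectrum $\sigma_{\mathsf{dis}}(A)$ is the set of all $\lambda\in\mathbb{C}$ such that $A-\lambda$ is not bijective from $\mathsf{Dom}(A)$ onto $L^2(U)$ but is Fredholm, i.e. has finite-dimensional kernel and closed range of finite codimension. Then $$\sigma_{\mathsf{dis}}\big(\Delta^{\mathsf{Dir}}_{\Omega_\theta}\big)=\sigma_{\mathsf{dis}}\big(\Delta^{\mathsf{Mix}}_{\Omega_\theta^+}\big).$$ Moreover, all bound states are even in $x_2$: if $\lambda<1$ is real and $\psi\in\mathsf{Dom}(\Delta^{\mathsf{Dir}}_{\Omega_\theta})$ satisfies $\Delta^{\mathsf{Dir}}_{\Omega_\theta}\psi=\lambda\psi$, then $\psi(x_1,-x_2)=\psi(x_1,x_2)$ for almost every $(x_1,x_2)\in\Omega_\theta$. -/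

import Mathlib

open MeasureTheory Set
open scoped ContDiff

noncomputable section

namespace BrokenGuide

/-! ### Spectrum of an unbounded operator -/

section Spectrum

variable {H : Type*} [NormedAddCommGroup H] [InnerProductSpace ℂ H]

/-- The operator `A - z`, as a linear map from the domain of `A` into `H`. -/
def shift (A : H →ₗ.[ℂ] H) (z : ℂ) : A.domain →ₗ[ℂ] H :=
  A.toFun - z • A.domain.subtype

/-- The spectrum: all `z` such that `A - z` is not invertible from its domain onto `H`. -/
def spectrum (A : H →ₗ.[ℂ] H) : Set ℂ :=
  {z | ¬ Function.Bijective (shift A z)}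

/-- `A - z` is Fredholm: its kernel is finite dimensional, its range is closed and of finite
codimension. -/
structure IsFredholmAt (A : H →ₗ.[ℂ] H) (z : ℂ) : Prop where
  finite_ker : FiniteDimensional ℂ (LinearMap.ker (shift A z))
  closed_range : IsClosed (LinearMap.range (shift A z) : Set H)
  finite_coker : FiniteDimensional ℂ (H ⧸ LinearMap.range (shift A z))

/-- The essential spectrum: all `z` such that `A - z` is not Fredholm. -/
def essentialSpectrum (A : H →ₗ.[ℂ] H) : Set ℂ :=
  {z | ¬ IsFredholmAt A z}

/-- The discrete spectrum: the spectrum without the essential spectrum. -/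
def discreteSpectrum (A : H →ₗ.[ℂ] H) : Set ℂ :=
  spectrum A \ essentialSpectrum A

end Spectrum

/-! ### Sobolev spaces on an open subset of the plane -/

/-- The complex Hilbert space `L²(U)` for Lebesgue measure. -/
abbrev L2 (U : Set (ℝ × ℝ)) : Type := Lp ℂ 2 (volume.restrict U)

/-- The first partial derivative. -/
def pd1 (φ : ℝ × ℝ → ℂ) (x : ℝ × ℝ) : ℂ := fderiv ℝ φ x (1, 0)

/-- The second partial derivative. -/
def pd2 (φ : ℝ × ℝ → ℂ) (x : ℝ × ℝ) : ℂ := fderiv ℝ φ x (0, 1)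

/-- `φ` is a smooth function on the plane with compact support contained in `S`. -/
structure IsTest (S : Set (ℝ × ℝ)) (φ : ℝ × ℝ → ℂ) : Prop where
  smooth : ContDiff ℝ ∞ φ
  compact : HasCompactSupport φ
  supp : tsupport φ ⊆ S

namespace IsTest

variable {S : Set (ℝ × ℝ)} {φ ψ : ℝ × ℝ → ℂ}

theorem zero : IsTest S 0 := ⟨contDiff_const, HasCompactSupport.zero, by simp [tsupport]⟩

theorem add (hφ : IsTest S φ) (hψ : IsTest S ψ) : IsTest S (φ + ψ) :=
  ⟨hφ.smooth.add hψ.smooth, hφ.compact.add hψ.compact,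
    (tsupport_add φ ψ).trans (union_subset hφ.supp hψ.supp)⟩

theorem smul (c : ℂ) (hφ : IsTest S φ) : IsTest S (c • φ) :=
  ⟨hφ.smooth.const_smul c, hφ.compact.smul_left (f := fun _ => c),
    (tsupport_smul_subset_right (fun _ => c) φ).trans hφ.supp⟩

theorem differentiable (hφ : IsTest S φ) : Differentiable ℝ φ :=
  hφ.smooth.differentiable (by simp)

theorem continuous_pd (hφ : IsTest S φ) (v : ℝ × ℝ) : Continuous fun x => fderiv ℝ φ x v :=
  (hφ.smooth.continuous_fderiv (by simp)).clm_apply continuous_const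

theorem compact_pd (hφ : IsTest S φ) (v : ℝ × ℝ) : HasCompactSupport fun x => fderiv ℝ φ x v :=
  hφ.compact.fderiv_apply ℝ v

theorem memLp (hφ : IsTest S φ) (μ : Measure (ℝ × ℝ)) [IsFiniteMeasureOnCompacts μ] :
    MemLp φ 2 μ :=
  hφ.smooth.continuous.memLp_of_hasCompactSupport hφ.compact

theorem memLp_pd (hφ : IsTest S φ) (v : ℝ × ℝ) (μ : Measure (ℝ × ℝ))
    [IsFiniteMeasureOnCompacts μ] : MemLp (fun x => fderiv ℝ φ x v) 2 μ :=
  (hφ.continuous_pd v).memLp_of_hasCompactSupport (hφ.compact_pd v)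

theorem integrable_mul {U : Set (ℝ × ℝ)} (hφ : IsTest S φ) (f : L2 U) :
    Integrable (fun x => φ x * f x) (volume.restrict U) :=
  (hφ.memLp _).integrable_mul (Lp.memLp f)

theorem integrable_pd_mul {U : Set (ℝ × ℝ)} (hφ : IsTest S φ) (v : ℝ × ℝ) (f : L2 U) :
    Integrable (fun x => fderiv ℝ φ x v * f x) (volume.restrict U) :=
  (hφ.memLp_pd v _).integrable_mul (Lp.memLp f)

end IsTest

/-- The Sobolev space `H¹(U)`, each function being recorded together with its weak partial
derivatives: the triples `(u, g₁, g₂)` of elements of `L²(U)` such that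
`∫ (∂ⱼφ) u = - ∫ φ gⱼ` for all smooth `φ` with compact support in `U`. -/
def H1 (U : Set (ℝ × ℝ)) : Submodule ℂ (L2 U × L2 U × L2 U) where
  carrier := {p | ∀ φ, IsTest U φ →
    ∫ x in U, pd1 φ x * p.1 x = - ∫ x in U, φ x * p.2.1 x ∧
    ∫ x in U, pd2 φ x * p.1 x = - ∫ x in U, φ x * p.2.2 x}
  zero_mem' := by
    intro φ hφ
    have h0 : ∀ k : ℝ × ℝ → ℂ, ∫ x in U, k x * (0 : L2 U) x = 0 := fun k =>
      integral_eq_zero_of_ae ((Lp.coeFn_zero ℂ 2 (volume.restrict U)).mono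
        fun x hx => by
          simp only [hx, Pi.zero_apply, mul_zero])
    simp only [Prod.fst_zero, Prod.snd_zero, h0, neg_zero, and_self]
  add_mem' := by
    intro p q hp hq φ hφ
    have hadd : ∀ (k : ℝ × ℝ → ℂ) (f g : L2 U),
        Integrable (fun x => k x * f x) (volume.restrict U) →
        Integrable (fun x => k x * g x) (volume.restrict U) →
        ∫ x in U, k x * (f + g) x = (∫ x in U, k x * f x) + ∫ x in U, k x * g x := by
      intro k f g hf hg
      rw [← integral_add hf hg]
      exact integral_congr_ae ((Lp.coeFn_add f g).mono fun x hx => by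
        simp only [hx, Pi.add_apply, mul_add])
    obtain ⟨h1, h2⟩ := hp φ hφ
    obtain ⟨k1, k2⟩ := hq φ hφ
    constructor
    · rw [Prod.fst_add, Prod.snd_add, Prod.fst_add,
        hadd (pd1 φ) _ _ (hφ.integrable_pd_mul _ _) (hφ.integrable_pd_mul _ _),
        hadd _ _ _ (hφ.integrable_mul _) (hφ.integrable_mul _), h1, k1]
      ring
    · rw [Prod.fst_add, Prod.snd_add, Prod.snd_add,
        hadd (pd2 φ) _ _ (hφ.integrable_pd_mul _ _) (hφ.integrable_pd_mul _ _),
        hadd _ _ _ (hφ.integrable_mul _) (hφ.integrable_mul _), h2, k2]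
      ring
  smul_mem' := by
    intro c p hp φ hφ
    have hsmul : ∀ (k : ℝ × ℝ → ℂ) (f : L2 U),
        ∫ x in U, k x * (c • f) x = c * ∫ x in U, k x * f x := by
      intro k f
      rw [← integral_const_mul]
      refine integral_congr_ae ((Lp.coeFn_smul c f).mono fun x hx => ?_)
      simp only [hx, Pi.smul_apply, smul_eq_mul]
      ring
    obtain ⟨h1, h2⟩ := hp φ hφ
    simp only [Prod.smul_fst, Prod.smul_snd, hsmul, h1, h2]
    constructor <;> ring

/-- The triples `(φ, ∂₁φ, ∂₂φ)`, restricted to `U`, where `φ` is smooth on the plane with compact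
support disjoint from `Γ`. -/
def smoothTriples (U Γ : Set (ℝ × ℝ)) : Submodule ℂ (L2 U × L2 U × L2 U) where
  carrier := {p | ∃ φ, IsTest Γᶜ φ ∧ p.1 =ᵐ[volume.restrict U] φ ∧
    p.2.1 =ᵐ[volume.restrict U] pd1 φ ∧ p.2.2 =ᵐ[volume.restrict U] pd2 φ}
  zero_mem' := by
    refine ⟨0, IsTest.zero, Lp.coeFn_zero _ _ _, ?_, ?_⟩
    · exact (Lp.coeFn_zero ℂ 2 (volume.restrict U)).mono fun x hx => by
        simpa [pd1] using hx
    · exact (Lp.coeFn_zero ℂ 2 (volume.restrict U)).mono fun x hx => by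
        simpa [pd2] using hx
  add_mem' := by
    rintro p q ⟨φ, hφ, a0, a1, a2⟩ ⟨ψ, hψ, b0, b1, b2⟩
    refine ⟨φ + ψ, hφ.add hψ, ?_, ?_, ?_⟩
    · filter_upwards [a0, b0, Lp.coeFn_add p.1 q.1] with x h1 h2 h3
      rw [Prod.fst_add, h3, Pi.add_apply, h1, h2, Pi.add_apply]
    · filter_upwards [a1, b1, Lp.coeFn_add p.2.1 q.2.1] with x h1 h2 h3
      rw [Prod.snd_add, Prod.fst_add, h3, Pi.add_apply, h1, h2]
      simp [pd1, fderiv_add (hφ.differentiable x) (hψ.differentiable x)]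
    · filter_upwards [a2, b2, Lp.coeFn_add p.2.2 q.2.2] with x h1 h2 h3
      rw [Prod.snd_add, Prod.snd_add, h3, Pi.add_apply, h1, h2]
      simp [pd2, fderiv_add (hφ.differentiable x) (hψ.differentiable x)]
  smul_mem' := by
    rintro c p ⟨φ, hφ, a0, a1, a2⟩
    refine ⟨c • φ, hφ.smul c, ?_, ?_, ?_⟩
    · filter_upwards [a0, Lp.coeFn_smul c p.1] with x h1 h3
      simp [h1, h3]
    · filter_upwards [a1, Lp.coeFn_smul c p.2.1] with x h1 h3
      simp [h1, h3, pd1, fderiv_const_smul (hφ.differentiable x)]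
    · filter_upwards [a2, Lp.coeFn_smul c p.2.2] with x h1 h3
      simp [h1, h3, pd2, fderiv_const_smul (hφ.differentiable x)]

/-- The space `{u ∈ H¹(U) : u = 0 on Γ}` (with weak gradients recorded): the closure in `H¹(U)` of
the smooth compactly supported functions that vanish near `Γ`. If `U` is open and `Γ` is the whole
boundary of `U`, it is `H¹₀(U)`, the closure of the smooth functions with compact support in `U`. -/
def formDomain (U Γ : Set (ℝ × ℝ)) : Submodule ℂ (L2 U × L2 U × L2 U) :=
  H1 U ⊓ (smoothTriples U Γ).topologicalClosure

/-! ### The Laplacian with Dirichlet conditions on `Γ` and natural conditions elsewhere -/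

/-- The graph of the operator associated with the Dirichlet form `b(u, v) = ∫ ∇u · conj ∇v` on
`V = {u ∈ H¹(U) : u = 0 on Γ}`: the pairs `(u, f)` with `u ∈ V`, `f ∈ L²(U)` and
`b(u, v) = ⟨f, v⟩` for all `v ∈ V`. -/
def laplacianGraph (U Γ : Set (ℝ × ℝ)) : Submodule ℂ (L2 U × L2 U) where
  carrier := {q | ∃ p ∈ formDomain U Γ, p.1 = q.1 ∧
    ∀ v ∈ formDomain U Γ, inner ℂ v.2.1 p.2.1 + inner ℂ v.2.2 p.2.2 = inner ℂ v.1 q.2}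
  zero_mem' := ⟨0, Submodule.zero_mem _, rfl, by simp⟩
  add_mem' := by
    rintro q r ⟨p, hp, h1, h2⟩ ⟨s, hs, k1, k2⟩
    refine ⟨p + s, Submodule.add_mem _ hp hs, by simp [h1, k1], fun v hv => ?_⟩
    simp only [Prod.fst_add, Prod.snd_add, inner_add_right, ← h2 v hv, ← k2 v hv]
    ring
  smul_mem' := by
    rintro c q ⟨p, hp, h1, h2⟩
    refine ⟨c • p, Submodule.smul_mem _ c hp, by simp [h1], fun v hv => ?_⟩
    simp only [Prod.smul_fst, Prod.smul_snd, inner_smul_right, ← h2 v hv]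
    ring

/-- The positive Laplacian on `U`, an unbounded operator on `L²(U)`, with Dirichlet conditions on
`Γ` and Neumann conditions on the rest of the boundary. Its graph is `laplacianGraph U Γ` as soon
as `U` is open and disjoint from `Γ`, see `laplacian_graph`. -/
def laplacian (U Γ : Set (ℝ × ℝ)) : L2 U →ₗ.[ℂ] L2 U :=
  (laplacianGraph U Γ).toLinearPMap

theorem ae_zero_of_test {U : Set (ℝ × ℝ)} (hU : IsOpen U) (f : L2 U)
    (h : ∀ φ, IsTest U φ → ∫ x in U, φ x * f x = 0) : f = 0 := by
  rw [Lp.eq_zero_iff_ae_eq_zero]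
  have hloc : LocallyIntegrableOn f U (volume.restrict U) :=
    ((Lp.memLp f).locallyIntegrable (by norm_num)).locallyIntegrableOn U
  have key := hU.ae_eq_zero_of_integral_contDiff_smul_eq_zero hloc (fun g hg hc hs => by
    have hsub : tsupport (fun x => (g x : ℂ)) ⊆ tsupport g :=
      closure_mono fun x hx => by simpa using hx
    have := h (fun x => (g x : ℂ))
      ⟨Complex.ofRealCLM.contDiff.comp hg, hc.comp_left (g := Complex.ofReal) (by simp),
        hsub.trans hs⟩
    simpa [Complex.real_smul] using this)
  filter_upwards [key, ae_restrict_mem hU.measurableSet] with x hx hxU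
  exact hx hxU

theorem exists_formDomain_of_test {U Γ : Set (ℝ × ℝ)} (hΓ : Disjoint U Γ)
    {φ : ℝ × ℝ → ℂ} (hφ : IsTest U φ) :
    ∃ p ∈ formDomain U Γ, p.1 =ᵐ[volume.restrict U] φ := by
  let μ : Measure (ℝ × ℝ) := volume.restrict U
  let p : L2 U × L2 U × L2 U :=
    ((hφ.memLp μ).toLp φ, (hφ.memLp_pd (1, 0) μ).toLp _, (hφ.memLp_pd (0, 1) μ).toLp _)
  have h0 : p.1 =ᵐ[volume.restrict U] φ := (hφ.memLp μ).coeFn_toLp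
  have h1 : p.2.1 =ᵐ[volume.restrict U] fun x => fderiv ℝ φ x (1, 0) :=
    (hφ.memLp_pd (1, 0) μ).coeFn_toLp
  have h2 : p.2.2 =ᵐ[volume.restrict U] fun x => fderiv ℝ φ x (0, 1) :=
    (hφ.memLp_pd (0, 1) μ).coeFn_toLp
  refine ⟨p, ⟨fun χ hχ => ?_, subset_closure
    ⟨φ, ⟨hφ.smooth, hφ.compact, hφ.supp.trans hΓ.subset_compl_right⟩, h0, h1, h2⟩⟩, h0⟩
  have aux : ∀ (v : ℝ × ℝ) (g : L2 U), g =ᵐ[volume.restrict U] (fun x => fderiv ℝ φ x v) →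
      ∫ x in U, fderiv ℝ χ x v * p.1 x = - ∫ x in U, χ x * g x := by
    intro v g hg
    have e1 : ∫ x in U, fderiv ℝ χ x v * p.1 x = ∫ x, fderiv ℝ χ x v * φ x := by
      rw [← setIntegral_eq_integral_of_forall_compl_eq_zero (s := U)
        (f := fun x => fderiv ℝ χ x v * φ x)]
      · exact integral_congr_ae (h0.mono fun x hx => by simp only [hx])
      · intro x hx
        rw [image_eq_zero_of_notMem_tsupport fun h => hx (hφ.supp h), mul_zero]
    have e2 : ∫ x in U, χ x * g x = ∫ x, χ x * fderiv ℝ φ x v := by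
      rw [← setIntegral_eq_integral_of_forall_compl_eq_zero (s := U)
        (f := fun x => χ x * fderiv ℝ φ x v)]
      · exact integral_congr_ae (hg.mono fun x hx => by simp only [hx])
      · intro x hx
        rw [image_eq_zero_of_notMem_tsupport fun h => hx (hχ.supp h), zero_mul]
    rw [e1, e2, integral_mul_fderiv_eq_neg_fderiv_mul_of_integrable, neg_neg]
    · exact (hχ.memLp_pd v volume).integrable_mul (hφ.memLp volume)
    · exact (hχ.memLp volume).integrable_mul (hφ.memLp_pd v volume)
    · exact (hχ.memLp volume).integrable_mul (hφ.memLp volume)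
    · exact fun x _ => hχ.differentiable x
    · exact fun x _ => hφ.differentiable x
  exact ⟨aux _ _ h1, aux _ _ h2⟩

/-- The operator `laplacian U Γ` is well defined: its graph is the one prescribed. -/
theorem laplacian_graph {U Γ : Set (ℝ × ℝ)} (hU : IsOpen U) (hΓ : Disjoint U Γ) :
    (laplacian U Γ).graph = laplacianGraph U Γ := by
  refine Submodule.toLinearPMap_graph_eq _ ?_
  rintro ⟨u, f⟩ ⟨p, hp, hpu, h⟩ rfl
  have hw := hp.1
  have g0 : ∀ k : ℝ × ℝ → ℂ, ∫ x in U, k x * p.1 x = 0 := by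
    intro k
    rw [hpu]
    exact integral_eq_zero_of_ae ((Lp.coeFn_zero ℂ 2 (volume.restrict U)).mono
      fun x hx => by
          simp only [hx, Pi.zero_apply, mul_zero])
  have z1 : p.2.1 = 0 := ae_zero_of_test hU _ fun φ hφ => by
    have := (hw φ hφ).1
    rw [g0] at this
    exact neg_eq_zero.mp this.symm
  have z2 : p.2.2 = 0 := ae_zero_of_test hU _ fun φ hφ => by
    have := (hw φ hφ).2
    rw [g0] at this
    exact neg_eq_zero.mp this.symm
  refine ae_zero_of_test hU _ fun φ hφ => ?_
  have hconj : IsTest U (fun x => star (φ x)) :=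
    ⟨(Complex.conjCLE.contDiff).comp hφ.smooth, hφ.compact.comp_left (g := star) (by simp),
      (closure_mono fun x hx => by simpa using hx : _ ⊆ tsupport φ).trans hφ.supp⟩
  obtain ⟨v, hv, hvφ⟩ := exists_formDomain_of_test hΓ hconj
  have := h v hv
  rw [z1, z2, inner_zero_right, inner_zero_right, add_zero, L2.inner_def] at this
  rw [this]
  refine integral_congr_ae (hvφ.mono fun x hx => ?_)
  simp [hx, mul_comm]

/-- The positive Dirichlet Laplacian on `U`. -/
def dirichletLaplacian (U : Set (ℝ × ℝ)) : L2 U →ₗ.[ℂ] L2 U :=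
  laplacian U (frontier U)

/-! ### The broken guide -/

/-- The broken guide `Ω_θ`. -/
def guide (θ : ℝ) : Set (ℝ × ℝ) :=
  {x | x.1 * Real.tan θ < |x.2| ∧ |x.2| < (x.1 + Real.pi / Real.sin θ) * Real.tan θ}

/-- The half-guide `Ω_θ⁺`. -/
def halfGuide (θ : ℝ) : Set (ℝ × ℝ) := {x ∈ guide θ | 0 < x.2}

/-- The Dirichlet part `∂Ω_θ ∩ ∂Ω_θ⁺` of the boundary of the half-guide. -/
def dirichletBoundary (θ : ℝ) : Set (ℝ × ℝ) := frontier (guide θ) ∩ frontier (halfGuide θ)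

theorem isOpen_guide (θ : ℝ) : IsOpen (guide θ) :=
  IsOpen.and (isOpen_lt (f := fun x : ℝ × ℝ => x.1 * Real.tan θ) (by fun_prop) (by fun_prop))
    (isOpen_lt (g := fun x : ℝ × ℝ => (x.1 + Real.pi / Real.sin θ) * Real.tan θ)
      (by fun_prop) (by fun_prop))

theorem isOpen_halfGuide (θ : ℝ) : IsOpen (halfGuide θ) :=
  (isOpen_guide θ).inter (isOpen_lt continuous_const continuous_snd)

/-- The positive Laplacian on the half-guide, with Dirichlet conditions on `∂Ω_θ ∩ ∂Ω_θ⁺` and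
Neumann conditions on the remaining part of the boundary, which lies on the axis `x₂ = 0`. -/
def mixedLaplacian (θ : ℝ) : L2 (halfGuide θ) →ₗ.[ℂ] L2 (halfGuide θ) :=
  laplacian (halfGuide θ) (dirichletBoundary θ)

/-- The Dirichlet Laplacian is well defined. -/
theorem dirichletLaplacian_graph (θ : ℝ) :
    (dirichletLaplacian (guide θ)).graph = laplacianGraph (guide θ) (frontier (guide θ)) :=
  laplacian_graph (isOpen_guide θ) (disjoint_iff_inter_eq_empty.mpr (isOpen_guide θ).inter_frontier_eq)

/-- The mixed Laplacian is well defined. -/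
theorem mixedLaplacian_graph (θ : ℝ) :
    (mixedLaplacian θ).graph = laplacianGraph (halfGuide θ) (dirichletBoundary θ) :=
  laplacian_graph (isOpen_halfGuide θ)
    ((disjoint_iff_inter_eq_empty.mpr (isOpen_halfGuide θ).inter_frontier_eq).mono_right
      inter_subset_right)

end BrokenGuide

end

/-!
The reflection `x₂ ↦ -x₂` commutes with the Dirichlet Laplacian and splits it into an even part,
which is the mixed Laplacian of the upper half, and an odd part, which is the Dirichlet Laplacian of
the upper half. The upper half is covered by segments of length at most `π` across the arm with
both ends on the boundary, so by the Poincaré inequality the odd part is bounded below by `1` and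
has no spectrum outside `[1, ∞)`. Hence the two discrete spectra coincide off `[1, ∞)`, and the
eigenfunctions below `1` are even. On `[1, ∞)` neither operator has discrete spectrum, since wave
packets `ρ(s) sin t` escaping along the arm form a Weyl sequence of the mixed Laplacian, which is
therefore not Fredholm there.
-/

open Filter Topology
open scoped ENNReal

namespace BrokenGuide

section Operators

variable {H K : Type*} [NormedAddCommGroup H] [InnerProductSpace ℂ H]
  [NormedAddCommGroup K] [InnerProductSpace ℂ K] {A : H →ₗ.[ℂ] H} {B : K →ₗ.[ℂ] K} {z : ℂ}

theorem mem_range_shift {g : H} :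
    g ∈ LinearMap.range (shift A z) ↔ ∃ u, (u, g + z • u) ∈ A.graph := by
  constructor
  · rintro ⟨y, rfl⟩
    exact ⟨y, (LinearPMap.mem_graph_iff _).2 ⟨y, rfl, by simp [shift]⟩⟩
  · rintro ⟨u, hu⟩
    obtain ⟨y, rfl, hy⟩ := (LinearPMap.mem_graph_iff _).1 hu
    exact ⟨y, by simpa [shift, sub_eq_iff_eq_add] using hy⟩

/-- The eigenspace `ker (A - z)`, as a subspace of the whole space rather than of the domain. -/
def eigenspace (A : H →ₗ.[ℂ] H) (z : ℂ) : Submodule ℂ H :=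
  (LinearMap.ker (shift A z)).map A.domain.subtype

theorem mem_eigenspace {u : H} : u ∈ eigenspace A z ↔ (u, z • u) ∈ A.graph := by
  rw [LinearPMap.mem_graph_iff]
  constructor
  · rintro ⟨y, hy, rfl⟩
    exact ⟨y, rfl, sub_eq_zero.1 hy⟩
  · rintro ⟨y, rfl, hy⟩
    exact ⟨y, sub_eq_zero.2 hy, rfl⟩

theorem finiteDimensional_eigenspace_iff :
    FiniteDimensional ℂ (eigenspace A z) ↔ FiniteDimensional ℂ (LinearMap.ker (shift A z)) :=
  (Module.Finite.equiv_iff (Submodule.equivMapOfInjective A.domain.subtype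
    A.domain.injective_subtype (LinearMap.ker (shift A z)))).symm

theorem submodule_map_eq_bot_iff {V W : Type*} [AddCommGroup V] [Module ℂ V]
    [AddCommGroup W] [Module ℂ W] {f : V →ₗ[ℂ] W} (hf : Function.Injective f)
    {S : Submodule ℂ V} : S.map f = ⊥ ↔ S = ⊥ := by
  rw [← Submodule.map_bot f, (Submodule.map_injective_of_injective hf).eq_iff]

theorem bijective_shift_iff :
    Function.Bijective (shift A z) ↔
      eigenspace A z = ⊥ ∧ LinearMap.range (shift A z) = ⊤ := by
  rw [eigenspace, submodule_map_eq_bot_iff A.domain.injective_subtype,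
    LinearMap.ker_eq_bot, LinearMap.range_eq_top]
  rfl

theorem finiteDimensional_quotient_comap {V W : Type*} [AddCommGroup V] [Module ℂ V]
    [AddCommGroup W] [Module ℂ W] (f : V →ₗ[ℂ] W) (S : Submodule ℂ W)
    [FiniteDimensional ℂ (W ⧸ S)] : FiniteDimensional ℂ (V ⧸ S.comap f) := by
  refine Module.Finite.of_injective ((S.comap f).mapQ S f le_rfl) ?_
  rw [← LinearMap.ker_eq_bot, Submodule.ker_mapQ, Submodule.mkQ_map_self]

theorem IsFredholmAt.of_range_eq_comap (hA : IsFredholmAt A z)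
    (hker : FiniteDimensional ℂ (eigenspace B z)) (L : K →L[ℂ] H)
    (hrange : LinearMap.range (shift B z) = (LinearMap.range (shift A z)).comap L.toLinearMap) :
    IsFredholmAt B z where
  finite_ker := finiteDimensional_eigenspace_iff.1 hker
  closed_range := by
    rw [hrange]
    exact hA.closed_range.preimage L.continuous
  finite_coker := by
    have := hA.finite_coker
    rw [hrange]
    exact finiteDimensional_quotient_comap _ _

/-- `B` is a direct summand of `A`: the embedding `J` has the left inverse `P`, and both
intertwine the two operators, which is expressed by their graphs. -/
structure IsSummand (A : H →ₗ.[ℂ] H) (B : K →ₗ.[ℂ] K) (J : K →L[ℂ] H) (P : H →L[ℂ] K) :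
    Prop where
  proj_embed : ∀ w, P (J w) = w
  embed_mem_graph : ∀ {w g}, (w, g) ∈ B.graph → (J w, J g) ∈ A.graph
  proj_mem_graph : ∀ {u f}, (u, f) ∈ A.graph → (P u, P f) ∈ B.graph

/-- The part of `A - z` in the complementary summand `ker P` is bijective. -/
structure RegularOnKer (A : H →ₗ.[ℂ] H) (P : H →L[ℂ] K) (z : ℂ) : Prop where
  inj : ∀ {u}, (u, z • u) ∈ A.graph → P u = 0 → u = 0
  surj : ∀ {f}, P f = 0 → ∃ u, (u, f + z • u) ∈ A.graph

namespace IsSummand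

variable {J : K →L[ℂ] H} {P : H →L[ℂ] K} (h : IsSummand A B J P)
include h

theorem injective_embed : Function.Injective J := Function.LeftInverse.injective h.proj_embed

theorem map_eigenspace_le : (eigenspace B z).map J.toLinearMap ≤ eigenspace A z := by
  rintro _ ⟨w, hw, rfl⟩
  simpa [mem_eigenspace] using h.embed_mem_graph (mem_eigenspace.1 hw)

theorem range_shift_eq_comap_embed :
    LinearMap.range (shift B z) = (LinearMap.range (shift A z)).comap J.toLinearMap := by
  ext g
  rw [Submodule.mem_comap, mem_range_shift, mem_range_shift]
  constructor
  · rintro ⟨w, hw⟩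
    exact ⟨J w, by simpa using h.embed_mem_graph hw⟩
  · rintro ⟨u, hu⟩
    exact ⟨P u, by simpa [h.proj_embed] using h.proj_mem_graph hu⟩

theorem isFredholmAt (hA : IsFredholmAt A z) : IsFredholmAt B z := by
  refine hA.of_range_eq_comap ?_ J h.range_shift_eq_comap_embed
  have := finiteDimensional_eigenspace_iff.2 hA.finite_ker
  have := Submodule.finiteDimensional_of_le (h.map_eigenspace_le (z := z))
  exact (Submodule.equivMapOfInjective J.toLinearMap h.injective_embed
    (eigenspace B z)).symm.finiteDimensional

theorem eigenspace_eq_map (hz : RegularOnKer A P z) :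
    eigenspace A z = (eigenspace B z).map J.toLinearMap := by
  refine le_antisymm (fun u hu => ?_) h.map_eigenspace_le
  have hPu : P u ∈ eigenspace B z := by
    simpa [mem_eigenspace] using h.proj_mem_graph (mem_eigenspace.1 hu)
  have hJPu : J (P u) ∈ eigenspace A z := h.map_eigenspace_le ⟨P u, hPu, rfl⟩
  have hzero : u - J (P u) = 0 :=
    hz.inj (mem_eigenspace.1 (Submodule.sub_mem _ hu hJPu)) (by simp [h.proj_embed])
  exact ⟨P u, hPu, (sub_eq_zero.1 hzero).symm⟩

theorem range_shift_eq_comap_proj (hz : RegularOnKer A P z) :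
    LinearMap.range (shift A z) = (LinearMap.range (shift B z)).comap P.toLinearMap := by
  ext f
  rw [Submodule.mem_comap, mem_range_shift]
  constructor
  · rintro ⟨u, hu⟩
    exact mem_range_shift.2 ⟨P u, by simpa using h.proj_mem_graph hu⟩
  · intro hf
    have hJPf : J (P f) ∈ LinearMap.range (shift A z) := by
      rwa [h.range_shift_eq_comap_embed, Submodule.mem_comap] at hf
    have hrest : f - J (P f) ∈ LinearMap.range (shift A z) :=
      mem_range_shift.2 (hz.surj (by simp [h.proj_embed]))
    exact mem_range_shift.1 (by simpa only [add_sub_cancel] using Submodule.add_mem _ hJPf hrest)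

theorem isFredholmAt_of_regularOnKer (hz : RegularOnKer A P z) (hB : IsFredholmAt B z) :
    IsFredholmAt A z := by
  refine hB.of_range_eq_comap ?_ P (h.range_shift_eq_comap_proj hz)
  have := finiteDimensional_eigenspace_iff.2 hB.finite_ker
  rw [h.eigenspace_eq_map hz]
  infer_instance

theorem bijective_shift_iff_of_regularOnKer (hz : RegularOnKer A P z) :
    Function.Bijective (shift A z) ↔ Function.Bijective (shift B z) := by
  rw [bijective_shift_iff, bijective_shift_iff, h.eigenspace_eq_map hz,
    submodule_map_eq_bot_iff (f := J.toLinearMap) h.injective_embed]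
  refine and_congr_right fun _ => ⟨fun hA => ?_, fun hB => ?_⟩
  · rw [h.range_shift_eq_comap_embed, hA, Submodule.comap_top]
  · rw [h.range_shift_eq_comap_proj hz, hB, Submodule.comap_top]

theorem discreteSpectrum_eq (hz : ∀ z, IsFredholmAt B z → RegularOnKer A P z) :
    discreteSpectrum A = discreteSpectrum B := by
  ext z
  have hiff : IsFredholmAt A z ↔ IsFredholmAt B z :=
    ⟨h.isFredholmAt, fun hB => h.isFredholmAt_of_regularOnKer (hz z hB) hB⟩
  simp only [discreteSpectrum, spectrum, essentialSpectrum, Set.mem_sdiff, mem_ofPred_eq,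
    not_not, hiff]
  exact and_congr_left fun hB =>
    not_congr (h.bijective_shift_iff_of_regularOnKer (hz z hB))

end IsSummand

theorem not_tendsto_sub_of_orthonormal (E : Submodule ℂ H) [FiniteDimensional ℂ E] {e : ℕ → H}
    (he : Orthonormal ℂ e) (k : ℕ → E) : ¬ Tendsto (fun n => e n - k n) atTop (𝓝 0) := by
  intro hlim
  have := FiniteDimensional.proper ℂ E
  obtain ⟨M, hM⟩ := hlim.norm.bddAbove_range
  have hk : ∀ n, k n ∈ Metric.closedBall 0 (1 + M) := fun n => by
    rw [mem_closedBall_zero_iff]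
    calc ‖(k n : H)‖ = ‖e n - (e n - k n)‖ := by rw [sub_sub_cancel]
      _ ≤ ‖e n‖ + ‖e n - k n‖ := norm_sub_le _ _
      _ ≤ 1 + M := add_le_add (he.1 n).le (hM ⟨n, rfl⟩)
  obtain ⟨a, -, φ, hφ, ha⟩ := (isCompact_closedBall (0 : E) (1 + M)).tendsto_subseq hk
  have hea : Tendsto (fun n => e (φ n)) atTop (𝓝 (a : H)) := by
    simpa [Function.comp_def] using
      ((continuous_subtype_val.tendsto a).comp ha).add (hlim.comp hφ.tendsto_atTop)
  have hdist : ∀ n, ‖e (φ (n + 1)) - e (φ n)‖ ^ 2 = 2 := fun n => by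
    have hne : φ (n + 1) ≠ φ n := (hφ n.lt_succ_self).ne'
    rw [norm_sub_sq (𝕜 := ℂ), he.2 hne, he.1, he.1]
    norm_num
  have hdist0 := (((hea.comp (tendsto_add_atTop_nat 1)).sub hea).norm.pow 2)
  simp only [Function.comp_apply, hdist, sub_self, norm_zero] at hdist0
  simpa using tendsto_nhds_unique hdist0 tendsto_const_nhds

theorem IsFredholmAt.exists_mem_eigenspace_norm_sub_le [CompleteSpace H] (hA : A.IsClosed)
    (hF : IsFredholmAt A z) :
    ∃ C : ℝ, ∀ u g, (u, g + z • u) ∈ A.graph → ∃ k ∈ eigenspace A z, ‖u - k‖ ≤ C * ‖g‖ := by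
  have : CompleteSpace A.graph := IsClosed.completeSpace_coe (hs := hA)
  let R := LinearMap.range (shift A z)
  have : CompleteSpace R := hF.closed_range.completeSpace_coe
  let T : A.graph →L[ℂ] R :=
    ((ContinuousLinearMap.snd ℂ H H - z • ContinuousLinearMap.fst ℂ H H).comp
      A.graph.subtypeL).codRestrict R fun x => mem_range_shift.2 ⟨x.1.1, by simp⟩
  have hT : ∀ x : A.graph, (T x : H) = x.1.2 - z • x.1.1 := fun x => rfl
  have hsurj : Function.Surjective T := by
    rintro ⟨g, hg⟩
    obtain ⟨u, hu⟩ := mem_range_shift.1 hg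
    exact ⟨⟨_, hu⟩, Subtype.ext (by simp [hT])⟩
  obtain ⟨C, -, hpre⟩ := T.exists_preimage_norm_le hsurj
  refine ⟨C, fun u g hu => ?_⟩
  obtain ⟨x, hx, hxn⟩ := hpre ⟨g, mem_range_shift.2 ⟨u, hu⟩⟩
  refine ⟨u - x.1.1, mem_eigenspace.2 ?_, ?_⟩
  · have hxg : x.1.2 = g + z • x.1.1 := by
      rw [← sub_eq_iff_eq_add, ← hT, hx]
    have hsub : (u - x.1.1, g + z • u - x.1.2) ∈ A.graph := A.graph.sub_mem hu x.2
    rwa [hxg, add_sub_add_left_eq_sub, ← smul_sub] at hsub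
  · rw [sub_sub_cancel]
    exact (norm_fst_le x.1).trans hxn

/-- Weyl's criterion. -/
theorem not_isFredholmAt_of_orthonormal [CompleteSpace H] (hA : A.IsClosed) {e r : ℕ → H}
    (he : Orthonormal ℂ e) (hr : ∀ n, (e n, r n + z • e n) ∈ A.graph)
    (hlim : Tendsto r atTop (𝓝 0)) : ¬ IsFredholmAt A z := by
  intro hF
  obtain ⟨C, hC⟩ := hF.exists_mem_eigenspace_norm_sub_le hA
  choose k hk hke using fun n => hC _ _ (hr n)
  have := finiteDimensional_eigenspace_iff.2 hF.finite_ker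
  refine not_tendsto_sub_of_orthonormal (eigenspace A z) he (fun n => ⟨k n, hk n⟩) ?_
  exact squeeze_zero_norm hke (by simpa using hlim.norm.const_mul C)

end Operators

section ClosedForms

theorem exists_pos_mul_le_norm_sub {m : ℝ} (hm : 0 < m) {w : ℂ} (hw : w.im ≠ 0 ∨ w.re < m) :
    ∃ c : ℝ, 0 < c ∧ ∀ N n : ℝ, 0 ≤ n → m * n ≤ N → c * N ≤ ‖(N : ℂ) - w * n‖ := by
  rcases hw with hw | hw
  · -- The multiplier `a` is chosen so that the real part of `a * w` vanishes.
    let a : ℂ := ⟨1, w.re / w.im⟩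
    have ha : 0 < ‖a‖ := norm_pos_iff.2 fun h => by simpa [a] using congrArg Complex.re h
    refine ⟨‖a‖⁻¹, inv_pos.2 ha, fun N n _ _ => ?_⟩
    have hre : (a * ((N : ℂ) - w * n)).re = N := by
      simp [a, Complex.mul_re]
      field_simp
      ring
    rw [inv_mul_le_iff₀ ha, ← norm_mul]
    exact hre.symm.le.trans (Complex.re_le_norm _)
  · refine ⟨min 1 ((m - w.re) / m), lt_min one_pos (div_pos (by linarith) hm),
      fun N n hn hN => ?_⟩
    have hN0 : 0 ≤ N := (mul_nonneg hm.le hn).trans hN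
    suffices min 1 ((m - w.re) / m) * N ≤ N - w.re * n by
      simpa using this.trans ((by simp : N - w.re * n = ((N : ℂ) - w * n).re).le.trans
        (Complex.re_le_norm _))
    rcases le_total w.re 0 with h | h
    · nlinarith [mul_le_mul_of_nonneg_right (min_le_left 1 ((m - w.re) / m)) hN0]
    · calc min 1 ((m - w.re) / m) * N ≤ (m - w.re) / m * N := by gcongr; exact min_le_right _ _
        _ = N - w.re * (N / m) := by field_simp
        _ ≤ N - w.re * n := by gcongr; rwa [le_div_iff₀' hm]

/-- The Lax–Milgram lemma for the form `⟪v, u⟫ - w ⟪J v, J u⟫`. -/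
theorem exists_forall_inner_sub_eq {V H : Type*} [NormedAddCommGroup V] [InnerProductSpace ℂ V]
    [CompleteSpace V] [NormedAddCommGroup H] [InnerProductSpace ℂ H] [CompleteSpace H]
    (J : V →L[ℂ] H) {m : ℝ} (hm : 0 < m) (hJ : ∀ u, m * ‖J u‖ ^ 2 ≤ ‖u‖ ^ 2) {w : ℂ}
    (hw : w.im ≠ 0 ∨ w.re < m) (f : H) :
    ∃ u : V, ∀ v, inner ℂ v u - w * inner ℂ (J v) (J u) = inner ℂ (J v) f := by
  obtain ⟨c, hc, hcoer⟩ := exists_pos_mul_le_norm_sub hm hw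
  let M : V →L[ℂ] V := 1 - w • (J.adjoint.comp J)
  have hM : ∀ v u, inner ℂ v (M u) = inner ℂ v u - w * inner ℂ (J v) (J u) := fun v u => by
    simp [M, ContinuousLinearMap.adjoint_inner_right]
  have hcoercive : ∀ u, ‖u‖ ^ 2 * c ≤ ‖inner ℂ (M u) u‖ := fun u => by
    rw [norm_inner_symm, hM, inner_self_eq_norm_sq_to_K, inner_self_eq_norm_sq_to_K, mul_comm]
    simpa using hcoer (‖u‖ ^ 2) (‖J u‖ ^ 2) (by positivity) (hJ u)
  obtain ⟨N, hN⟩ := (ContinuousLinearMap.isUnit_of_forall_le_norm_inner_map M (c := ⟨c, hc.le⟩) hc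
    hcoercive).exists_right_inv
  refine ⟨N (J.adjoint f), fun v => ?_⟩
  have hMN : M (N (J.adjoint f)) = J.adjoint f := DFunLike.congr_fun hN _
  rw [← hM, hMN, ContinuousLinearMap.adjoint_inner_right]

theorem exists_mem_forall_inner_sub_eq {E H : Type*} [NormedAddCommGroup E]
    [InnerProductSpace ℂ E] [CompleteSpace E] [NormedAddCommGroup H] [InnerProductSpace ℂ H]
    [CompleteSpace H] {V : Submodule ℂ E} (hV : IsClosed (V : Set E)) (J : E →L[ℂ] H) {m : ℝ}
    (hm : 0 < m) (hJ : ∀ u ∈ V, m * ‖J u‖ ^ 2 ≤ ‖u‖ ^ 2) {w : ℂ} (hw : w.im ≠ 0 ∨ w.re < m)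
    (f : H) : ∃ u ∈ V, ∀ v ∈ V, inner ℂ v u - w * inner ℂ (J v) (J u) = inner ℂ (J v) f := by
  have : CompleteSpace V := hV.completeSpace_coe
  obtain ⟨u, hu⟩ := exists_forall_inner_sub_eq (J.comp V.subtypeL) hm (fun u => hJ u u.2) hw f
  exact ⟨u, u.2, fun v hv => hu ⟨v, hv⟩⟩

variable {H₀ H₁ H₂ : Type*} [NormedAddCommGroup H₀] [InnerProductSpace ℂ H₀]
  [NormedAddCommGroup H₁] [InnerProductSpace ℂ H₁]
  [NormedAddCommGroup H₂] [InnerProductSpace ℂ H₂]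

/-- `m` is a lower bound of the quadratic form `‖g₁‖² + ‖g₂‖²` of the triples `(u, g₁, g₂)` in
`W`, relative to `‖u‖²`. -/
def IsFormLowerBound (W : Submodule ℂ (H₀ × H₁ × H₂)) (m : ℝ) : Prop :=
  ∀ p ∈ W, m * ‖p.1‖ ^ 2 ≤ ‖p.2.1‖ ^ 2 + ‖p.2.2‖ ^ 2

variable {W : Submodule ℂ (H₀ × H₁ × H₂)} {m : ℝ} {z : ℂ}

theorem IsFormLowerBound.fst_eq_zero (hW : IsFormLowerBound W m) (hz : z.im ≠ 0 ∨ z.re < m)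
    {p : H₀ × H₁ × H₂} (hp : p ∈ W)
    (heq : inner ℂ p.2.1 p.2.1 + inner ℂ p.2.2 p.2.2 = z * inner ℂ p.1 p.1) : p.1 = 0 := by
  simp only [inner_self_eq_norm_sq_to_K] at heq
  have hre : ‖p.2.1‖ ^ 2 + ‖p.2.2‖ ^ 2 = z.re * ‖p.1‖ ^ 2 := by
    simpa [← Complex.ofReal_pow] using congrArg Complex.re heq
  have him : 0 = z.im * ‖p.1‖ ^ 2 := by
    simpa [← Complex.ofReal_pow] using congrArg Complex.im heq
  have hsq : ‖p.1‖ ^ 2 = 0 := by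
    rcases hz with hz | hz
    · exact (mul_eq_zero.1 him.symm).resolve_left hz
    · have := hW p hp
      nlinarith [sq_nonneg ‖p.1‖]
  simpa using hsq

/-- Triples with their Hilbert space norm, identified with triples with the maximum norm. -/
noncomputable def toTriple (H₀ H₁ H₂ : Type*) [NormedAddCommGroup H₀] [InnerProductSpace ℂ H₀]
    [NormedAddCommGroup H₁] [InnerProductSpace ℂ H₁]
    [NormedAddCommGroup H₂] [InnerProductSpace ℂ H₂] :
    WithLp 2 (H₀ × WithLp 2 (H₁ × H₂)) ≃L[ℂ] H₀ × H₁ × H₂ :=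
  (WithLp.prodContinuousLinearEquiv 2 ℂ H₀ (WithLp 2 (H₁ × H₂))).trans
    ((ContinuousLinearEquiv.refl ℂ H₀).prodCongr (WithLp.prodContinuousLinearEquiv 2 ℂ H₁ H₂))

theorem inner_eq_toTriple (x y : WithLp 2 (H₀ × WithLp 2 (H₁ × H₂))) :
    inner ℂ x y = inner ℂ (toTriple H₀ H₁ H₂ x).1 (toTriple H₀ H₁ H₂ y).1 +
      (inner ℂ (toTriple H₀ H₁ H₂ x).2.1 (toTriple H₀ H₁ H₂ y).2.1 +
        inner ℂ (toTriple H₀ H₁ H₂ x).2.2 (toTriple H₀ H₁ H₂ y).2.2) := by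
  rw [WithLp.prod_inner_apply, WithLp.prod_inner_apply]
  rfl

theorem norm_sq_eq_toTriple (x : WithLp 2 (H₀ × WithLp 2 (H₁ × H₂))) :
    ‖x‖ ^ 2 = ‖(toTriple H₀ H₁ H₂ x).1‖ ^ 2 +
      (‖(toTriple H₀ H₁ H₂ x).2.1‖ ^ 2 + ‖(toTriple H₀ H₁ H₂ x).2.2‖ ^ 2) := by
  rw [WithLp.prod_norm_sq_eq_of_L2, WithLp.prod_norm_sq_eq_of_L2]
  rfl

theorem IsFormLowerBound.exists_weak_solution [CompleteSpace H₀] [CompleteSpace H₁]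
    [CompleteSpace H₂] (hW : IsFormLowerBound W m) (hclosed : IsClosed (W : Set (H₀ × H₁ × H₂)))
    (hm : 0 ≤ m) (hz : z.im ≠ 0 ∨ z.re < m) (f : H₀) :
    ∃ p ∈ W, ∀ v ∈ W,
      inner ℂ v.2.1 p.2.1 + inner ℂ v.2.2 p.2.2 = inner ℂ v.1 (f + z • p.1) := by
  let e := toTriple H₀ H₁ H₂
  let V := W.comap e.toLinearMap
  have hbound : ∀ u ∈ V, (1 + m) * ‖(e u).1‖ ^ 2 ≤ ‖u‖ ^ 2 := fun u hu => by
    have := hW _ hu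
    rw [norm_sq_eq_toTriple]
    change m * ‖(e u).1‖ ^ 2 ≤ ‖(e u).2.1‖ ^ 2 + ‖(e u).2.2‖ ^ 2 at this
    linarith
  obtain ⟨u, hu, h⟩ := exists_mem_forall_inner_sub_eq (V := V) (hclosed.preimage e.continuous)
    ((ContinuousLinearMap.fst ℂ _ _).comp e.toContinuousLinearMap)
    (by linarith) hbound (w := 1 + z) (by simpa using hz) f
  refine ⟨e u, hu, fun v hv => ?_⟩
  have huv : inner ℂ v.1 (e u).1 + (inner ℂ v.2.1 (e u).2.1 + inner ℂ v.2.2 (e u).2.2) -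
      (1 + z) * inner ℂ v.1 (e u).1 = inner ℂ v.1 f := by
    have := h (e.symm v) (by simpa [V] using hv)
    rw [inner_eq_toTriple] at this
    simpa [e] using this
  rw [inner_add_right, inner_smul_right, ← huv]
  ring

theorem norm_gradient_le {p : H₀ × H₁ × H₂} {f : H₀}
    (h : inner ℂ p.2.1 p.2.1 + inner ℂ p.2.2 p.2.2 = inner ℂ p.1 f) :
    ‖p.2‖ ≤ ‖(p.1, f)‖ := by
  have hp : ‖p.1‖ ≤ ‖(p.1, f)‖ := norm_fst_le (p.1, f)
  have hf : ‖f‖ ≤ ‖(p.1, f)‖ := norm_snd_le (p.1, f)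
  have henergy : ‖p.2.1‖ ^ 2 + ‖p.2.2‖ ^ 2 ≤ ‖(p.1, f)‖ ^ 2 :=
    calc ‖p.2.1‖ ^ 2 + ‖p.2.2‖ ^ 2 = (inner ℂ p.1 f : ℂ).re := by
          rw [← h, inner_self_eq_norm_sq_to_K, inner_self_eq_norm_sq_to_K]
          simp [← Complex.ofReal_pow]
      _ ≤ ‖p.1‖ * ‖f‖ := (Complex.re_le_norm _).trans (norm_inner_le_norm _ _)
      _ ≤ ‖(p.1, f)‖ ^ 2 := by rw [sq]; gcongr
  rw [norm_prod_le_iff]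
  constructor <;> refine le_of_sq_le_sq ?_ (norm_nonneg _) <;> nlinarith

theorem isClosed_setOf_weak_solution (hclosed : IsClosed (W : Set (H₀ × H₁ × H₂))) :
    IsClosed {x : (H₀ × H₁ × H₂) × H₀ | x.1 ∈ W ∧
      ∀ v ∈ W, inner ℂ v.2.1 x.1.2.1 + inner ℂ v.2.2 x.1.2.2 = inner ℂ v.1 x.2} := by
  simp only [ofPred_and, ofPred_forall]
  exact (hclosed.preimage continuous_fst).inter
    (isClosed_biInter fun v _ => isClosed_eq (by fun_prop) (by fun_prop))

/-- The operator associated with a closed form is closed: a weak solution `p` of `A u = f` depends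
continuously on the point `(u, f)` of the graph. -/
theorem isClosed_setOf_exists_weak_solution [CompleteSpace H₀] [CompleteSpace H₁]
    [CompleteSpace H₂] (hclosed : IsClosed (W : Set (H₀ × H₁ × H₂))) :
    IsClosed {q : H₀ × H₀ | ∃ p ∈ W, p.1 = q.1 ∧
      ∀ v ∈ W, inner ℂ v.2.1 p.2.1 + inner ℂ v.2.2 p.2.2 = inner ℂ v.1 q.2} := by
  let X : Set ((H₀ × H₁ × H₂) × H₀) := {x | x.1 ∈ W ∧
    ∀ v ∈ W, inner ℂ v.2.1 x.1.2.1 + inner ℂ v.2.2 x.1.2.2 = inner ℂ v.1 x.2}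
  have : CompleteSpace X := (isClosed_setOf_weak_solution hclosed).completeSpace_coe
  let T : X → H₀ × H₀ := fun x => (x.1.1.1, x.1.2)
  have hT : AntilipschitzWith 1 T := AntilipschitzWith.of_le_mul_dist fun x y => by
    obtain ⟨⟨p, f⟩, hp, hpf⟩ := x
    obtain ⟨⟨q, g⟩, hq, hqg⟩ := y
    have hgrad : ‖(p - q).2‖ ≤ ‖((p - q).1, f - g)‖ := norm_gradient_le (by
      have hv : p - q ∈ W := W.sub_mem hp hq
      rw [inner_sub_right, ← hpf _ hv, ← hqg _ hv, Prod.snd_sub, Prod.fst_sub, Prod.snd_sub,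
        inner_sub_right, inner_sub_right]
      ring)
    rw [Subtype.dist_eq, dist_eq_norm, dist_eq_norm, NNReal.coe_one, one_mul]
    change ‖(p - q, f - g)‖ ≤ ‖((p - q).1, f - g)‖
    rw [norm_prod_le_iff, norm_prod_le_iff]
    exact ⟨⟨norm_fst_le ((p - q).1, f - g), hgrad⟩, norm_snd_le ((p - q).1, f - g)⟩
  have hTu : UniformContinuous T :=
    (uniformContinuous_fst.comp uniformContinuous_fst).prodMk uniformContinuous_snd |>.comp
      uniformContinuous_subtype_val
  have hrange : range T = {q : H₀ × H₀ | ∃ p ∈ W, p.1 = q.1 ∧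
      ∀ v ∈ W, inner ℂ v.2.1 p.2.1 + inner ℂ v.2.2 p.2.2 = inner ℂ v.1 q.2} := by
    ext q
    constructor
    · rintro ⟨⟨⟨p, f⟩, hp, h⟩, rfl⟩
      exact ⟨p, hp, rfl, h⟩
    · rintro ⟨p, hp, hpq, h⟩
      exact ⟨⟨(p, q.2), hp, h⟩, Prod.ext hpq rfl⟩
  rw [← hrange]
  exact hT.isClosed_range hTu

end ClosedForms

section SquareIntegrable

variable {α : Type*} [MeasurableSpace α] {μ : Measure α}

theorem norm_sq_eq_integral (f : Lp ℂ 2 μ) : ‖f‖ ^ 2 = ∫ x, ‖f x‖ ^ 2 ∂μ := by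
  rw [← inner_self_eq_norm_sq (𝕜 := ℂ), L2.inner_def, ← integral_re (L2.integrable_inner f f)]
  simp only [inner_self_eq_norm_sq]

theorem inner_eq_integral {v g : Lp ℂ 2 μ} {φ γ : α → ℂ} (hv : v =ᵐ[μ] φ) (hg : g =ᵐ[μ] γ) :
    inner ℂ v g = ∫ x, star (φ x) * γ x ∂μ := by
  rw [L2.inner_def]
  refine integral_congr_ae ?_
  filter_upwards [hv, hg] with x h1 h2
  simp [h1, h2, mul_comm]

theorem continuous_integral_mul {k : α → ℂ} (hk : MemLp k 2 μ) :
    Continuous fun f : Lp ℂ 2 μ => ∫ x, k x * f x ∂μ := by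
  have h : (fun f : Lp ℂ 2 μ => ∫ x, k x * f x ∂μ) =
      fun f => inner ℂ (hk.star.toLp (star k)) f := by
    ext f
    rw [inner_eq_integral hk.star.coeFn_toLp (ae_eq_refl f)]
    simp
  rw [h]
  fun_prop

theorem tendsto_toLp_of_dominated {f : ℕ → α → ℂ} (hf : ∀ n, MemLp (f n) 2 μ) {g : α → ℝ}
    (hg : MemLp g 2 μ) (hfg : ∀ n, ∀ᵐ x ∂μ, ‖f n x‖ ≤ g x) {p : Lp ℂ 2 μ}
    (hlim : ∀ᵐ x ∂μ, Tendsto (fun n => f n x) atTop (𝓝 (p x))) :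
    Tendsto (fun n => (hf n).toLp (f n)) atTop (𝓝 p) := by
  have hint : ∀ n, ‖(hf n).toLp (f n) - p‖ ^ 2 = ∫ x, ‖f n x - p x‖ ^ 2 ∂μ := fun n => by
    rw [norm_sq_eq_integral]
    refine integral_congr_ae ?_
    filter_upwards [Lp.coeFn_sub ((hf n).toLp (f n)) p, (hf n).coeFn_toLp] with x h1 h2
    rw [h1, Pi.sub_apply, h2]
  have hsq : Tendsto (fun n => ‖(hf n).toLp (f n) - p‖ ^ 2) atTop (𝓝 0) := by
    simp only [hint]
    rw [← integral_zero α ℝ (μ := μ)]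
    refine tendsto_integral_of_dominated_convergence (fun x => (g x + ‖p x‖) ^ 2)
      (fun n => ((hf n).aestronglyMeasurable.sub (Lp.aestronglyMeasurable p)).norm.pow 2)
      (hg.add (Lp.memLp p).norm).integrable_sq (fun n => ?_) ?_
    · filter_upwards [hfg n] with x hx
      rw [Real.norm_of_nonneg (by positivity)]
      gcongr
      exact (norm_sub_le _ _).trans (by gcongr)
    · filter_upwards [hlim] with x hx
      simpa using (hx.sub_const (p x)).norm.pow 2
  rw [tendsto_iff_norm_sub_tendsto_zero]
  simpa [Real.sqrt_sq (norm_nonneg _)] using hsq.sqrt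

end SquareIntegrable

section WeightedPullback

variable {α β : Type*} [MeasurableSpace α] [MeasurableSpace β] {μ : Measure α} {ν : Measure β}

/-- The data of a weighted pullback `f ↦ m · (f ∘ T)` from `L²(ν)` to `L²(μ)`. -/
structure IsWeightedPullback (T : α → β) (m : α → ℂ) (μ : Measure α) (ν : Measure β) : Prop where
  measurable : Measurable T
  map_le : ∃ c : ℝ≥0∞, c ≠ ⊤ ∧ μ.map T ≤ c • ν
  measurable_weight : Measurable m
  norm_weight_le : ∀ x, ‖m x‖ ≤ 1

namespace IsWeightedPullback

variable {T : α → β} {m : α → ℂ} (h : IsWeightedPullback T m μ ν)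
include h

theorem ae_comp {f g : β → ℂ} (hfg : f =ᵐ[ν] g) : ∀ᵐ x ∂μ, f (T x) = g (T x) := by
  obtain ⟨c, -, hc⟩ := h.map_le
  exact Measure.QuasiMeasurePreserving.ae_eq_comp
    ⟨h.measurable, Measure.absolutelyContinuous_of_le_smul hc⟩ hfg

theorem norm_weight_mul_le (f : β → ℂ) (x : α) : ‖m x * f (T x)‖ ≤ ‖(f ∘ T) x‖ := by
  rw [norm_mul]
  exact mul_le_of_le_one_left (norm_nonneg _) (h.norm_weight_le x)

theorem memLp {f : β → ℂ} (hf : MemLp f 2 ν) : MemLp (fun x => m x * f (T x)) 2 μ := by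
  obtain ⟨c, hc, hle⟩ := h.map_le
  have hcomp : MemLp (f ∘ T) 2 μ :=
    (hf.of_measure_le_smul hc hle).comp_of_map h.measurable.aemeasurable
  exact hcomp.mono
    (h.measurable_weight.aestronglyMeasurable.mul hcomp.aestronglyMeasurable)
    (Eventually.of_forall (h.norm_weight_mul_le f))

theorem exists_eLpNorm_le : ∃ C : ℝ≥0∞, C ≠ ⊤ ∧ ∀ f : β → ℂ, MemLp f 2 ν →
    eLpNorm (fun x => m x * f (T x)) 2 μ ≤ C * eLpNorm f 2 ν := by
  obtain ⟨c, hc, hle⟩ := h.map_le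
  refine ⟨c ^ (1 / (2 : ℝ≥0∞)).toReal, by simp [hc], fun f hf => ?_⟩
  calc eLpNorm (fun x => m x * f (T x)) 2 μ ≤ eLpNorm (f ∘ T) 2 μ :=
        eLpNorm_mono (h.norm_weight_mul_le f)
    _ = eLpNorm f 2 (μ.map T) :=
        (eLpNorm_map_measure (hf.of_measure_le_smul hc hle).aestronglyMeasurable
          h.measurable.aemeasurable).symm
    _ ≤ eLpNorm f 2 (c • ν) := eLpNorm_mono_measure _ hle
    _ = c ^ (1 / (2 : ℝ≥0∞)).toReal * eLpNorm f 2 ν :=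
        eLpNorm_smul_measure_of_ne_top (by simp) _ _

end IsWeightedPullback

/-- The weighted pullback `f ↦ m · (f ∘ T)` as a bounded operator. -/
noncomputable def weightedPullback {T : α → β} {m : α → ℂ} (h : IsWeightedPullback T m μ ν) :
    Lp ℂ 2 ν →L[ℂ] Lp ℂ 2 μ :=
  LinearMap.mkContinuousOfExistsBound
    { toFun := fun f => (h.memLp (Lp.memLp f)).toLp _
      map_add' := fun f g => by
        rw [← MemLp.toLp_add, MemLp.toLp_eq_toLp_iff]
        filter_upwards [h.ae_comp (Lp.coeFn_add f g)] with x hx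
        simp only [hx, Pi.add_apply, mul_add]
      map_smul' := fun c f => by
        rw [RingHom.id_apply, ← MemLp.toLp_const_smul, MemLp.toLp_eq_toLp_iff]
        filter_upwards [h.ae_comp (Lp.coeFn_smul c f)] with x hx
        simp only [hx, Pi.smul_apply, smul_eq_mul]
        ring }
    (by
      obtain ⟨C, hC, hle⟩ := h.exists_eLpNorm_le
      refine ⟨C.toReal, fun f => ?_⟩
      rw [LinearMap.coe_mk, AddHom.coe_mk, Lp.norm_toLp, Lp.norm_def, ← ENNReal.toReal_mul]
      exact ENNReal.toReal_mono (ENNReal.mul_ne_top hC (Lp.eLpNorm_ne_top f))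
        (hle f (Lp.memLp f)))

theorem weightedPullback_ae {T : α → β} {m : α → ℂ} (h : IsWeightedPullback T m μ ν)
    {f : Lp ℂ 2 ν} {g : β → ℂ} (hg : f =ᵐ[ν] g) :
    weightedPullback h f =ᵐ[μ] fun x => m x * g (T x) := by
  filter_upwards [(h.memLp (Lp.memLp f)).coeFn_toLp, h.ae_comp hg] with x h1 h2
  exact h1.trans (by rw [h2])

end WeightedPullback

namespace IsTest

variable {S U : Set (ℝ × ℝ)} {φ η g : ℝ × ℝ → ℂ}

theorem mono {S' : Set (ℝ × ℝ)} (h : IsTest S φ) (hS : S ⊆ S') : IsTest S' φ :=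
  ⟨h.smooth, h.compact, h.supp.trans hS⟩

theorem mul_right (h : IsTest S φ) (hg : ContDiff ℝ ∞ g) : IsTest S (fun x => φ x * g x) :=
  ⟨h.smooth.mul hg, h.compact.mul_right, (tsupport_mul_subset_left).trans h.supp⟩

theorem indicator (hU : IsOpen U) (h : IsTest (frontier U)ᶜ η) : IsTest U (U.indicator η) := by
  have hle : Function.support (U.indicator η) ⊆ Function.support η := by
    rw [support_indicator]
    exact inter_subset_right
  have hsupp : tsupport (U.indicator η) ⊆ U := fun x hx => by
    have hxU : x ∈ closure U := closure_mono support_indicator_subset hx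
    rw [closure_eq_self_union_frontier] at hxU
    exact hxU.resolve_right (h.supp (closure_mono hle hx))
  refine ⟨contDiff_iff_contDiffAt.2 fun x => ?_, h.compact.mono hle, hsupp⟩
  by_cases hx : x ∈ tsupport (U.indicator η)
  · refine h.smooth.contDiffAt.congr_of_eventuallyEq ?_
    filter_upwards [hU.mem_nhds (hsupp hx)] with y hy using indicator_of_mem hy η
  · exact contDiffAt_const.congr_of_eventuallyEq (notMem_tsupport_iff_eventuallyEq.1 hx)

theorem integral_fderiv_eq_zero (h : IsTest S φ) (v : ℝ × ℝ) : ∫ x, fderiv ℝ φ x v = 0 := by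
  have := integral_mul_fderiv_eq_neg_fderiv_mul_of_integrable (μ := (volume : Measure (ℝ × ℝ)))
    (f := fun _ => (1 : ℂ)) (g := φ) (v := v) (by simp)
    (by simpa using (h.continuous_pd v).integrable_of_hasCompactSupport (h.compact_pd v))
    (by simpa using h.smooth.continuous.integrable_of_hasCompactSupport h.compact)
    (fun x _ => by fun_prop) (fun x _ => h.differentiable x)
  simpa using this

theorem setIntegral_fderiv_eq_zero (hU : IsOpen U) (h : IsTest (frontier U)ᶜ η) (v : ℝ × ℝ) :
    ∫ x in U, fderiv ℝ η x v = 0 := by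
  have hi := h.indicator hU
  have hext : ∀ x ∈ U, fderiv ℝ (U.indicator η) x v = fderiv ℝ η x v := fun x hx => by
    have : U.indicator η =ᶠ[𝓝 x] η := by
      filter_upwards [hU.mem_nhds hx] with y hy using indicator_of_mem hy η
    rw [this.fderiv_eq]
  have hzero : ∀ x ∉ U, fderiv ℝ (U.indicator η) x v = 0 := fun x hx => by
    rw [image_eq_zero_of_notMem_tsupport fun h' => hx (hi.supp (tsupport_fderiv_subset ℝ h'))]
    rfl
  rw [← setIntegral_congr_fun hU.measurableSet hext,
    setIntegral_eq_integral_of_forall_compl_eq_zero hzero, hi.integral_fderiv_eq_zero v]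

end IsTest

section FormDomain

variable {U Γ : Set (ℝ × ℝ)}

theorem subset_compl_frontier (hU : IsOpen U) : U ⊆ (frontier U)ᶜ :=
  (disjoint_iff_inter_eq_empty.2 hU.inter_frontier_eq).subset_compl_right

theorem smoothTriples_le_H1 (hU : IsOpen U) : smoothTriples U Γ ≤ H1 U := by
  rintro p ⟨φ, hφ, h0, h1, h2⟩ χ hχ
  have hparts : ∀ (v : ℝ × ℝ) (g : L2 U), g =ᵐ[volume.restrict U] (fun x => fderiv ℝ φ x v) →
      ∫ x in U, fderiv ℝ χ x v * p.1 x = - ∫ x in U, χ x * g x := by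
    intro v g hg
    rw [eq_neg_iff_add_eq_zero, ← integral_add (hχ.integrable_pd_mul _ _) (hχ.integrable_mul _),
      ← ((hχ.mono (subset_compl_frontier hU)).mul_right hφ.smooth).setIntegral_fderiv_eq_zero hU v]
    refine integral_congr_ae ?_
    filter_upwards [h0, hg] with x hx0 hx1
    rw [fderiv_fun_mul (hχ.differentiable x) (hφ.differentiable x), hx0, hx1]
    simp
    ring
  exact ⟨hparts _ _ h1, hparts _ _ h2⟩

theorem isClosed_H1 : IsClosed (H1 U : Set (L2 U × L2 U × L2 U)) := by
  have hH1 : (H1 U : Set (L2 U × L2 U × L2 U)) = ⋂ (φ : ℝ × ℝ → ℂ) (_ : IsTest U φ),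
      ({p | ∫ x in U, pd1 φ x * p.1 x = - ∫ x in U, φ x * p.2.1 x} ∩
        {p | ∫ x in U, pd2 φ x * p.1 x = - ∫ x in U, φ x * p.2.2 x}) := by
    ext p
    simp only [mem_iInter]
    rfl
  rw [hH1]
  refine isClosed_iInter fun φ => isClosed_iInter fun hφ => IsClosed.inter ?_ ?_
  · exact isClosed_eq ((continuous_integral_mul (hφ.memLp_pd (1, 0) _)).comp continuous_fst)
      ((continuous_integral_mul (hφ.memLp _)).comp (continuous_fst.comp continuous_snd)).neg
  · exact isClosed_eq ((continuous_integral_mul (hφ.memLp_pd (0, 1) _)).comp continuous_fst)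
      ((continuous_integral_mul (hφ.memLp _)).comp (continuous_snd.comp continuous_snd)).neg

theorem formDomain_eq_closure (hU : IsOpen U) :
    formDomain U Γ = (smoothTriples U Γ).topologicalClosure :=
  inf_eq_right.2 (Submodule.topologicalClosure_minimal _ (smoothTriples_le_H1 hU) isClosed_H1)

theorem isClosed_formDomain (hU : IsOpen U) :
    IsClosed (formDomain U Γ : Set (L2 U × L2 U × L2 U)) := by
  rw [formDomain_eq_closure hU]
  exact Submodule.isClosed_topologicalClosure _

theorem smoothTriples_le_formDomain (hU : IsOpen U) : smoothTriples U Γ ≤ formDomain U Γ := by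
  rw [formDomain_eq_closure hU]
  exact Submodule.le_topologicalClosure _

theorem mem_of_mem_formDomain (hU : IsOpen U) {C : Set (L2 U × L2 U × L2 U)} (hC : IsClosed C)
    (h : ∀ p ∈ smoothTriples U Γ, p ∈ C) {p : L2 U × L2 U × L2 U} (hp : p ∈ formDomain U Γ) :
    p ∈ C := by
  rw [formDomain_eq_closure hU] at hp
  exact closure_minimal h hC hp

theorem map_mem_of_mem_formDomain {U' : Set (ℝ × ℝ)} (hU : IsOpen U)
    {C : Submodule ℂ (L2 U' × L2 U' × L2 U')} (hC : IsClosed (C : Set (L2 U' × L2 U' × L2 U')))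
    (L : L2 U × L2 U × L2 U →L[ℂ] L2 U' × L2 U' × L2 U')
    (h : ∀ p ∈ smoothTriples U Γ, L p ∈ C) {p : L2 U × L2 U × L2 U} (hp : p ∈ formDomain U Γ) :
    L p ∈ C :=
  mem_of_mem_formDomain hU (hC.preimage L.continuous) h hp

theorem mem_formDomain_of_tendsto (hU : IsOpen U) {ψ : ℕ → ℝ × ℝ → ℂ}
    (hψ : ∀ n, IsTest Γᶜ (ψ n)) {K : Set (ℝ × ℝ)} (hK : IsCompact K)
    (hsupp : ∀ n, tsupport (ψ n) ⊆ K) {C : ℝ} (h0 : ∀ n x, ‖ψ n x‖ ≤ C)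
    (h1 : ∀ n x, ‖pd1 (ψ n) x‖ ≤ C) (h2 : ∀ n x, ‖pd2 (ψ n) x‖ ≤ C)
    {p : L2 U × L2 U × L2 U}
    (l0 : ∀ᵐ x ∂volume.restrict U, Tendsto (fun n => ψ n x) atTop (𝓝 (p.1 x)))
    (l1 : ∀ᵐ x ∂volume.restrict U, Tendsto (fun n => pd1 (ψ n) x) atTop (𝓝 (p.2.1 x)))
    (l2 : ∀ᵐ x ∂volume.restrict U, Tendsto (fun n => pd2 (ψ n) x) atTop (𝓝 (p.2.2 x))) :
    p ∈ formDomain U Γ := by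
  let μ := volume.restrict U
  have hbound : MemLp (K.indicator fun _ => C) 2 μ :=
    memLp_indicator_const 2 hK.measurableSet C (Or.inr hK.measure_lt_top.ne)
  have hdom : ∀ {f : ℝ × ℝ → ℂ}, (∀ x, ‖f x‖ ≤ C) → tsupport f ⊆ K →
      ∀ᵐ x ∂μ, ‖f x‖ ≤ K.indicator (fun _ => C) x := fun {f} hf hfK => ae_of_all _ fun x => by
    by_cases hx : x ∈ K
    · simpa [hx] using hf x
    · simp [hx, image_eq_zero_of_notMem_tsupport fun h => hx (hfK h)]
  have hpd : ∀ n v, tsupport (fun x => fderiv ℝ (ψ n) x v) ⊆ K := fun n v =>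
    (tsupport_fderiv_apply_subset ℝ v).trans (hsupp n)
  have m0 := fun n => (hψ n).memLp μ
  have m1 := fun n => (hψ n).memLp_pd (1, 0) μ
  have m2 := fun n => (hψ n).memLp_pd (0, 1) μ
  rw [formDomain_eq_closure hU]
  refine mem_closure_of_tendsto (f := fun n => ((m0 n).toLp _, (m1 n).toLp _, (m2 n).toLp _))
    (b := atTop) (Tendsto.prodMk_nhds ?_ (Tendsto.prodMk_nhds ?_ ?_)) ?_
  · exact tendsto_toLp_of_dominated m0 hbound (fun n => hdom (h0 n) (hsupp n)) l0
  · exact tendsto_toLp_of_dominated m1 hbound (fun n => hdom (h1 n) (hpd n _)) l1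
  · exact tendsto_toLp_of_dominated m2 hbound (fun n => hdom (h2 n) (hpd n _)) l2
  · exact Eventually.of_forall fun n =>
      ⟨ψ n, hψ n, (m0 n).coeFn_toLp, (m1 n).coeFn_toLp, (m2 n).coeFn_toLp⟩

theorem isClosed_laplacianGraph (hU : IsOpen U) :
    IsClosed (laplacianGraph U Γ : Set (L2 U × L2 U)) :=
  isClosed_setOf_exists_weak_solution (isClosed_formDomain hU)

end FormDomain

section Reflection

variable {U : Set (ℝ × ℝ)} {x : ℝ × ℝ}

/-- The folding `(x₁, x₂) ↦ (x₁, |x₂|)` of the plane onto the closed upper half-plane. -/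
def fold (x : ℝ × ℝ) : ℝ × ℝ := (x.1, |x.2|)

/-- The reflection `(x₁, x₂) ↦ (x₁, -x₂)` across the axis. -/
def reflect : (ℝ × ℝ) ≃ₜ (ℝ × ℝ) := (Homeomorph.refl ℝ).prodCongr (Homeomorph.neg ℝ)

/-- The part of `U` above the axis; `halfGuide θ` unfolds to `upperHalf (guide θ)`. -/
def upperHalf (U : Set (ℝ × ℝ)) : Set (ℝ × ℝ) := {x ∈ U | 0 < x.2}

/-- The part of the boundary of `upperHalf U` inherited from `U`; `dirichletBoundary θ` unfolds to
`upperBoundary (guide θ)`. -/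
def upperBoundary (U : Set (ℝ × ℝ)) : Set (ℝ × ℝ) := frontier U ∩ frontier (upperHalf U)

/-- Open subsets of the plane that are symmetric with respect to the axis `x₂ = 0`. -/
structure IsSymmetricDomain (U : Set (ℝ × ℝ)) : Prop where
  isOpen : IsOpen U
  preimage_reflect : reflect ⁻¹' U = U

theorem continuous_fold : Continuous fold := by unfold fold; fun_prop

@[simp] theorem reflect_apply (x : ℝ × ℝ) : reflect x = (x.1, -x.2) := rfl

theorem reflect_reflect (x : ℝ × ℝ) : reflect (reflect x) = x := by simp

theorem fold_reflect (x : ℝ × ℝ) : fold (reflect x) = fold x := by simp [fold]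

theorem fold_of_pos (hx : 0 < x.2) : fold x = x := by simp [fold, abs_of_pos hx]

theorem fold_eq_or (x : ℝ × ℝ) : fold x = x ∨ fold x = reflect x := by
  rcases abs_choice x.2 with h | h <;> simp [fold, h]

theorem upperHalf_subset : upperHalf U ⊆ U := fun _ hx => hx.1

theorem isClosed_upperBoundary : IsClosed (upperBoundary U) :=
  isClosed_frontier.inter isClosed_frontier

theorem mem_closure_upperHalf (hU : IsOpen U) (hx : x ∈ U) (h : 0 ≤ x.2) :
    x ∈ closure (upperHalf U) := by
  refine hU.inter_closure (t := Prod.snd ⁻¹' Ioi (0 : ℝ)) ⟨hx, ?_⟩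
  rw [← isOpenMap_snd.preimage_closure_eq_closure_preimage continuous_snd, closure_Ioi]
  exact h

namespace IsSymmetricDomain

variable (h : IsSymmetricDomain U)
include h

theorem isOpen_upperHalf : IsOpen (upperHalf U) :=
  h.isOpen.inter (isOpen_lt continuous_const continuous_snd)

theorem reflect_mem_iff : reflect x ∈ U ↔ x ∈ U := by
  rw [← mem_preimage, h.preimage_reflect]

theorem fold_mem_iff : fold x ∈ U ↔ x ∈ U := by
  rcases fold_eq_or x with hx | hx
  · rw [hx]
  · rw [hx, h.reflect_mem_iff]

theorem reflect_mem_frontier_iff : reflect x ∈ frontier U ↔ x ∈ frontier U := by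
  rw [← mem_preimage, reflect.preimage_frontier, h.preimage_reflect]

theorem fold_mem_upperBoundary (hx : x ∈ frontier U) : fold x ∈ upperBoundary U := by
  rw [h.isOpen.frontier_eq] at hx
  have hnot : fold x ∉ U := fun hmem => hx.2 (h.fold_mem_iff.1 hmem)
  have hcl : fold x ∈ closure (upperHalf U) := by
    rw [← closure_closure]
    exact map_mem_closure continuous_fold hx.1 fun y hy =>
      mem_closure_upperHalf h.isOpen (h.fold_mem_iff.2 hy) (abs_nonneg _)
  rw [upperBoundary, h.isOpen.frontier_eq, h.isOpen_upperHalf.frontier_eq]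
  exact ⟨⟨closure_mono upperHalf_subset hcl, hnot⟩, hcl, fun hmem => hnot hmem.1⟩

theorem mem_frontier_of_mem_frontier_upperHalf (hx : x ∈ frontier (upperHalf U)) (hpos : 0 < x.2) :
    x ∈ frontier U := by
  rw [h.isOpen_upperHalf.frontier_eq] at hx
  rw [h.isOpen.frontier_eq]
  exact ⟨closure_mono upperHalf_subset hx.1, fun hmem => hx.2 ⟨hmem, hpos⟩⟩

end IsSymmetricDomain

theorem isSymmetricDomain_guide (θ : ℝ) : IsSymmetricDomain (guide θ) :=
  ⟨isOpen_guide θ, by ext x; simp [guide]⟩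

end Reflection

section EvenOdd

variable {U : Set (ℝ × ℝ)}

theorem ae_snd_ne_zero : ∀ᵐ x : ℝ × ℝ, x.2 ≠ 0 := by
  have : {x : ℝ × ℝ | ¬ x.2 ≠ 0} = univ ×ˢ {0} := by
    ext x
    simp
  rw [ae_iff, this, Measure.volume_eq_prod, Measure.prod_prod]
  simp

theorem measurePreserving_reflect : MeasurePreserving reflect :=
  (MeasurePreserving.id (volume : Measure ℝ)).prod (Measure.measurePreserving_neg volume)

theorem measurable_sign : Measurable Real.sign := by
  unfold Real.sign
  exact Measurable.ite measurableSet_Iio measurable_const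
    (Measurable.ite measurableSet_Ioi measurable_const measurable_const)

theorem abs_sign_le_one (t : ℝ) : |Real.sign t| ≤ 1 := by
  rcases Real.sign_apply_eq t with h | h | h <;> simp [h]

theorem isWeightedPullback_restrictUpper : IsWeightedPullback id (fun _ => 1)
    (volume.restrict (upperHalf U)) (volume.restrict U) where
  measurable := measurable_id
  map_le := by
    refine ⟨1, ENNReal.one_ne_top, ?_⟩
    rw [Measure.map_id, one_smul]
    exact Measure.restrict_mono upperHalf_subset le_rfl
  measurable_weight := measurable_const
  norm_weight_le := by simp

/-- The restriction from `U` to its upper half. -/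
noncomputable def restrictUpper (U : Set (ℝ × ℝ)) : L2 U →L[ℂ] L2 (upperHalf U) :=
  weightedPullback isWeightedPullback_restrictUpper

theorem restrictUpper_ae {u : L2 U} {f : ℝ × ℝ → ℂ} (hf : u =ᵐ[volume.restrict U] f) :
    restrictUpper U u =ᵐ[volume.restrict (upperHalf U)] f := by
  filter_upwards [weightedPullback_ae isWeightedPullback_restrictUpper hf] with x hx
  rw [restrictUpper, hx, one_mul, id]

namespace IsSymmetricDomain

variable (h : IsSymmetricDomain U)
include h

theorem measurePreserving_reflect_restrict :
    MeasurePreserving reflect (volume.restrict U) (volume.restrict U) := by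
  have := measurePreserving_reflect.restrict_preimage h.isOpen.measurableSet
  rwa [h.preimage_reflect] at this

theorem ae_mem_upperHalf : ∀ᵐ x ∂volume.restrict (upperHalf U), x ∈ upperHalf U :=
  ae_restrict_mem h.isOpen_upperHalf.measurableSet

theorem ae_eq_union :
    U =ᵐ[volume] (upperHalf U ∪ reflect ⁻¹' upperHalf U : Set (ℝ × ℝ)) := by
  filter_upwards [ae_snd_ne_zero] with x hx
  refine propext ⟨fun hxU => ?_, ?_⟩
  · rcases lt_or_gt_of_ne hx with hlt | hgt
    · exact Or.inr ⟨h.reflect_mem_iff.2 hxU, by simpa using hlt⟩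
    · exact Or.inl ⟨hxU, hgt⟩
  · rintro (hx | hx)
    exacts [hx.1, h.reflect_mem_iff.1 hx.1]

theorem map_fold_le :
    (volume.restrict U).map fold ≤ (2 : ℝ≥0∞) • volume.restrict (upperHalf U) := by
  refine Measure.le_iff.2 fun s hs => ?_
  have hm : MeasurableSet (s ∩ upperHalf U) := hs.inter h.isOpen_upperHalf.measurableSet
  have hsub : fold ⁻¹' s ∩ (upperHalf U ∪ reflect ⁻¹' upperHalf U) ⊆
      (s ∩ upperHalf U) ∪ reflect ⁻¹' (s ∩ upperHalf U) := by
    rintro x ⟨hxs, hx | hx⟩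
    · exact Or.inl ⟨by rwa [mem_preimage, fold_of_pos hx.2] at hxs, hx⟩
    · exact Or.inr ⟨by rwa [mem_preimage, ← fold_reflect, fold_of_pos hx.2] at hxs, hx⟩
  rw [Measure.map_apply continuous_fold.measurable hs, Measure.restrict_congr_set h.ae_eq_union,
    Measure.restrict_apply (continuous_fold.measurable hs), Measure.smul_apply,
    Measure.restrict_apply hs, smul_eq_mul, two_mul]
  refine (measure_mono hsub).trans ((measure_union_le _ _).trans ?_)
  rw [measurePreserving_reflect.measure_preimage hm.nullMeasurableSet]

theorem isWeightedPullback_reflect : IsWeightedPullback reflect (fun _ => 1)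
    (volume.restrict U) (volume.restrict U) where
  measurable := reflect.continuous.measurable
  map_le := ⟨1, ENNReal.one_ne_top, by rw [h.measurePreserving_reflect_restrict.map_eq, one_smul]⟩
  measurable_weight := measurable_const
  norm_weight_le := by simp

theorem isWeightedPullback_evenExt : IsWeightedPullback fold (fun _ => 1)
    (volume.restrict U) (volume.restrict (upperHalf U)) where
  measurable := continuous_fold.measurable
  map_le := ⟨2, ENNReal.ofNat_ne_top, h.map_fold_le⟩
  measurable_weight := measurable_const
  norm_weight_le := by simp

theorem isWeightedPullback_oddExt : IsWeightedPullback fold (fun x => (Real.sign x.2 : ℂ))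
    (volume.restrict U) (volume.restrict (upperHalf U)) where
  measurable := continuous_fold.measurable
  map_le := ⟨2, ENNReal.ofNat_ne_top, h.map_fold_le⟩
  measurable_weight := Complex.measurable_ofReal.comp (measurable_sign.comp measurable_snd)
  norm_weight_le x := by simpa using abs_sign_le_one x.2

/-- The composition of functions on `U` with the reflection. -/
noncomputable def reflectL2 : L2 U →L[ℂ] L2 U := weightedPullback h.isWeightedPullback_reflect

/-- The even extension from the upper half of `U` to `U`. -/
noncomputable def evenExt : L2 (upperHalf U) →L[ℂ] L2 U :=
  weightedPullback h.isWeightedPullback_evenExt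

/-- The odd extension from the upper half of `U` to `U`. -/
noncomputable def oddExt : L2 (upperHalf U) →L[ℂ] L2 U :=
  weightedPullback h.isWeightedPullback_oddExt

theorem reflectL2_ae {u : L2 U} {f : ℝ × ℝ → ℂ} (hf : u =ᵐ[volume.restrict U] f) :
    h.reflectL2 u =ᵐ[volume.restrict U] fun x => f (reflect x) := by
  filter_upwards [weightedPullback_ae h.isWeightedPullback_reflect hf] with x hx
  rw [reflectL2, hx, one_mul]

theorem evenExt_ae {g : L2 (upperHalf U)} {f : ℝ × ℝ → ℂ}
    (hf : g =ᵐ[volume.restrict (upperHalf U)] f) :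
    h.evenExt g =ᵐ[volume.restrict U] fun x => f (fold x) := by
  filter_upwards [weightedPullback_ae h.isWeightedPullback_evenExt hf] with x hx
  rw [evenExt, hx, one_mul]

theorem oddExt_ae {g : L2 (upperHalf U)} {f : ℝ × ℝ → ℂ}
    (hf : g =ᵐ[volume.restrict (upperHalf U)] f) :
    h.oddExt g =ᵐ[volume.restrict U] fun x => Real.sign x.2 * f (fold x) :=
  weightedPullback_ae h.isWeightedPullback_oddExt hf

theorem reflectL2_reflectL2 (u : L2 U) : h.reflectL2 (h.reflectL2 u) = u := by
  refine Lp.ext ?_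
  filter_upwards [h.reflectL2_ae (h.reflectL2_ae (ae_eq_refl u))] with x hx
  rw [hx, reflect_reflect]

theorem restrictUpper_evenExt (g : L2 (upperHalf U)) : restrictUpper U (h.evenExt g) = g := by
  refine Lp.ext ?_
  filter_upwards [restrictUpper_ae (h.evenExt_ae (ae_eq_refl g)), h.ae_mem_upperHalf] with x hx hpos
  rw [hx, fold_of_pos hpos.2]

theorem restrictUpper_oddExt (g : L2 (upperHalf U)) : restrictUpper U (h.oddExt g) = g := by
  refine Lp.ext ?_
  filter_upwards [restrictUpper_ae (h.oddExt_ae (ae_eq_refl g)), h.ae_mem_upperHalf] with x hx hpos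
  rw [hx, fold_of_pos hpos.2, Real.sign_of_pos hpos.2, Complex.ofReal_one, one_mul]

theorem reflectL2_evenExt (g : L2 (upperHalf U)) : h.reflectL2 (h.evenExt g) = h.evenExt g := by
  have hg := h.evenExt_ae (ae_eq_refl g)
  refine Lp.ext ?_
  filter_upwards [h.reflectL2_ae hg, hg] with x h1 h2
  rw [h1, h2, fold_reflect]

theorem reflectL2_oddExt (g : L2 (upperHalf U)) : h.reflectL2 (h.oddExt g) = - h.oddExt g := by
  have hg := h.oddExt_ae (ae_eq_refl g)
  refine Lp.ext ?_
  filter_upwards [h.reflectL2_ae hg, hg, Lp.coeFn_neg (h.oddExt g)] with x h1 h2 h3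
  rw [h1, h3, Pi.neg_apply, h2, fold_reflect, reflect_apply, Real.sign_neg, Complex.ofReal_neg,
    neg_mul]

theorem setIntegral_eq_add {f : ℝ × ℝ → ℂ} (hf : IntegrableOn f U) :
    ∫ x in U, f x =
      (∫ x in upperHalf U, f x) + ∫ x in upperHalf U, f (reflect x) := by
  have hm := h.isOpen_upperHalf.measurableSet
  have hd : Disjoint (upperHalf U) (reflect ⁻¹' upperHalf U) :=
    disjoint_left.2 fun x h1 h2 => by
      have h3 : 0 < -x.2 := h2.2
      linarith [h1.2]
  have hsub : reflect ⁻¹' upperHalf U ⊆ U := fun x hx => h.reflect_mem_iff.1 hx.1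
  rw [setIntegral_congr_set h.ae_eq_union, setIntegral_union hd
    (reflect.continuous.measurable hm) (hf.mono_set upperHalf_subset) (hf.mono_set hsub),
    ← measurePreserving_reflect.setIntegral_preimage_emb reflect.measurableEmbedding
      (fun x => f (reflect x))]
  simp only [reflect_reflect]

theorem inner_eq_add (u v : L2 U) :
    inner ℂ u v = inner ℂ (restrictUpper U u) (restrictUpper U v) +
      inner ℂ (restrictUpper U (h.reflectL2 u)) (restrictUpper U (h.reflectL2 v)) := by
  rw [L2.inner_def, h.setIntegral_eq_add (L2.integrable_inner u v), L2.inner_def, L2.inner_def]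
  congr 1
  · refine integral_congr_ae ?_
    filter_upwards [restrictUpper_ae (ae_eq_refl u), restrictUpper_ae (ae_eq_refl v)] with x h1 h2
    rw [h1, h2]
  · refine integral_congr_ae ?_
    filter_upwards [restrictUpper_ae (h.reflectL2_ae (ae_eq_refl u)),
      restrictUpper_ae (h.reflectL2_ae (ae_eq_refl v))] with x h1 h2
    rw [h1, h2]

theorem inner_reflectL2_left (u v : L2 U) :
    inner ℂ (h.reflectL2 u) v = inner ℂ u (h.reflectL2 v) := by
  rw [h.inner_eq_add, h.inner_eq_add u, h.reflectL2_reflectL2, h.reflectL2_reflectL2, add_comm]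

theorem inner_evenExt_right (u : L2 U) (g : L2 (upperHalf U)) :
    inner ℂ u (h.evenExt g) = inner ℂ (restrictUpper U (u + h.reflectL2 u)) g := by
  rw [h.inner_eq_add, h.reflectL2_evenExt, h.restrictUpper_evenExt, map_add, inner_add_left]

theorem inner_oddExt_right (u : L2 U) (g : L2 (upperHalf U)) :
    inner ℂ u (h.oddExt g) = inner ℂ (restrictUpper U (u - h.reflectL2 u)) g := by
  rw [h.inner_eq_add, h.reflectL2_oddExt, map_neg, h.restrictUpper_oddExt, map_sub,
    inner_sub_left, inner_neg_right, sub_eq_add_neg]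

theorem inner_evenExt_left (u : L2 U) (g : L2 (upperHalf U)) :
    inner ℂ (h.evenExt g) u = inner ℂ g (restrictUpper U (u + h.reflectL2 u)) := by
  rw [← inner_conj_symm, inner_evenExt_right, inner_conj_symm]

theorem inner_oddExt_left (u : L2 U) (g : L2 (upperHalf U)) :
    inner ℂ (h.oddExt g) u = inner ℂ g (restrictUpper U (u - h.reflectL2 u)) := by
  rw [← inner_conj_symm, inner_oddExt_right, inner_conj_symm]

theorem norm_sq_eq_two_mul {u : L2 U} (hu : h.reflectL2 u = u ∨ h.reflectL2 u = -u) :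
    ‖u‖ ^ 2 = 2 * ‖restrictUpper U u‖ ^ 2 := by
  have hinner := h.inner_eq_add u u
  have hrefl : inner ℂ (restrictUpper U (h.reflectL2 u)) (restrictUpper U (h.reflectL2 u)) =
      inner ℂ (restrictUpper U u) (restrictUpper U u) := by
    rcases hu with hu | hu <;> simp [hu]
  rw [hrefl, ← two_mul, inner_self_eq_norm_sq_to_K, inner_self_eq_norm_sq_to_K] at hinner
  exact Complex.ofReal_injective (by simpa using hinner)

theorem eq_zero_of_restrictUpper_eq_zero {u : L2 U} (hu : h.reflectL2 u = u)
    (hr : restrictUpper U u = 0) : u = 0 := by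
  simpa [hr] using h.norm_sq_eq_two_mul (Or.inl hu)

end IsSymmetricDomain

end EvenOdd

section CompSnd

variable {S U Γ : Set (ℝ × ℝ)} {φ : ℝ × ℝ → ℂ} {g : ℝ → ℝ} {h : ℕ → ℝ → ℝ} {k d : ℝ → ℝ}
  {s : Set ℝ} {δ : ℝ}

theorem fderiv_comp_snd (hφ : Differentiable ℝ φ) (hg : Differentiable ℝ g) (x v : ℝ × ℝ) :
    fderiv ℝ (fun x : ℝ × ℝ => φ (x.1, g x.2)) x v =
      fderiv ℝ φ (x.1, g x.2) (v.1, v.2 * deriv g x.2) := by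
  have hpair := (hasFDerivAt_fst (𝕜 := ℝ) (p := x)).prodMk
    ((hg x.2).hasDerivAt.hasFDerivAt.comp x (hasFDerivAt_snd (𝕜 := ℝ) (p := x)))
  have hcomp := ((hφ (x.1, g x.2)).hasFDerivAt.comp x hpair).fderiv
  simp only [Function.comp_def] at hcomp
  rw [hcomp]
  simp

theorem pd1_comp_snd (hφ : Differentiable ℝ φ) (hg : Differentiable ℝ g) (x : ℝ × ℝ) :
    pd1 (fun x : ℝ × ℝ => φ (x.1, g x.2)) x = pd1 φ (x.1, g x.2) := by
  simp [pd1, fderiv_comp_snd hφ hg]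

theorem pd2_comp_snd (hφ : Differentiable ℝ φ) (hg : Differentiable ℝ g) (x : ℝ × ℝ) :
    pd2 (fun x : ℝ × ℝ => φ (x.1, g x.2)) x = deriv g x.2 * pd2 φ (x.1, g x.2) := by
  have hv : ((0 : ℝ), deriv g x.2) = deriv g x.2 • ((0 : ℝ), (1 : ℝ)) := by simp
  rw [pd2, fderiv_comp_snd hφ hg, one_mul, hv, map_smul, pd2, Complex.real_smul]

theorem tsupport_comp_snd_subset (φ : ℝ × ℝ → ℂ) (hg : Continuous g) :
    tsupport (fun x : ℝ × ℝ => φ (x.1, g x.2)) ⊆ {x | (x.1, g x.2) ∈ tsupport φ} :=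
  closure_minimal (fun _ hx => subset_tsupport φ hx)
    ((isClosed_tsupport φ).preimage (by fun_prop))

theorem IsTest.exists_bound (hφ : IsTest S φ) :
    ∃ C, (∀ x, ‖φ x‖ ≤ C) ∧ (∀ x, ‖pd1 φ x‖ ≤ C) ∧ ∀ x, ‖pd2 φ x‖ ≤ C := by
  obtain ⟨C0, h0⟩ := hφ.compact.exists_bound_of_continuous hφ.smooth.continuous
  obtain ⟨C1, h1⟩ := (hφ.compact_pd (1, 0)).exists_bound_of_continuous (hφ.continuous_pd (1, 0))
  obtain ⟨C2, h2⟩ := (hφ.compact_pd (0, 1)).exists_bound_of_continuous (hφ.continuous_pd (0, 1))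
  exact ⟨max C0 (max C1 C2), fun x => le_max_of_le_left (h0 x),
    fun x => le_max_of_le_right (le_max_of_le_left (h1 x)),
    fun x => le_max_of_le_right (le_max_of_le_right (h2 x))⟩

theorem IsTest.exists_forall_mem_closedBall_diff (hφ : IsTest Γᶜ φ) (hΓ : IsClosed Γ) :
    ∃ δ > 0, ∃ M, ∀ a s t, (a, s) ∈ tsupport φ → |s - t| < δ →
      (a, t) ∈ Metric.closedBall 0 M \ Γ := by
  obtain ⟨δ, hδ, hsub⟩ := hφ.compact.exists_thickening_subset_open hΓ.isOpen_compl hφ.supp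
  obtain ⟨M, hM⟩ := (hφ.compact.isBounded.thickening (δ := δ)).subset_closedBall 0
  refine ⟨δ, hδ, M, fun a s t hs hst => ?_⟩
  have hmem : (a, t) ∈ Metric.thickening δ (tsupport φ) :=
    Metric.mem_thickening_iff.2
      ⟨(a, s), hs, by simpa [Prod.dist_eq, Real.dist_eq, abs_sub_comm t s] using hst⟩
  exact ⟨hM hmem, hsub hmem⟩

/-- A sequence of smooth functions that is `δ`-close to `k` and converges to `k` pointwise on `s`,
with uniformly bounded derivatives converging to `d` pointwise on `s`. -/
structure IsSmoothApprox (h : ℕ → ℝ → ℝ) (k d : ℝ → ℝ) (s : Set ℝ) (δ : ℝ) : Prop where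
  smooth : ∀ n, ContDiff ℝ ∞ (h n)
  exists_abs_deriv_le : ∃ D, ∀ n t, |deriv (h n) t| ≤ D
  abs_sub_lt : ∀ n t, |h n t - k t| < δ
  tendsto : ∀ t ∈ s, Tendsto (fun n => h n t) atTop (𝓝 (k t))
  tendsto_deriv : ∀ t ∈ s, Tendsto (fun n => deriv (h n) t) atTop (𝓝 (d t))

theorem IsSmoothApprox.differentiable (ha : IsSmoothApprox h k d s δ) (n : ℕ) :
    Differentiable ℝ (h n) :=
  (ha.smooth n).differentiable (by simp)

theorem IsSmoothApprox.mem_formDomain (ha : IsSmoothApprox h k d s δ) (hφ : IsTest S φ)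
    (hU : IsOpen U) (hs : ∀ᵐ x ∂volume.restrict U, x.2 ∈ s) {K : Set (ℝ × ℝ)} (hK : IsCompact K)
    (hsupp : ∀ n, tsupport (fun x : ℝ × ℝ => φ (x.1, h n x.2)) ⊆ K \ Γ)
    {p : L2 U × L2 U × L2 U}
    (l0 : p.1 =ᵐ[volume.restrict U] fun x => φ (x.1, k x.2))
    (l1 : p.2.1 =ᵐ[volume.restrict U] fun x => pd1 φ (x.1, k x.2))
    (l2 : p.2.2 =ᵐ[volume.restrict U] fun x => d x.2 * pd2 φ (x.1, k x.2)) :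
    p ∈ formDomain U Γ := by
  obtain ⟨C, b0, b1, b2⟩ := hφ.exists_bound
  obtain ⟨D, hD⟩ := ha.exists_abs_deriv_le
  have hpd1 := fun n => pd1_comp_snd hφ.differentiable (ha.differentiable n)
  have hpd2 := fun n => pd2_comp_snd hφ.differentiable (ha.differentiable n)
  have hpair : ∀ x : ℝ × ℝ, x.2 ∈ s →
      Tendsto (fun n => (x.1, h n x.2)) atTop (𝓝 (x.1, k x.2)) := fun x hx =>
    tendsto_const_nhds.prodMk_nhds (ha.tendsto _ hx)
  refine mem_formDomain_of_tendsto hU (ψ := fun n x => φ (x.1, h n x.2)) (C := max C (D * C))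
    (fun n => ⟨?_, ?_, fun x hx => (hsupp n hx).2⟩) hK (fun n x hx => (hsupp n hx).1)
    (fun n x => le_max_of_le_left (b0 _)) (fun n x => ?_) (fun n x => ?_) ?_ ?_ ?_
  · have := ha.smooth n
    exact hφ.smooth.comp (by fun_prop)
  · exact hK.of_isClosed_subset (isClosed_tsupport _) fun x hx => (hsupp n hx).1
  · rw [hpd1]
    exact le_max_of_le_left (b1 _)
  · rw [hpd2, norm_mul, Complex.norm_real, Real.norm_eq_abs]
    exact le_max_of_le_right
      (mul_le_mul (hD _ _) (b2 _) (norm_nonneg _) ((abs_nonneg _).trans (hD n x.2)))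
  · filter_upwards [hs, l0] with x hx h0
    rw [h0]
    exact (hφ.smooth.continuous.tendsto _).comp (hpair x hx)
  · filter_upwards [hs, l1] with x hx h1
    simp only [h1, hpd1]
    exact ((hφ.continuous_pd (1, 0)).tendsto _).comp (hpair x hx)
  · filter_upwards [hs, l2] with x hx h2
    simp only [h2, hpd2]
    exact ((Complex.continuous_ofReal.tendsto _).comp (ha.tendsto_deriv _ hx)).mul
      (((hφ.continuous_pd (0, 1)).tendsto _).comp (hpair x hx))

end CompSnd

section SmoothApproximations

variable {ε δ t : ℝ}

/-- The smooth approximation `√(t² + ε²)` of `|t|`. -/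
noncomputable def smoothAbs (ε t : ℝ) : ℝ := √(t ^ 2 + ε ^ 2)

theorem abs_smoothAbs_sub_le (hε : 0 ≤ ε) (t : ℝ) : |smoothAbs ε t - (|t|)| ≤ ε := by
  have hlow : |t| ≤ smoothAbs ε t := Real.abs_le_sqrt (by nlinarith)
  have hupp : smoothAbs ε t ≤ |t| + ε :=
    Real.sqrt_le_iff.2 ⟨by positivity, by nlinarith [sq_abs t, abs_nonneg t]⟩
  rw [abs_of_nonneg (sub_nonneg.2 hlow)]
  linarith

theorem deriv_smoothAbs (hε : ε ≠ 0) (t : ℝ) : deriv (smoothAbs ε) t = t / smoothAbs ε t := by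
  have hsq : HasDerivAt (fun t : ℝ => t ^ 2 + ε ^ 2) (2 * t) t := by
    simpa using (hasDerivAt_pow 2 t).add_const (ε ^ 2)
  have hsqrt := hsq.sqrt (by positivity : t ^ 2 + ε ^ 2 ≠ 0)
  rw [show smoothAbs ε = fun t => √(t ^ 2 + ε ^ 2) from rfl, hsqrt.deriv]
  ring

theorem div_abs_eq_sign (ht : t ≠ 0) : t / |t| = Real.sign t := by
  rcases lt_or_gt_of_ne ht with h | h
  · rw [abs_of_neg h, Real.sign_of_neg h, div_neg, div_self ht]
  · rw [abs_of_pos h, Real.sign_of_pos h, div_self ht]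

theorem exists_isSmoothApprox_abs (hδ : 0 < δ) :
    ∃ h, IsSmoothApprox h (fun t => |t|) Real.sign {0}ᶜ δ := by
  obtain ⟨ε, -, hε, hlim⟩ := exists_seq_strictAnti_tendsto' hδ
  have htendsto : ∀ t, Tendsto (fun n => smoothAbs (ε n) t) atTop (𝓝 |t|) := fun t => by
    have hc : Continuous fun e : ℝ => smoothAbs e t := by unfold smoothAbs; fun_prop
    simpa [smoothAbs, Real.sqrt_sq_eq_abs, Function.comp_def] using (hc.tendsto 0).comp hlim
  refine ⟨fun n => smoothAbs (ε n), fun n => ?_, ⟨1, fun n t => ?_⟩, fun n t => ?_,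
    fun t _ => htendsto t, fun t ht => ?_⟩
  · have := (hε n).1
    exact ContDiff.sqrt (by fun_prop) fun t => by positivity
  · rw [deriv_smoothAbs (hε n).1.ne', smoothAbs, abs_div, abs_of_nonneg (Real.sqrt_nonneg _)]
    exact div_le_one_of_le₀ (Real.abs_le_sqrt (by nlinarith [sq_nonneg (ε n)])) (Real.sqrt_nonneg _)
  · exact (abs_smoothAbs_sub_le (hε n).1.le t).trans_lt (hε n).2
  · simp only [deriv_smoothAbs (hε _).1.ne', ← div_abs_eq_sign ht]
    exact tendsto_const_nhds.div (htendsto t) (abs_ne_zero.2 ht)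

/-- A smooth approximation of the positive part, vanishing on `(-∞, ε]` and equal to the identity
on `[2ε, ∞)`. -/
noncomputable def ramp (ε t : ℝ) : ℝ := t * Real.smoothTransition (t / ε - 1)

theorem ramp_eq_zero (hε : 0 < ε) (ht : t ≤ ε) : ramp ε t = 0 := by
  rw [ramp, Real.smoothTransition.zero_of_nonpos (sub_nonpos.2 ((div_le_one hε).2 ht)), mul_zero]

theorem ramp_eq_self (hε : 0 < ε) (ht : 2 * ε ≤ t) : ramp ε t = t := by
  have h : 1 ≤ t / ε - 1 := by
    rw [le_sub_iff_add_le, le_div_iff₀ hε]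
    linarith
  rw [ramp, Real.smoothTransition.one_of_one_le h, mul_one]

theorem abs_ramp_sub_le (hε : 0 < ε) (t : ℝ) : |ramp ε t - max t 0| ≤ 2 * ε := by
  rcases le_total t 0 with ht | ht
  · rw [max_eq_right ht, ramp_eq_zero hε (ht.trans hε.le), sub_zero, abs_zero]
    positivity
  · rw [max_eq_left ht]
    rcases le_total (2 * ε) t with h | h
    · rw [ramp_eq_self hε h, sub_self, abs_zero]
      positivity
    · have h0 := Real.smoothTransition.nonneg (t / ε - 1)
      have h1 := Real.smoothTransition.le_one (t / ε - 1)
      rw [ramp, abs_le]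
      constructor <;> nlinarith

theorem differentiable_smoothTransition : Differentiable ℝ Real.smoothTransition :=
  (Real.smoothTransition.contDiff (n := 1)).differentiable (by simp)

theorem deriv_smoothTransition_eq_zero (ht : t ∉ Icc (0 : ℝ) 1) :
    deriv Real.smoothTransition t = 0 := by
  rcases not_and_or.1 ht with h | h
  · have : Real.smoothTransition =ᶠ[𝓝 t] fun _ => 0 := by
      filter_upwards [Iio_mem_nhds (not_le.1 h)] with u hu
      exact Real.smoothTransition.zero_of_nonpos (le_of_lt hu)
    rw [this.deriv_eq, deriv_const]
  · have : Real.smoothTransition =ᶠ[𝓝 t] fun _ => 1 := by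
      filter_upwards [Ioi_mem_nhds (not_le.1 h)] with u hu
      exact Real.smoothTransition.one_of_one_le (le_of_lt hu)
    rw [this.deriv_eq, deriv_const]

theorem deriv_ramp (ε t : ℝ) : deriv (ramp ε) t = Real.smoothTransition (t / ε - 1) +
    t / ε * deriv Real.smoothTransition (t / ε - 1) := by
  have hlin : HasDerivAt (fun t : ℝ => t / ε - 1) (1 / ε) t :=
    ((hasDerivAt_id t).div_const ε).sub_const 1
  have hmul := (hasDerivAt_id t).mul
    ((differentiable_smoothTransition (t / ε - 1)).hasDerivAt.comp t hlin)
  refine (hmul.congr_deriv ?_).deriv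
  simp only [Function.comp_apply, id_eq]
  ring

theorem exists_abs_deriv_ramp_le : ∃ D : ℝ, ∀ ε t, |deriv (ramp ε) t| ≤ D := by
  have hc : Continuous fun y : ℝ => (y + 1) * deriv Real.smoothTransition y :=
    (continuous_id.add continuous_const).mul
      ((Real.smoothTransition.contDiff (n := 1)).continuous_deriv le_rfl)
  have hs : HasCompactSupport fun y : ℝ => (y + 1) * deriv Real.smoothTransition y :=
    HasCompactSupport.intro isCompact_Icc fun y hy => by
      rw [deriv_smoothTransition_eq_zero hy, mul_zero]
  obtain ⟨D, hD⟩ := hs.exists_bound_of_continuous hc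
  refine ⟨1 + D, fun ε t => ?_⟩
  rw [deriv_ramp]
  refine (abs_add_le _ _).trans (add_le_add ?_ ?_)
  · rw [abs_of_nonneg (Real.smoothTransition.nonneg _)]
    exact Real.smoothTransition.le_one _
  · simpa [abs_div] using hD (t / ε - 1)

theorem exists_isSmoothApprox_max (hδ : 0 < δ) :
    ∃ h, IsSmoothApprox h (fun t => max t 0) 1 (Ioi 0) δ ∧ ∀ n, ∃ ε > 0, ∀ t ≤ ε, h n t = 0 := by
  obtain ⟨ε, -, hε, hlim⟩ := exists_seq_strictAnti_tendsto' (half_pos hδ)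
  have heq : ∀ t > 0, ∀ᶠ n in atTop, ramp (ε n) =ᶠ[𝓝 t] id := fun t ht => by
    have hev : ∀ᶠ n in atTop, 2 * ε n < t :=
      (hlim.const_mul 2).eventually_lt_const (by simpa using ht)
    filter_upwards [hev] with n hn
    filter_upwards [Ioi_mem_nhds hn] with u hu using ramp_eq_self (hε n).1 (le_of_lt hu)
  refine ⟨fun n => ramp (ε n), ⟨fun n => ?_, ?_, fun n t => ?_, fun t ht => ?_, fun t ht => ?_⟩,
    fun n => ⟨ε n, (hε n).1, fun t => ramp_eq_zero (hε n).1⟩⟩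
  · exact contDiff_id.mul (Real.smoothTransition.contDiff.comp (by fun_prop))
  · exact exists_abs_deriv_ramp_le.imp fun D hD n => hD _
  · exact (abs_ramp_sub_le (hε n).1 t).trans_lt (by linarith [(hε n).2])
  · refine tendsto_const_nhds.congr' ?_
    filter_upwards [heq t ht] with n hn
    rw [hn.eq_of_nhds, max_eq_left (le_of_lt ht), id]
  · refine tendsto_const_nhds.congr' ?_
    filter_upwards [heq t ht] with n hn
    rw [hn.deriv_eq, deriv_id, Pi.one_apply]

end SmoothApproximations

section Triples

variable {S U Γ : Set (ℝ × ℝ)} {φ ψ : ℝ × ℝ → ℂ} {p q : L2 U × L2 U × L2 U}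

/-- The triple `p` consists of the function `φ` and its partial derivatives. -/
structure Represents (U : Set (ℝ × ℝ)) (p : L2 U × L2 U × L2 U) (φ : ℝ × ℝ → ℂ) : Prop where
  ae_fst : p.1 =ᵐ[volume.restrict U] φ
  ae_pd1 : p.2.1 =ᵐ[volume.restrict U] pd1 φ
  ae_pd2 : p.2.2 =ᵐ[volume.restrict U] pd2 φ

theorem mem_smoothTriples : p ∈ smoothTriples U Γ ↔ ∃ φ, IsTest Γᶜ φ ∧ Represents U p φ :=
  ⟨fun ⟨φ, hφ, h0, h1, h2⟩ => ⟨φ, hφ, h0, h1, h2⟩,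
    fun ⟨φ, hφ, hp⟩ => ⟨φ, hφ, hp.ae_fst, hp.ae_pd1, hp.ae_pd2⟩⟩

theorem Represents.sub (hp : Represents U p φ) (hq : Represents U q ψ)
    (hφ : Differentiable ℝ φ) (hψ : Differentiable ℝ ψ) : Represents U (p - q) (φ - ψ) where
  ae_fst := (Lp.coeFn_sub p.1 q.1).trans (hp.ae_fst.sub hq.ae_fst)
  ae_pd1 := by
    refine ((Lp.coeFn_sub p.2.1 q.2.1).trans (hp.ae_pd1.sub hq.ae_pd1)).trans
      (.of_forall fun x => ?_)
    simp [pd1, fderiv_sub (hφ x) (hψ x)]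
  ae_pd2 := by
    refine ((Lp.coeFn_sub p.2.2 q.2.2).trans (hp.ae_pd2.sub hq.ae_pd2)).trans
      (.of_forall fun x => ?_)
    simp [pd2, fderiv_sub (hφ x) (hψ x)]

/-- The restriction of functions, together with their gradients, to the upper half. -/
noncomputable def restrictTriple (U : Set (ℝ × ℝ)) :
    L2 U × L2 U × L2 U →L[ℂ] L2 (upperHalf U) × L2 (upperHalf U) × L2 (upperHalf U) :=
  (restrictUpper U).prodMap ((restrictUpper U).prodMap (restrictUpper U))

@[simp] theorem restrictTriple_apply (p : L2 U × L2 U × L2 U) : restrictTriple U p =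
    (restrictUpper U p.1, restrictUpper U p.2.1, restrictUpper U p.2.2) := rfl

theorem Represents.restrict (hp : Represents U p φ) :
    Represents (upperHalf U) (restrictTriple U p) φ :=
  ⟨restrictUpper_ae hp.ae_fst, restrictUpper_ae hp.ae_pd1, restrictUpper_ae hp.ae_pd2⟩

namespace IsSymmetricDomain

variable (h : IsSymmetricDomain U)
include h

/-- The reflection of functions together with their gradients. -/
noncomputable def reflectTriple : L2 U × L2 U × L2 U →L[ℂ] L2 U × L2 U × L2 U :=
  h.reflectL2.prodMap (h.reflectL2.prodMap (-h.reflectL2))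

/-- The even extension of functions together with their gradients. -/
noncomputable def evenExtTriple :
    L2 (upperHalf U) × L2 (upperHalf U) × L2 (upperHalf U) →L[ℂ] L2 U × L2 U × L2 U :=
  h.evenExt.prodMap (h.evenExt.prodMap h.oddExt)

@[simp] theorem reflectTriple_apply (p : L2 U × L2 U × L2 U) :
    h.reflectTriple p = (h.reflectL2 p.1, h.reflectL2 p.2.1, -h.reflectL2 p.2.2) := rfl

@[simp] theorem evenExtTriple_apply
    (p : L2 (upperHalf U) × L2 (upperHalf U) × L2 (upperHalf U)) :
    h.evenExtTriple p = (h.evenExt p.1, h.evenExt p.2.1, h.oddExt p.2.2) := rfl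

theorem reflectTriple_reflectTriple (p : L2 U × L2 U × L2 U) :
    h.reflectTriple (h.reflectTriple p) = p := by
  simp [h.reflectL2_reflectL2]

theorem restrictTriple_mem (hp : p ∈ formDomain U (frontier U)) :
    restrictTriple U p ∈ formDomain (upperHalf U) (upperBoundary U) := by
  refine map_mem_of_mem_formDomain h.isOpen (isClosed_formDomain h.isOpen_upperHalf)
    (restrictTriple U) (fun q hq => ?_) hp
  obtain ⟨φ, hφ, hq⟩ := mem_smoothTriples.1 hq
  exact smoothTriples_le_formDomain h.isOpen_upperHalf (mem_smoothTriples.2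
    ⟨φ, hφ.mono (compl_subset_compl.2 inter_subset_left), hq.restrict⟩)

theorem isTest_reflect (hφ : IsTest (frontier U)ᶜ φ) :
    IsTest (frontier U)ᶜ fun x => φ (x.1, -x.2) where
  smooth := hφ.smooth.comp (by fun_prop)
  compact := hφ.compact.comp_homeomorph reflect
  supp := fun x hx hfr => hφ.supp (tsupport_comp_snd_subset φ continuous_neg hx)
    (h.reflect_mem_frontier_iff.2 hfr)

theorem represents_reflectTriple (hp : Represents U p φ) (hφ : Differentiable ℝ φ) :
    Represents U (h.reflectTriple p) fun x => φ (x.1, -x.2) where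
  ae_fst := h.reflectL2_ae hp.ae_fst
  ae_pd1 := by
    filter_upwards [h.reflectL2_ae hp.ae_pd1] with x hx
    rw [reflectTriple_apply, hx, pd1_comp_snd hφ differentiable_neg, reflect_apply]
  ae_pd2 := by
    filter_upwards [h.reflectL2_ae hp.ae_pd2, Lp.coeFn_neg (h.reflectL2 p.2.2)] with x h1 h2
    rw [reflectTriple_apply, h2, Pi.neg_apply, h1, pd2_comp_snd hφ differentiable_neg]
    simp

theorem reflectTriple_mem (hp : p ∈ formDomain U (frontier U)) :
    h.reflectTriple p ∈ formDomain U (frontier U) := by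
  refine map_mem_of_mem_formDomain h.isOpen (isClosed_formDomain h.isOpen) h.reflectTriple
    (fun q hq => ?_) hp
  obtain ⟨φ, hφ, hq⟩ := mem_smoothTriples.1 hq
  exact smoothTriples_le_formDomain h.isOpen (mem_smoothTriples.2
    ⟨_, h.isTest_reflect hφ, h.represents_reflectTriple hq hφ.differentiable⟩)

theorem evenExtTriple_mem {p : L2 (upperHalf U) × L2 (upperHalf U) × L2 (upperHalf U)}
    (hp : p ∈ formDomain (upperHalf U) (upperBoundary U)) :
    h.evenExtTriple p ∈ formDomain U (frontier U) := by
  refine map_mem_of_mem_formDomain h.isOpen_upperHalf (isClosed_formDomain h.isOpen) h.evenExtTriple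
    (fun q hq => ?_) hp
  obtain ⟨φ, hφ, hq⟩ := mem_smoothTriples.1 hq
  obtain ⟨δ, hδ, M, hM⟩ := hφ.exists_forall_mem_closedBall_diff isClosed_upperBoundary
  obtain ⟨g, hg⟩ := exists_isSmoothApprox_abs hδ
  refine hg.mem_formDomain hφ h.isOpen (ae_restrict_of_ae ae_snd_ne_zero)
    (isCompact_closedBall 0 M) (fun n x hx => ?_) (h.evenExt_ae hq.ae_fst)
    (h.evenExt_ae hq.ae_pd1) (h.oddExt_ae hq.ae_pd2)
  have hfold : fold x ∈ Metric.closedBall 0 M \ upperBoundary U :=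
    hM _ _ _ (tsupport_comp_snd_subset φ (hg.smooth n).continuous hx) (hg.abs_sub_lt n x.2)
  refine ⟨?_, fun hfr => hfold.2 (h.fold_mem_upperBoundary hfr)⟩
  simpa [fold, Prod.norm_def] using hfold.1

theorem mem_formDomain_frontier_upperHalf_of_odd (hφ : IsTest (frontier U)ᶜ φ)
    (hodd : ∀ a, φ (a, 0) = 0)
    {p : L2 (upperHalf U) × L2 (upperHalf U) × L2 (upperHalf U)}
    (hp : Represents (upperHalf U) p φ) :
    p ∈ formDomain (upperHalf U) (frontier (upperHalf U)) := by
  obtain ⟨δ, hδ, M, hM⟩ := hφ.exists_forall_mem_closedBall_diff isClosed_frontier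
  obtain ⟨g, hg, hzero⟩ := exists_isSmoothApprox_max hδ
  have hmax : ∀ {x : ℝ × ℝ}, 0 < x.2 → (x.1, max x.2 0) = x := fun hx => by
    rw [max_eq_left hx.le]
  refine hg.mem_formDomain hφ h.isOpen_upperHalf (h.ae_mem_upperHalf.mono fun x hx => hx.2)
    (isCompact_closedBall 0 M) (fun n x hx => ?_) ?_ ?_ ?_
  · obtain ⟨ε, hε, hgε⟩ := hzero n
    have hxε : ε ≤ x.2 := by
      refine closure_minimal (t := {x : ℝ × ℝ | ε ≤ x.2}) (fun y hy => ?_)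
        (isClosed_le continuous_const continuous_snd) hx
      by_contra! hlt
      exact hy (by simp only [hgε _ (not_le.1 hlt).le, hodd])
    have hpos : 0 < x.2 := hε.trans_le hxε
    have hmem := hM _ _ _ (tsupport_comp_snd_subset φ (hg.smooth n).continuous hx)
      (hg.abs_sub_lt n x.2)
    rw [hmax hpos] at hmem
    exact ⟨hmem.1, fun hfr => hmem.2 (h.mem_frontier_of_mem_frontier_upperHalf hfr hpos)⟩
  · filter_upwards [hp.ae_fst, h.ae_mem_upperHalf] with x hx hpos
    rw [hx, hmax hpos.2]
  · filter_upwards [hp.ae_pd1, h.ae_mem_upperHalf] with x hx hpos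
    rw [hx, hmax hpos.2]
  · filter_upwards [hp.ae_pd2, h.ae_mem_upperHalf] with x hx hpos
    rw [hx, hmax hpos.2, Pi.one_apply, Complex.ofReal_one, one_mul]

theorem restrictTriple_sub_reflectTriple_mem (hp : p ∈ formDomain U (frontier U)) :
    restrictTriple U (p - h.reflectTriple p) ∈
      formDomain (upperHalf U) (frontier (upperHalf U)) := by
  let L := (restrictTriple U).comp (ContinuousLinearMap.id ℂ _ - h.reflectTriple)
  have hL : ∀ q, restrictTriple U (q - h.reflectTriple q) = L q := fun q => by
    rw [ContinuousLinearMap.comp_apply, sub_apply, ContinuousLinearMap.id_apply]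
  rw [hL]
  refine map_mem_of_mem_formDomain h.isOpen (isClosed_formDomain h.isOpen_upperHalf) L
    (fun q hq => ?_) hp
  rw [← hL]
  obtain ⟨φ, hφ, hq⟩ := mem_smoothTriples.1 hq
  have hφ' := h.isTest_reflect hφ
  have hsub : IsTest (frontier U)ᶜ (φ - fun x => φ (x.1, -x.2)) := by
    simpa [sub_eq_add_neg] using hφ.add (hφ'.smul (-1))
  exact h.mem_formDomain_frontier_upperHalf_of_odd hsub (fun a => by simp)
    (hq.sub (h.represents_reflectTriple hq hφ.differentiable) hφ.differentiable
      hφ'.differentiable).restrict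

end IsSymmetricDomain

end Triples

section Geometry

variable {θ : ℝ} {x : ℝ × ℝ}

/-- The coordinate along the upper arm of the guide. -/
noncomputable def along (θ : ℝ) (x : ℝ × ℝ) : ℝ := x.1 * Real.cos θ + x.2 * Real.sin θ

/-- The coordinate across the upper arm of the guide, which ranges over `(0, π)` in the arm. -/
noncomputable def across (θ : ℝ) (x : ℝ × ℝ) : ℝ := x.2 * Real.cos θ - x.1 * Real.sin θ

theorem contDiff_across : ContDiff ℝ ∞ (across θ) := by unfold across; fun_prop

theorem mem_guide_iff (hθ : θ ∈ Ioo 0 (Real.pi / 2)) :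
    x ∈ guide θ ↔ across θ (fold x) ∈ Ioo 0 Real.pi := by
  have hs : 0 < Real.sin θ := Real.sin_pos_of_pos_of_lt_pi hθ.1 (by linarith [hθ.2, Real.pi_pos])
  have hc : 0 < Real.cos θ := Real.cos_pos_of_mem_Ioo ⟨by linarith [hθ.1, Real.pi_pos], hθ.2⟩
  have hleft : x.1 * Real.tan θ = x.1 * Real.sin θ / Real.cos θ := by
    rw [Real.tan_eq_sin_div_cos, mul_div_assoc]
  have hright : (x.1 + Real.pi / Real.sin θ) * Real.tan θ =
      (x.1 * Real.sin θ + Real.pi) / Real.cos θ := by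
    rw [Real.tan_eq_sin_div_cos]
    field_simp
  simp only [guide, mem_ofPred_eq, hleft, hright, div_lt_iff₀ hc, lt_div_iff₀ hc, across, fold,
    mem_Ioo, sub_pos, sub_lt_iff_lt_add, add_comm Real.pi]

theorem mem_halfGuide_iff (hθ : θ ∈ Ioo 0 (Real.pi / 2)) :
    x ∈ halfGuide θ ↔ across θ x ∈ Ioo 0 Real.pi ∧ 0 < x.2 :=
  and_congr_left fun hx => by rw [mem_guide_iff hθ, fold_of_pos hx]

end Geometry

section Poincare

variable {S U : Set (ℝ × ℝ)} {θ : ℝ} {φ : ℝ × ℝ → ℂ} {x : ℝ × ℝ}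

namespace IsTest

theorem star (hφ : IsTest S φ) : IsTest S fun x => star (φ x) where
  smooth := Complex.conjCLE.contDiff.comp hφ.smooth
  compact := hφ.compact.comp_left (g := Star.star) (star_zero ℂ)
  supp := (closure_mono fun x hx => by simpa using hx : _ ⊆ tsupport φ).trans hφ.supp

theorem mul_right_of_contDiffAt {w : ℝ × ℝ → ℂ} (hφ : IsTest S φ)
    (hw : ∀ x ∈ S, ContDiffAt ℝ ∞ w x) : IsTest S fun x => φ x * w x where
  smooth := contDiff_iff_contDiffAt.2 fun x => by
    by_cases hx : x ∈ tsupport φ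
    · exact hφ.smooth.contDiffAt.mul (hw x (hφ.supp hx))
    · refine (contDiffAt_const (c := (0 : ℂ))).congr_of_eventuallyEq ?_
      filter_upwards [notMem_tsupport_iff_eventuallyEq.1 hx] with y hy
      simp [hy]
  compact := hφ.compact.mul_right
  supp := tsupport_mul_subset_left.trans hφ.supp

theorem hasDerivAt_line (hφ : IsTest S φ) (x v : ℝ × ℝ) :
    HasDerivAt (fun s : ℝ => φ (x + s • v)) (fderiv ℝ φ x v) 0 :=
  (hφ.differentiable x).hasFDerivAt.hasLineDerivAt v

theorem integrable_norm_sq_fderiv (hφ : IsTest S φ) (v : ℝ × ℝ) (U : Set (ℝ × ℝ)) :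
    IntegrableOn (fun x => ‖fderiv ℝ φ x v‖ ^ 2) U :=
  (hφ.memLp_pd v (volume.restrict U)).norm.integrable_sq

end IsTest

/-- The unit vector across the upper arm of the guide. -/
noncomputable def acrossDir (θ : ℝ) : ℝ × ℝ := (-Real.sin θ, Real.cos θ)

theorem across_add_smul_acrossDir (θ s : ℝ) (x : ℝ × ℝ) :
    across θ (x + s • acrossDir θ) = across θ x + s := by
  simp only [across, acrossDir, Prod.fst_add, Prod.snd_add, Prod.smul_mk, smul_eq_mul]
  linear_combination s * Real.sin_sq_add_cos_sq θ

theorem norm_sq_fderiv_acrossDir_le (θ : ℝ) (φ : ℝ × ℝ → ℂ) (x : ℝ × ℝ) :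
    ‖fderiv ℝ φ x (acrossDir θ)‖ ^ 2 ≤ ‖pd1 φ x‖ ^ 2 + ‖pd2 φ x‖ ^ 2 := by
  have hdir : acrossDir θ =
      (-Real.sin θ) • ((1 : ℝ), (0 : ℝ)) + Real.cos θ • ((0 : ℝ), (1 : ℝ)) := by
    simp [acrossDir]
  have hle : ‖fderiv ℝ φ x (acrossDir θ)‖ ≤
      |Real.sin θ| * ‖pd1 φ x‖ + |Real.cos θ| * ‖pd2 φ x‖ := by
    rw [hdir, map_add, map_smul, map_smul]
    refine (norm_add_le _ _).trans_eq ?_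
    rw [norm_smul, norm_smul, Real.norm_eq_abs, Real.norm_eq_abs, abs_neg, pd1, pd2]
  have hsq : |Real.sin θ| ^ 2 + |Real.cos θ| ^ 2 = 1 := by
    rw [sq_abs, sq_abs, Real.sin_sq_add_cos_sq]
  refine (pow_le_pow_left₀ (norm_nonneg _) hle 2).trans ?_
  nlinarith [sq_nonneg (|Real.cos θ| * ‖pd1 φ x‖ - |Real.sin θ| * ‖pd2 φ x‖)]

theorem hasDerivAt_cos_div_sin {t : ℝ} (ht : Real.sin t ≠ 0) :
    HasDerivAt (fun t => Real.cos t / Real.sin t) (-(1 + (Real.cos t / Real.sin t) ^ 2)) t := by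
  refine ((Real.hasDerivAt_cos t).div (Real.hasDerivAt_sin t) ht).congr_deriv ?_
  field_simp
  ring

/-- The logarithmic derivative `cot t` of the transverse ground state `sin t`, `t` being the
coordinate across the arm. -/
noncomputable def groundStateSlope (θ : ℝ) (x : ℝ × ℝ) : ℝ :=
  Real.cos (across θ x) / Real.sin (across θ x)

theorem isTest_mul_groundStateSlope (hstrip : ∀ x ∈ U, across θ x ∈ Ioo 0 Real.pi)
    (hφ : IsTest U φ) : IsTest U fun x => φ x * star (φ x) * (groundStateSlope θ x : ℂ) := by
  refine (hφ.mul_right hφ.star.smooth).mul_right_of_contDiffAt fun x hx => ?_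
  have hslope : ContDiffAt ℝ ∞ (groundStateSlope θ) x :=
    (Real.contDiff_cos.comp contDiff_across).contDiffAt.div
      (Real.contDiff_sin.comp contDiff_across).contDiffAt
      (Real.sin_pos_of_mem_Ioo (hstrip x hx)).ne'
  exact Complex.ofRealCLM.contDiff.contDiffAt.comp x hslope

theorem fderiv_mul_groundStateSlope (hstrip : ∀ x ∈ U, across θ x ∈ Ioo 0 Real.pi)
    (hφ : IsTest U φ) (hx : x ∈ U) :
    fderiv ℝ (fun x => φ x * star (φ x) * (groundStateSlope θ x : ℂ)) x (acrossDir θ) =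
      (fderiv ℝ φ x (acrossDir θ) * star (φ x) + φ x * star (fderiv ℝ φ x (acrossDir θ))) *
        groundStateSlope θ x + φ x * star (φ x) * (-(1 + groundStateSlope θ x ^ 2) : ℝ) := by
  have hsin : Real.sin (across θ x) ≠ 0 := (Real.sin_pos_of_mem_Ioo (hstrip x hx)).ne'
  have hslope : HasDerivAt (fun s : ℝ => groundStateSlope θ (x + s • acrossDir θ))
      (-(1 + groundStateSlope θ x ^ 2)) 0 := by
    simp only [groundStateSlope, across_add_smul_acrossDir]
    exact HasDerivAt.comp_const_add (across θ x) 0 (by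
      rw [add_zero]
      exact hasDerivAt_cos_div_sin hsin)
  have hline := hφ.hasDerivAt_line x (acrossDir θ)
  rw [((isTest_mul_groundStateSlope hstrip hφ).hasDerivAt_line x (acrossDir θ)).unique
    ((hline.mul hline.star).mul hslope.ofReal_comp)]
  simp only [Pi.mul_apply, zero_smul, add_zero]

/-- Expanding `0 ≤ |D - w a|²`, where `D`, `a` and `w` stand for the derivative of the test
function across the arm, its value, and the slope `cot t`. -/
theorem re_le_norm_sq_sub_norm_sq (a D : ℂ) (w : ℝ) :
    ((D * star a + a * star D) * w + a * star a * (-(1 + w ^ 2) : ℝ)).re ≤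
      ‖D‖ ^ 2 - ‖a‖ ^ 2 := by
  have hsq : 0 ≤ ‖D - w * a‖ ^ 2 := by positivity
  simp only [Complex.sq_norm, Complex.normSq_apply, Complex.sub_re, Complex.sub_im,
    Complex.mul_re, Complex.mul_im, Complex.ofReal_re, Complex.ofReal_im, Complex.add_re,
    Complex.add_im, Complex.star_def, Complex.conj_re, Complex.conj_im] at hsq ⊢
  nlinarith

theorem integral_norm_sq_le_integral_norm_sq_fderiv (hU : IsOpen U)
    (hstrip : ∀ x ∈ U, across θ x ∈ Ioo 0 Real.pi) (hφ : IsTest U φ) :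
    ∫ x in U, ‖φ x‖ ^ 2 ≤ ∫ x in U, ‖fderiv ℝ φ x (acrossDir θ)‖ ^ 2 := by
  have hη := isTest_mul_groundStateSlope hstrip hφ
  have hint : IntegrableOn (fun x => fderiv ℝ
      (fun x => φ x * star (φ x) * (groundStateSlope θ x : ℂ)) x (acrossDir θ)) U :=
    ((hη.continuous_pd _).integrable_of_hasCompactSupport (hη.compact_pd _)).integrableOn
  have hzero : ∫ x in U, (fderiv ℝ
      (fun x => φ x * star (φ x) * (groundStateSlope θ x : ℂ)) x (acrossDir θ)).re = 0 := by
    rw [← Complex.zero_re, ← (hη.mono (subset_compl_frontier hU)).setIntegral_fderiv_eq_zero hU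
      (acrossDir θ)]
    exact integral_re hint
  have hφ_int : IntegrableOn (fun x => ‖φ x‖ ^ 2) U :=
    (hφ.memLp (volume.restrict U)).norm.integrable_sq
  have hD_int := hφ.integrable_norm_sq_fderiv (acrossDir θ) U
  rw [← sub_nonneg, ← integral_sub hD_int hφ_int, ← hzero]
  refine setIntegral_mono_on hint.re (hD_int.sub hφ_int) hU.measurableSet fun x hx => ?_
  rw [fderiv_mul_groundStateSlope hstrip hφ hx]
  exact re_le_norm_sq_sub_norm_sq _ _ _

theorem integral_norm_sq_le_integral_norm_sq_gradient (hU : IsOpen U)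
    (hstrip : ∀ x ∈ U, across θ x ∈ Ioo 0 Real.pi) (hφ : IsTest U φ) :
    ∫ x in U, ‖φ x‖ ^ 2 ≤ (∫ x in U, ‖pd1 φ x‖ ^ 2) + ∫ x in U, ‖pd2 φ x‖ ^ 2 := by
  have h1 : IntegrableOn (fun x => ‖pd1 φ x‖ ^ 2) U := hφ.integrable_norm_sq_fderiv (1, 0) U
  have h2 : IntegrableOn (fun x => ‖pd2 φ x‖ ^ 2) U := hφ.integrable_norm_sq_fderiv (0, 1) U
  refine (integral_norm_sq_le_integral_norm_sq_fderiv hU hstrip hφ).trans ?_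
  rw [← integral_add h1 h2]
  exact integral_mono (hφ.integrable_norm_sq_fderiv _ U) (h1.add h2)
    (norm_sq_fderiv_acrossDir_le θ φ)

theorem Represents.indicator (hU : IsOpen U) {p : L2 U × L2 U × L2 U} (hp : Represents U p φ) :
    Represents U p (U.indicator φ) := by
  have hmem : ∀ᵐ x ∂volume.restrict U, x ∈ U := ae_restrict_mem hU.measurableSet
  have heq : ∀ x ∈ U, U.indicator φ =ᶠ[𝓝 x] φ := fun x hx => by
    filter_upwards [hU.mem_nhds hx] with y hy using indicator_of_mem hy φ
  refine ⟨?_, ?_, ?_⟩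
  · filter_upwards [hp.ae_fst, hmem] with x h1 hx
    rw [h1, indicator_of_mem hx]
  · filter_upwards [hp.ae_pd1, hmem] with x h1 hx
    rw [h1, pd1, pd1, (heq x hx).fderiv_eq]
  · filter_upwards [hp.ae_pd2, hmem] with x h2 hx
    rw [h2, pd2, pd2, (heq x hx).fderiv_eq]

theorem isFormLowerBound_formDomain_frontier (hU : IsOpen U)
    (hstrip : ∀ x ∈ U, across θ x ∈ Ioo 0 Real.pi) :
    IsFormLowerBound (formDomain U (frontier U)) 1 := by
  intro p hp
  refine mem_of_mem_formDomain hU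
    (C := {p : L2 U × L2 U × L2 U | 1 * ‖p.1‖ ^ 2 ≤ ‖p.2.1‖ ^ 2 + ‖p.2.2‖ ^ 2})
    (isClosed_le (by fun_prop) (by fun_prop)) (fun q hq => ?_) hp
  obtain ⟨φ, hφ, hq⟩ := mem_smoothTriples.1 hq
  have hq := hq.indicator hU
  have hsq : ∀ {u : L2 U} {f : ℝ × ℝ → ℂ}, u =ᵐ[volume.restrict U] f →
      ‖u‖ ^ 2 = ∫ x in U, ‖f x‖ ^ 2 := fun huf => by
    rw [norm_sq_eq_integral]
    exact integral_congr_ae (huf.mono fun x hx => by simp only [hx])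
  rw [mem_ofPred_eq, one_mul, hsq hq.ae_fst, hsq hq.ae_pd1, hsq hq.ae_pd2]
  exact integral_norm_sq_le_integral_norm_sq_gradient hU hstrip (hφ.indicator hU)

end Poincare

section Symmetry

theorem mem_graph_laplacian {U Γ : Set (ℝ × ℝ)} (hU : IsOpen U) (hΓ : Disjoint U Γ) {u f : L2 U} :
    (u, f) ∈ (laplacian U Γ).graph ↔ ∃ p ∈ formDomain U Γ, p.1 = u ∧
      ∀ v ∈ formDomain U Γ, inner ℂ v.2.1 p.2.1 + inner ℂ v.2.2 p.2.2 = inner ℂ v.1 f := by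
  rw [laplacian_graph hU hΓ]
  rfl

theorem mem_graph_laplacian_frontier {U : Set (ℝ × ℝ)} (hU : IsOpen U) {u f : L2 U} :
    (u, f) ∈ (laplacian U (frontier U)).graph ↔ ∃ p ∈ formDomain U (frontier U), p.1 = u ∧
      ∀ v ∈ formDomain U (frontier U),
        inner ℂ v.2.1 p.2.1 + inner ℂ v.2.2 p.2.2 = inner ℂ v.1 f :=
  mem_graph_laplacian hU (disjoint_iff_inter_eq_empty.2 hU.inter_frontier_eq)

namespace IsSymmetricDomain

variable {U : Set (ℝ × ℝ)} {u f : L2 U} {p : L2 U × L2 U × L2 U} {m : ℝ} {z : ℂ}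
  (h : IsSymmetricDomain U)
include h

theorem mem_graph_laplacian_upperHalf {u f : L2 (upperHalf U)} :
    (u, f) ∈ (laplacian (upperHalf U) (upperBoundary U)).graph ↔
      ∃ p ∈ formDomain (upperHalf U) (upperBoundary U), p.1 = u ∧
        ∀ v ∈ formDomain (upperHalf U) (upperBoundary U),
          inner ℂ v.2.1 p.2.1 + inner ℂ v.2.2 p.2.2 = inner ℂ v.1 f :=
  mem_graph_laplacian h.isOpen_upperHalf ((disjoint_iff_inter_eq_empty.2
    h.isOpen_upperHalf.inter_frontier_eq).mono_right inter_subset_right)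

/-- The even part of functions on `U`, restricted to the upper half. -/
noncomputable def evenPart : L2 U →L[ℂ] L2 (upperHalf U) :=
  (1 / 2 : ℂ) • (restrictUpper U).comp (ContinuousLinearMap.id ℂ _ + h.reflectL2)

theorem evenPart_apply (u : L2 U) :
    h.evenPart u = (1 / 2 : ℂ) • restrictUpper U (u + h.reflectL2 u) := rfl

theorem evenPart_evenExt (g : L2 (upperHalf U)) : h.evenPart (h.evenExt g) = g := by
  rw [evenPart_apply, reflectL2_evenExt, map_add, restrictUpper_evenExt, smul_add, ← add_smul]
  norm_num

theorem evenPart_eq_zero_iff : h.evenPart u = 0 ↔ h.reflectL2 u = -u := by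
  rw [evenPart_apply, smul_eq_zero_iff_right (by norm_num), eq_neg_iff_add_eq_zero,
    add_comm (h.reflectL2 u)]
  refine ⟨fun hu => h.eq_zero_of_restrictUpper_eq_zero ?_ hu, fun hu => by rw [hu, map_zero]⟩
  rw [map_add, reflectL2_reflectL2, add_comm]

theorem evenExt_mem_graph {u f : L2 (upperHalf U)}
    (hu : (u, f) ∈ (laplacian (upperHalf U) (upperBoundary U)).graph) :
    (h.evenExt u, h.evenExt f) ∈ (laplacian U (frontier U)).graph := by
  obtain ⟨w, hw, rfl, hweak⟩ := h.mem_graph_laplacian_upperHalf.1 hu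
  refine (mem_graph_laplacian_frontier h.isOpen).2
    ⟨h.evenExtTriple w, h.evenExtTriple_mem hw, rfl, fun v hv => ?_⟩
  have htest := hweak _ (h.restrictTriple_mem (Submodule.add_mem _ hv (h.reflectTriple_mem hv)))
  simp only [restrictTriple_apply, reflectTriple_apply, Prod.fst_add, Prod.snd_add] at htest
  simp only [evenExtTriple_apply, inner_evenExt_right, inner_oddExt_right]
  rw [← htest, sub_eq_add_neg]

theorem evenPart_mem_graph (hu : (u, f) ∈ (laplacian U (frontier U)).graph) :
    (h.evenPart u, h.evenPart f) ∈ (laplacian (upperHalf U) (upperBoundary U)).graph := by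
  obtain ⟨w, hw, rfl, hweak⟩ := (mem_graph_laplacian_frontier h.isOpen).1 hu
  refine h.mem_graph_laplacian_upperHalf.2
    ⟨(1 / 2 : ℂ) • restrictTriple U (w + h.reflectTriple w), Submodule.smul_mem _ _
      (h.restrictTriple_mem (Submodule.add_mem _ hw (h.reflectTriple_mem hw))), rfl,
      fun v hv => ?_⟩
  have htest := hweak _ (h.evenExtTriple_mem hv)
  simp only [evenExtTriple_apply, inner_evenExt_left, inner_oddExt_left] at htest
  simp only [restrictTriple_apply, reflectTriple_apply, Prod.fst_add, Prod.snd_add, Prod.smul_fst,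
    Prod.smul_snd, evenPart_apply, inner_smul_right, ← sub_eq_add_neg]
  rw [← htest]
  ring

theorem isSummand : IsSummand (laplacian U (frontier U))
    (laplacian (upperHalf U) (upperBoundary U)) h.evenExt h.evenPart :=
  ⟨h.evenPart_evenExt, h.evenExt_mem_graph, h.evenPart_mem_graph⟩

/-- The odd functions of the form domain of the Dirichlet Laplacian. -/
noncomputable def oddDomain : Submodule ℂ (L2 U × L2 U × L2 U) :=
  formDomain U (frontier U) ⊓
    LinearMap.ker (h.reflectTriple + ContinuousLinearMap.id ℂ _).toLinearMap

theorem mem_oddDomain :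
    p ∈ h.oddDomain ↔ p ∈ formDomain U (frontier U) ∧ h.reflectTriple p = -p := by
  rw [oddDomain, Submodule.mem_inf, LinearMap.mem_ker, ContinuousLinearMap.coe_coe, add_apply,
    ContinuousLinearMap.id_apply, eq_neg_iff_add_eq_zero]

theorem isClosed_oddDomain : IsClosed (h.oddDomain : Set (L2 U × L2 U × L2 U)) :=
  (isClosed_formDomain h.isOpen).inter (ContinuousLinearMap.isClosed_ker _)

theorem sub_reflectTriple_mem_oddDomain (hp : p ∈ formDomain U (frontier U)) :
    p - h.reflectTriple p ∈ h.oddDomain := by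
  refine h.mem_oddDomain.2 ⟨Submodule.sub_mem _ hp (h.reflectTriple_mem hp), ?_⟩
  rw [map_sub, reflectTriple_reflectTriple, neg_sub]

theorem isFormLowerBound_oddDomain
    (hm : IsFormLowerBound (formDomain (upperHalf U) (frontier (upperHalf U))) m) :
    IsFormLowerBound h.oddDomain m := fun p hp => by
  obtain ⟨hp, hodd⟩ := h.mem_oddDomain.1 hp
  have hmem : restrictTriple U p ∈ formDomain (upperHalf U) (frontier (upperHalf U)) := by
    have := Submodule.smul_mem _ (2⁻¹ : ℂ) (h.restrictTriple_sub_reflectTriple_mem hp)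
    rwa [hodd, sub_neg_eq_add, ← two_smul ℂ, map_smul, inv_smul_smul₀ two_ne_zero] at this
  have hfst : h.reflectL2 p.1 = -p.1 := congrArg Prod.fst hodd
  have hpd1 : h.reflectL2 p.2.1 = -p.2.1 := congrArg (fun q => q.2.1) hodd
  have hpd2 : -h.reflectL2 p.2.2 = -p.2.2 := congrArg (fun q => q.2.2) hodd
  rw [h.norm_sq_eq_two_mul (Or.inr hfst), h.norm_sq_eq_two_mul (Or.inr hpd1),
    h.norm_sq_eq_two_mul (Or.inl (neg_injective hpd2))]
  have hbound := hm _ hmem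
  simp only [restrictTriple_apply] at hbound
  linarith

theorem form_reflectTriple_left (v p : L2 U × L2 U × L2 U) :
    inner ℂ (h.reflectTriple v).2.1 p.2.1 + inner ℂ (h.reflectTriple v).2.2 p.2.2 =
      inner ℂ v.2.1 (h.reflectTriple p).2.1 + inner ℂ v.2.2 (h.reflectTriple p).2.2 := by
  simp only [reflectTriple_apply, inner_neg_left, inner_neg_right, inner_reflectL2_left]

/-- For odd `p` and `f`, the weak equation tested on odd functions tests it on all functions. -/
theorem mem_graph_of_odd (hp : p ∈ h.oddDomain) (hf : h.reflectL2 f = -f)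
    (hweak : ∀ v ∈ h.oddDomain,
      inner ℂ v.2.1 p.2.1 + inner ℂ v.2.2 p.2.2 = inner ℂ v.1 f) :
    (p.1, f) ∈ (laplacian U (frontier U)).graph := by
  obtain ⟨hpD, hodd⟩ := h.mem_oddDomain.1 hp
  refine (mem_graph_laplacian_frontier h.isOpen).2 ⟨p, hpD, rfl, fun v hv => ?_⟩
  have htest := hweak _ (h.sub_reflectTriple_mem_oddDomain hv)
  have hform := h.form_reflectTriple_left v p
  have hsource : inner ℂ (h.reflectTriple v).1 f = -inner ℂ v.1 f := by
    rw [reflectTriple_apply, inner_reflectL2_left, hf, inner_neg_right]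
  simp only [hodd, Prod.fst_neg, Prod.snd_neg, inner_neg_right] at hform
  simp only [Prod.fst_sub, Prod.snd_sub, inner_sub_left, hsource] at htest
  linear_combination (1 / 2 : ℂ) * htest + (1 / 2 : ℂ) * hform

theorem eq_zero_of_odd (hm : IsFormLowerBound h.oddDomain m) (hz : z.im ≠ 0 ∨ z.re < m)
    (hu : (u, z • u) ∈ (laplacian U (frontier U)).graph) (hodd : h.reflectL2 u = -u) : u = 0 := by
  obtain ⟨w, hw, rfl, hweak⟩ := (mem_graph_laplacian_frontier h.isOpen).1 hu
  let p := w - h.reflectTriple w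
  have hp : p ∈ h.oddDomain := h.sub_reflectTriple_mem_oddDomain hw
  have hp1 : p.1 = (2 : ℂ) • w.1 := by
    rw [Prod.fst_sub, reflectTriple_apply, hodd, sub_neg_eq_add, two_smul]
  have htest := hweak p (h.mem_oddDomain.1 hp).1
  have hform := h.form_reflectTriple_left p w
  have hpd1 : inner ℂ p.2.1 p.2.1 = inner ℂ p.2.1 w.2.1 - inner ℂ p.2.1 (h.reflectTriple w).2.1 :=
    inner_sub_right _ _ _
  have hpd2 : inner ℂ p.2.2 p.2.2 = inner ℂ p.2.2 w.2.2 - inner ℂ p.2.2 (h.reflectTriple w).2.2 :=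
    inner_sub_right _ _ _
  have hzero : p.1 = 0 := hm.fst_eq_zero hz hp (by
    rw [(h.mem_oddDomain.1 hp).2] at hform
    simp only [Prod.fst_neg, Prod.snd_neg, inner_neg_left] at hform
    rw [inner_smul_right] at htest
    rw [hpd1, hpd2, hp1, inner_smul_right, ← hp1]
    linear_combination 2 * htest + hform)
  exact (smul_eq_zero_iff_right two_ne_zero).1 (hp1.symm.trans hzero)

theorem regularOnKer_evenPart (hm0 : 0 ≤ m)
    (hm : IsFormLowerBound (formDomain (upperHalf U) (frontier (upperHalf U))) m)
    (hz : z.im ≠ 0 ∨ z.re < m) :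
    RegularOnKer (laplacian U (frontier U)) h.evenPart z where
  inj hu hPu :=
    h.eq_zero_of_odd (h.isFormLowerBound_oddDomain hm) hz hu (h.evenPart_eq_zero_iff.1 hPu)
  surj {f} hf := by
    obtain ⟨p, hp, hweak⟩ := (h.isFormLowerBound_oddDomain hm).exists_weak_solution
      h.isClosed_oddDomain hm0 hz f
    have hodd : h.reflectL2 p.1 = -p.1 := congrArg Prod.fst (h.mem_oddDomain.1 hp).2
    refine ⟨p.1, h.mem_graph_of_odd hp ?_ hweak⟩
    rw [map_add, map_smul, h.evenPart_eq_zero_iff.1 hf, hodd, smul_neg, neg_add]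

theorem reflectL2_eq_of_mem_graph (hz : RegularOnKer (laplacian U (frontier U)) h.evenPart z)
    (hu : (u, z • u) ∈ (laplacian U (frontier U)).graph) : h.reflectL2 u = u := by
  have heven : h.evenExt (h.evenPart u) = u := by
    obtain ⟨w, -, hw⟩ := h.isSummand.eigenspace_eq_map hz ▸ mem_eigenspace.2 hu
    rw [← hw]
    exact congrArg h.evenExt (h.evenPart_evenExt w)
  rw [← heven, reflectL2_evenExt]

end IsSymmetricDomain

end Symmetry

section ProductApproximation

variable {S U Γ : Set (ℝ × ℝ)} {φ : ℝ × ℝ → ℂ} {w : ℝ × ℝ → ℝ} {g : ℝ → ℝ}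
  {p : L2 U × L2 U × L2 U}

theorem IsTest.fderiv_mul_comp (hφ : IsTest S φ) (hw : ContDiff ℝ ∞ w) (hg : Differentiable ℝ g)
    (x v : ℝ × ℝ) :
    fderiv ℝ (fun x => φ x * (g (w x) : ℂ)) x v =
      fderiv ℝ φ x v * (g (w x) : ℂ) + φ x * (deriv g (w x) * fderiv ℝ w x v : ℝ) := by
  have hline : HasDerivAt (fun s : ℝ => w (x + s • v)) (fderiv ℝ w x v) 0 :=
    (hw.differentiable (by simp) x).hasFDerivAt.hasLineDerivAt v
  have hgw : HasDerivAt (fun s : ℝ => g (w (x + s • v))) (deriv g (w x) * fderiv ℝ w x v) 0 :=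
    HasDerivAt.comp (0 : ℝ) (by simpa using (hg (w x)).hasDerivAt) hline
  have hmul : DifferentiableAt ℝ (fun x => φ x * (g (w x) : ℂ)) x :=
    (hφ.differentiable x).mul (Complex.ofRealCLM.differentiable.comp
      (hg.comp (hw.differentiable (by simp))) x)
  have hderiv := (hmul.hasFDerivAt.hasLineDerivAt v).unique
    ((hφ.hasDerivAt_line x v).mul hgw.ofReal_comp)
  simpa only [zero_smul, add_zero] using hderiv

theorem IsTest.exists_norm_fderiv_mul_add_le (hφ : IsTest S φ) {a b : ℝ × ℝ → ℝ}
    (ha : Continuous a) (hb : Continuous b) (v : ℝ × ℝ) :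
    ∃ C, ∀ x, ‖fderiv ℝ φ x v‖ * a x + ‖φ x‖ * b x ≤ C := by
  have hcont : Continuous fun x => ‖fderiv ℝ φ x v‖ * a x + ‖φ x‖ * b x :=
    ((hφ.continuous_pd v).norm.mul ha).add (hφ.smooth.continuous.norm.mul hb)
  have hcompact : HasCompactSupport fun x => ‖fderiv ℝ φ x v‖ * a x + ‖φ x‖ * b x :=
    (hφ.compact_pd v).norm.mul_right.add hφ.compact.norm.mul_right
  obtain ⟨C, hC⟩ := hcompact.exists_bound_of_continuous hcont
  exact ⟨C, fun x => (le_abs_self _).trans (hC x)⟩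

theorem abs_le_abs_add_one_of_abs_sub_max_lt {a b : ℝ} (h : |a - max b 0| < 1) :
    |a| ≤ |b| + 1 := by
  have hmax : max b 0 ≤ |b| := max_le (le_abs_self _) (abs_nonneg _)
  have hmax' : 0 ≤ max b 0 := le_max_right _ _
  rw [abs_le]
  constructor <;> linarith [(abs_lt.1 h).1, (abs_lt.1 h).2]

theorem IsTest.exists_bound_mul_comp (hφ : IsTest S φ) (hw : ContDiff ℝ ∞ w) (D : ℝ) :
    ∃ C, ∀ g : ℝ → ℝ, Differentiable ℝ g → (∀ t, |g t - max t 0| < 1) → (∀ t, |deriv g t| ≤ D) →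
      (∀ x, ‖φ x * (g (w x) : ℂ)‖ ≤ C) ∧
      (∀ x, ‖pd1 (fun x => φ x * (g (w x) : ℂ)) x‖ ≤ C) ∧
      ∀ x, ‖pd2 (fun x => φ x * (g (w x) : ℂ)) x‖ ≤ C := by
  have hweight : Continuous fun x => |w x| + 1 := hw.continuous.abs.add continuous_const
  have hdw : ∀ v, Continuous fun x => D * |fderiv ℝ w x v| := fun v =>
    continuous_const.mul ((hw.continuous_fderiv (by simp)).clm_apply continuous_const).abs
  have hcompact : HasCompactSupport fun x => ‖φ x‖ * (|w x| + 1) := hφ.compact.norm.mul_right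
  obtain ⟨C₀, h₀⟩ := hcompact.exists_bound_of_continuous (hφ.smooth.continuous.norm.mul hweight)
  obtain ⟨C₁, h₁⟩ := hφ.exists_norm_fderiv_mul_add_le hweight (hdw (1, 0)) (1, 0)
  obtain ⟨C₂, h₂⟩ := hφ.exists_norm_fderiv_mul_add_le hweight (hdw (0, 1)) (0, 1)
  refine ⟨max C₀ (max C₁ C₂), fun g hg hnear hD => ?_⟩
  have hgw : ∀ x, ‖(g (w x) : ℂ)‖ ≤ |w x| + 1 := fun x => by
    rw [Complex.norm_real]
    exact abs_le_abs_add_one_of_abs_sub_max_lt (hnear (w x))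
  have hderiv : ∀ x v, ‖fderiv ℝ (fun x => φ x * (g (w x) : ℂ)) x v‖ ≤
      ‖fderiv ℝ φ x v‖ * (|w x| + 1) + ‖φ x‖ * (D * |fderiv ℝ w x v|) := fun x v => by
    rw [hφ.fderiv_mul_comp hw hg]
    refine (norm_add_le _ _).trans ?_
    rw [norm_mul, norm_mul, Complex.norm_real (deriv g (w x) * _), Real.norm_eq_abs, abs_mul]
    gcongr
    exacts [hgw x, hD _]
  refine ⟨fun x => le_max_of_le_left ?_,
    fun x => le_max_of_le_right (le_max_of_le_left ((hderiv x (1, 0)).trans (h₁ x))),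
    fun x => le_max_of_le_right (le_max_of_le_right ((hderiv x (0, 1)).trans (h₂ x)))⟩
  rw [norm_mul]
  exact (mul_le_mul_of_nonneg_left (hgw x) (norm_nonneg _)).trans
    ((le_abs_self _).trans (h₀ x))

theorem tsupport_mul_comp_subset (hw : Continuous w) {ε : ℝ} (hg : ∀ t ≤ ε, g t = 0) :
    tsupport (fun x => φ x * (g (w x) : ℂ)) ⊆ tsupport φ ∩ {x | ε ≤ w x} :=
  closure_minimal (fun x hx => ⟨subset_tsupport φ (left_ne_zero_of_mul hx), by
      by_contra hlt
      exact right_ne_zero_of_mul hx (by rw [hg _ (not_le.1 hlt).le, Complex.ofReal_zero])⟩)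
    ((isClosed_tsupport φ).inter (isClosed_le continuous_const hw))

theorem IsSmoothApprox.tendsto_ofReal_of_pos {h : ℕ → ℝ → ℝ} {δ : ℝ}
    (ha : IsSmoothApprox h (fun t => max t 0) 1 (Ioi 0) δ) {t : ℝ} (ht : 0 < t) :
    Tendsto (fun n => (h n t : ℂ)) atTop (𝓝 t) := by
  have hlim := ha.tendsto t ht
  rw [max_eq_left ht.le] at hlim
  exact (Complex.continuous_ofReal.tendsto _).comp hlim

theorem IsSmoothApprox.tendsto_fderiv_mul_comp {h : ℕ → ℝ → ℝ} {δ : ℝ}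
    (ha : IsSmoothApprox h (fun t => max t 0) 1 (Ioi 0) δ) (hφ : IsTest S φ)
    (hw : ContDiff ℝ ∞ w) {x : ℝ × ℝ} (hx : 0 < w x) (v : ℝ × ℝ) :
    Tendsto (fun n => fderiv ℝ (fun x => φ x * (h n (w x) : ℂ)) x v) atTop
      (𝓝 (fderiv ℝ (fun x => φ x * (w x : ℂ)) x v)) := by
  simp only [fun n => hφ.fderiv_mul_comp hw (ha.differentiable n),
    hφ.fderiv_mul_comp hw (g := fun t => t) differentiable_id, deriv_id'']
  exact ((ha.tendsto_ofReal_of_pos hx).const_mul _).add (((Complex.continuous_ofReal.tendsto _).comp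
    ((ha.tendsto_deriv (w x) hx).mul_const _)).const_mul _)

/-- A weight vanishing on `Γ` may be cut off at a small level, so it enforces the Dirichlet
condition. -/
theorem Represents.mem_formDomain_of_mul (hU : IsOpen U) (hφ : IsTest S φ)
    (hw : ContDiff ℝ ∞ w) (hpos : ∀ x ∈ U, 0 < w x) (hΓ : ∀ x ∈ tsupport φ, x ∈ Γ → w x ≤ 0)
    (hp : Represents U p fun x => φ x * (w x : ℂ)) : p ∈ formDomain U Γ := by
  obtain ⟨g, hg, hzero⟩ := exists_isSmoothApprox_max one_pos
  obtain ⟨D, hD⟩ := hg.exists_abs_deriv_le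
  obtain ⟨C, hC⟩ := hφ.exists_bound_mul_comp hw D
  have hC' := fun n => hC (g n) (hg.differentiable n) (hg.abs_sub_lt n) (hD n)
  have hsupp : ∀ n, ∃ ε > 0,
      tsupport (fun x => φ x * (g n (w x) : ℂ)) ⊆ tsupport φ ∩ {x | ε ≤ w x} := fun n => by
    obtain ⟨ε, hε, h⟩ := hzero n
    exact ⟨ε, hε, tsupport_mul_comp_subset hw.continuous h⟩
  have hmem : ∀ᵐ x ∂volume.restrict U, 0 < w x :=
    (ae_restrict_mem hU.measurableSet).mono hpos
  refine mem_formDomain_of_tendsto hU (ψ := fun n x => φ x * (g n (w x) : ℂ)) (fun n => ?_)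
    hφ.compact (fun n => ?_) (fun n => (hC' n).1) (fun n => (hC' n).2.1) (fun n => (hC' n).2.2)
    ?_ ?_ ?_
  · obtain ⟨ε, hε, hsub⟩ := hsupp n
    have hsmooth := (hφ.mul_right (Complex.ofRealCLM.contDiff.comp ((hg.smooth n).comp hw)))
    exact ⟨hsmooth.smooth, hsmooth.compact, fun x hx hxΓ =>
      ((hε.trans_le (hsub hx).2).trans_le (hΓ x (hsub hx).1 hxΓ)).false⟩
  · obtain ⟨ε, -, hsub⟩ := hsupp n
    exact hsub.trans inter_subset_left
  · filter_upwards [hp.ae_fst, hmem] with x hx hwx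
    rw [hx]
    exact (hg.tendsto_ofReal_of_pos hwx).const_mul _
  · filter_upwards [hp.ae_pd1, hmem] with x hx hwx
    rw [hx]
    exact hg.tendsto_fderiv_mul_comp hφ hw hwx (1, 0)
  · filter_upwards [hp.ae_pd2, hmem] with x hx hwx
    rw [hx]
    exact hg.tendsto_fderiv_mul_comp hφ hw hwx (0, 1)

end ProductApproximation

section Green

variable {S U Γ : Set (ℝ × ℝ)} {φ χ : ℝ × ℝ → ℂ} {p : L2 U × L2 U × L2 U} {f : L2 U}

theorem IsTest.fderiv (hφ : IsTest S φ) (v : ℝ × ℝ) : IsTest S fun x => fderiv ℝ φ x v where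
  smooth := (hφ.smooth.fderiv_right (m := ∞) (by simp)).clm_apply contDiff_const
  compact := hφ.compact_pd v
  supp := (tsupport_fderiv_apply_subset ℝ v).trans hφ.supp

theorem IsTest.fderiv_star_mul (hφ : IsTest S φ) {g : ℝ × ℝ → ℂ} (hg : Differentiable ℝ g)
    (x v : ℝ × ℝ) : _root_.fderiv ℝ (fun x => Star.star (φ x) * g x) x v =
      Star.star (_root_.fderiv ℝ φ x v) * g x + Star.star (φ x) * _root_.fderiv ℝ g x v := by
  have hline := ((hφ.hasDerivAt_line x v).star.mul ((hg x).hasFDerivAt.hasLineDerivAt v))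
  have hmul : DifferentiableAt ℝ (fun x => Star.star (φ x) * g x) x :=
    (hφ.star.differentiable x).mul (hg x)
  simpa only [zero_smul, add_zero] using (hmul.hasFDerivAt.hasLineDerivAt v).unique hline

/-- Green's formula: the Dirichlet condition of `χ` on `Γ` removes the boundary term. -/
theorem setIntegral_star_fderiv_mul_eq_neg (hU : IsOpen U) (hφ : IsTest univ φ)
    (hsupp : tsupport φ ∩ frontier U ⊆ Γ) (hχ : IsTest Γᶜ χ) (v : ℝ × ℝ) :
    ∫ x in U, star (fderiv ℝ χ x v) * φ x = -∫ x in U, star (χ x) * fderiv ℝ φ x v := by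
  have htest : IsTest (frontier U)ᶜ fun x => star (χ x) * φ x :=
    ⟨hχ.star.smooth.mul hφ.smooth, hχ.star.compact.mul_right, fun x hx hfr =>
      hχ.star.supp (tsupport_mul_subset_left hx)
        (hsupp ⟨tsupport_mul_subset_right hx, hfr⟩)⟩
  have hint₁ : IntegrableOn (fun x => star (fderiv ℝ χ x v) * φ x) U :=
    (hχ.memLp_pd v (volume.restrict U)).star.integrable_mul (hφ.memLp _)
  have hint₂ : IntegrableOn (fun x => star (χ x) * fderiv ℝ φ x v) U :=
    (hχ.memLp (volume.restrict U)).star.integrable_mul (hφ.memLp_pd v _)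
  rw [eq_neg_iff_add_eq_zero, ← integral_add hint₁ hint₂,
    ← htest.setIntegral_fderiv_eq_zero hU v]
  simp only [hχ.fderiv_star_mul hφ.differentiable]

theorem mem_laplacianGraph_of_represents (hU : IsOpen U) (hφ : IsTest univ φ)
    (hsupp : tsupport φ ∩ frontier U ⊆ Γ) (hp : p ∈ formDomain U Γ) (hrep : Represents U p φ)
    (hf : f =ᵐ[volume.restrict U] fun x => -(pd1 (pd1 φ) x + pd2 (pd2 φ) x)) :
    (p.1, f) ∈ laplacianGraph U Γ := by
  refine ⟨p, hp, rfl, fun v hv => mem_of_mem_formDomain hU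
    (C := {v | inner ℂ v.2.1 p.2.1 + inner ℂ v.2.2 p.2.2 = inner ℂ v.1 f})
    (isClosed_eq (by fun_prop) (by fun_prop)) (fun w hw => ?_) hv⟩
  obtain ⟨χ, hχ, hw⟩ := mem_smoothTriples.1 hw
  have hgreen : ∀ v : ℝ × ℝ, ∫ x in U, star (fderiv ℝ χ x v) * fderiv ℝ φ x v =
      -∫ x in U, star (χ x) * fderiv ℝ (fun x => fderiv ℝ φ x v) x v := fun v =>
    setIntegral_star_fderiv_mul_eq_neg hU (hφ.fderiv v)
      ((inter_subset_inter_left _ (tsupport_fderiv_apply_subset ℝ v)).trans hsupp) hχ v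
  have hint : ∀ v : ℝ × ℝ, IntegrableOn
      (fun x => star (χ x) * fderiv ℝ (fun x => fderiv ℝ φ x v) x v) U := fun v =>
    (hχ.memLp (volume.restrict U)).star.integrable_mul ((hφ.fderiv v).memLp_pd v _)
  rw [mem_ofPred_eq, inner_eq_integral hw.ae_pd1 hrep.ae_pd1,
    inner_eq_integral hw.ae_pd2 hrep.ae_pd2, inner_eq_integral hw.ae_fst hf]
  refine (congrArg₂ (· + ·) (hgreen (1, 0)) (hgreen (0, 1))).trans ?_
  rw [← neg_add, ← integral_add (hint (1, 0)) (hint (0, 1)), ← integral_neg]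
  simp only [← mul_add, ← mul_neg]
  rfl

end Green

section RotatedCoordinates

variable {θ : ℝ} {x : ℝ × ℝ}

theorem contDiff_along : ContDiff ℝ ∞ (along θ) := by unfold along; fun_prop

theorem along_add_smul (x v : ℝ × ℝ) (s : ℝ) :
    along θ (x + s • v) = along θ x + s * along θ v := by
  simp only [along, Prod.fst_add, Prod.snd_add, Prod.smul_fst, Prod.smul_snd, smul_eq_mul]
  ring

theorem across_add_smul (x v : ℝ × ℝ) (s : ℝ) :
    across θ (x + s • v) = across θ x + s * across θ v := by
  simp only [across, Prod.fst_add, Prod.snd_add, Prod.smul_fst, Prod.smul_snd, smul_eq_mul]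
  ring

theorem snd_eq_along_across (θ : ℝ) (x : ℝ × ℝ) :
    x.2 = along θ x * Real.sin θ + across θ x * Real.cos θ := by
  simp only [along, across]
  linear_combination (-x.2) * Real.sin_sq_add_cos_sq θ

theorem snd_pos_of_along_pos (hθ : θ ∈ Ioo 0 (Real.pi / 2)) (halong : 0 < along θ x)
    (hacross : 0 ≤ across θ x) : 0 < x.2 := by
  have hs : 0 < Real.sin θ := Real.sin_pos_of_pos_of_lt_pi hθ.1 (by linarith [hθ.2, Real.pi_pos])
  have hc : 0 < Real.cos θ := Real.cos_pos_of_mem_Ioo ⟨by linarith [hθ.1, Real.pi_pos], hθ.2⟩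
  rw [snd_eq_along_across θ x]
  positivity

theorem across_mem_Icc_of_mem_closure (hθ : θ ∈ Ioo 0 (Real.pi / 2))
    (hx : x ∈ closure (halfGuide θ)) : across θ x ∈ Icc 0 Real.pi :=
  closure_minimal (t := across θ ⁻¹' Icc 0 Real.pi)
    (fun _ hy => Ioo_subset_Icc_self ((mem_halfGuide_iff hθ).1 hy).1)
    (isClosed_Icc.preimage contDiff_across.continuous) hx

theorem mem_dirichletBoundary_of_along_pos (hθ : θ ∈ Ioo 0 (Real.pi / 2))
    (hx : x ∈ frontier (halfGuide θ)) (halong : 0 < along θ x) : x ∈ dirichletBoundary θ :=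
  ⟨(isSymmetricDomain_guide θ).mem_frontier_of_mem_frontier_upperHalf hx
    (snd_pos_of_along_pos hθ halong (across_mem_Icc_of_mem_closure hθ hx.1).1), hx⟩

theorem sin_across_eq_zero (hθ : θ ∈ Ioo 0 (Real.pi / 2)) (hx : x ∈ frontier (halfGuide θ))
    (halong : 0 < along θ x) : Real.sin (across θ x) = 0 := by
  have hIcc := across_mem_Icc_of_mem_closure hθ hx.1
  have hnot : across θ x ∉ Ioo 0 Real.pi := fun hIoo =>
    ((isOpen_halfGuide θ).frontier_eq ▸ hx).2
      ((mem_halfGuide_iff hθ).2 ⟨hIoo, snd_pos_of_along_pos hθ halong hIcc.1⟩)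
  rcases eq_endpoints_or_mem_Ioo_of_mem_Icc hIcc with h | h | h
  · rw [h, Real.sin_zero]
  · rw [h, Real.sin_pi]
  · exact absurd h hnot

/-- The rotation to the coordinates along and across the upper arm. -/
noncomputable def rot (θ : ℝ) : (ℝ × ℝ) ≃ₜ (ℝ × ℝ) where
  toFun x := (along θ x, across θ x)
  invFun y := (y.1 * Real.cos θ - y.2 * Real.sin θ, y.1 * Real.sin θ + y.2 * Real.cos θ)
  left_inv x := by
    ext
    · simp only [along, across]
      linear_combination x.1 * Real.sin_sq_add_cos_sq θ
    · exact (snd_eq_along_across θ x).symm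
  right_inv y := by
    ext
    · simp only [along]
      linear_combination y.1 * Real.sin_sq_add_cos_sq θ
    · simp only [across]
      linear_combination y.2 * Real.sin_sq_add_cos_sq θ
  continuous_toFun := contDiff_along.continuous.prodMk contDiff_across.continuous
  continuous_invFun := by fun_prop

theorem rot_apply (x : ℝ × ℝ) : rot θ x = (along θ x, across θ x) := rfl

theorem measurePreserving_rot : MeasurePreserving (rot θ) (volume : Measure (ℝ × ℝ)) volume := by
  refine ⟨(rot θ).continuous.measurable, ?_⟩
  let f : ℝ × ℝ →ₗ[ℝ] ℝ × ℝ := Matrix.toLin (Module.Basis.finTwoProd ℝ) (Module.Basis.finTwoProd ℝ)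
    !![Real.cos θ, Real.sin θ; -Real.sin θ, Real.cos θ]
  have hf : ⇑f = rot θ := by
    ext x
    · simp only [f, Matrix.toLin_finTwoProd_apply, rot_apply, along]
      ring
    · simp only [f, Matrix.toLin_finTwoProd_apply, rot_apply, across]
      ring
  have hdet : LinearMap.det f = 1 := by
    rw [LinearMap.det_toLin, Matrix.det_fin_two_of]
    linear_combination Real.sin_sq_add_cos_sq θ
  have hmap := Measure.map_linearMap_addHaar_eq_smul_addHaar (volume : Measure (ℝ × ℝ)) (f := f)
    (by rw [hdet]; exact one_ne_zero)
  rw [hf, hdet] at hmap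
  simpa using hmap

end RotatedCoordinates

section Modes

variable {θ : ℝ} {ρ σ γ : ℝ → ℂ}

/-- The product of a function of the coordinate along the arm and of a function of the coordinate
across the arm. -/
noncomputable def mode (θ : ℝ) (ρ γ : ℝ → ℂ) (x : ℝ × ℝ) : ℂ := ρ (along θ x) * γ (across θ x)

theorem contDiff_mode (hρ : ContDiff ℝ ∞ ρ) (hγ : ContDiff ℝ ∞ γ) :
    ContDiff ℝ ∞ (mode θ ρ γ) :=
  (hρ.comp contDiff_along).mul (hγ.comp contDiff_across)

theorem hasDerivAt_comp_affine (hρ : Differentiable ℝ ρ) (a b : ℝ) :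
    HasDerivAt (fun s : ℝ => ρ (a + s * b)) (b * deriv ρ a) 0 := by
  have hlin : HasDerivAt (fun s : ℝ => a + s * b) b 0 := by
    simpa using ((hasDerivAt_id (0 : ℝ)).mul_const b).const_add a
  simpa [Function.comp_def] using (hρ (a + 0 * b)).hasDerivAt.scomp 0 hlin

theorem fderiv_mode (hρ : ContDiff ℝ ∞ ρ) (hγ : ContDiff ℝ ∞ γ) (x v : ℝ × ℝ) :
    fderiv ℝ (mode θ ρ γ) x v =
      along θ v * mode θ (deriv ρ) γ x + across θ v * mode θ ρ (deriv γ) x := by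
  have hline : HasDerivAt (fun s : ℝ => mode θ ρ γ (x + s • v)) (fderiv ℝ (mode θ ρ γ) x v) 0 :=
    ((contDiff_mode hρ hγ).differentiable (by simp) x).hasFDerivAt.hasLineDerivAt v
  have hprod :=
    (hasDerivAt_comp_affine (hρ.differentiable (by simp)) (along θ x) (along θ v)).mul
      (hasDerivAt_comp_affine (hγ.differentiable (by simp)) (across θ x) (across θ v))
  simp only [mode, along_add_smul, across_add_smul] at hline
  rw [hline.unique hprod]
  simp only [zero_mul, add_zero, mode]
  ring

theorem fderiv_fderiv_mode (hρ : ContDiff ℝ ∞ ρ) (hγ : ContDiff ℝ ∞ γ) (x v : ℝ × ℝ) :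
    fderiv ℝ (fun x => fderiv ℝ (mode θ ρ γ) x v) x v =
      along θ v ^ 2 * mode θ (deriv (deriv ρ)) γ x +
        2 * along θ v * across θ v * mode θ (deriv ρ) (deriv γ) x +
        across θ v ^ 2 * mode θ ρ (deriv (deriv γ)) x := by
  have hρ' : ContDiff ℝ ∞ (deriv ρ) := hρ.deriv' (n := ∞)
  have hγ' : ContDiff ℝ ∞ (deriv γ) := hγ.deriv' (n := ∞)
  have hdiff₁ : Differentiable ℝ (mode θ (deriv ρ) γ) :=
    (contDiff_mode hρ' hγ).differentiable (by simp)
  have hdiff₂ : Differentiable ℝ (mode θ ρ (deriv γ)) :=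
    (contDiff_mode hρ hγ').differentiable (by simp)
  simp only [fderiv_mode hρ hγ]
  rw [fderiv_fun_add ((hdiff₁ x).const_mul _) ((hdiff₂ x).const_mul _),
    fderiv_const_mul (hdiff₁ x), fderiv_const_mul (hdiff₂ x)]
  simp only [add_apply, smul_apply, smul_eq_mul,
    fderiv_mode hρ' hγ, fderiv_mode hρ hγ']
  ring

theorem laplacian_mode (hρ : ContDiff ℝ ∞ ρ) (hγ : ContDiff ℝ ∞ γ) (x : ℝ × ℝ) :
    pd1 (pd1 (mode θ ρ γ)) x + pd2 (pd2 (mode θ ρ γ)) x =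
      mode θ (deriv (deriv ρ)) γ x + mode θ ρ (deriv (deriv γ)) x := by
  have hsq : (Real.sin θ : ℂ) ^ 2 + (Real.cos θ : ℂ) ^ 2 = 1 := by
    exact_mod_cast Real.sin_sq_add_cos_sq θ
  refine (congrArg₂ (· + ·) (fderiv_fderiv_mode hρ hγ x (1, 0))
    (fderiv_fderiv_mode hρ hγ x (0, 1))).trans ?_
  simp only [along, across, one_mul, zero_mul, add_zero, zero_add, sub_zero, zero_sub,
    Complex.ofReal_neg]
  linear_combination
    (mode θ (deriv (deriv ρ)) γ x + mode θ ρ (deriv (deriv γ)) x) * hsq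

theorem tsupport_mode_subset (ρ γ : ℝ → ℂ) :
    tsupport (mode θ ρ γ) ⊆ rot θ ⁻¹' (tsupport ρ ×ˢ tsupport γ) :=
  closure_minimal
    (fun _ hx => ⟨subset_tsupport ρ (left_ne_zero_of_mul hx),
      subset_tsupport γ (right_ne_zero_of_mul hx)⟩)
    (((isClosed_tsupport ρ).prod (isClosed_tsupport γ)).preimage (rot θ).continuous)

theorem isTest_mode (hρ : ContDiff ℝ ∞ ρ) (hρc : HasCompactSupport ρ) (hγ : ContDiff ℝ ∞ γ)
    (hγc : HasCompactSupport γ) : IsTest univ (mode θ ρ γ) where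
  smooth := contDiff_mode hρ hγ
  compact := ((rot θ).isCompact_preimage.2 (hρc.prod hγc)).of_isClosed_subset
    (isClosed_tsupport _) (tsupport_mode_subset ρ γ)
  supp := subset_univ _

/-- The Dirichlet ground state `sin` of the cross section `(0, π)`, of energy `1`. -/
noncomputable def csin (t : ℝ) : ℂ := (Real.sin t : ℂ)

theorem contDiff_csin : ContDiff ℝ ∞ csin := Complex.ofRealCLM.contDiff.comp Real.contDiff_sin

theorem deriv_deriv_csin (t : ℝ) : deriv (deriv csin) t = -csin t := by
  have hderiv : deriv csin = fun t => (Real.cos t : ℂ) :=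
    funext fun t => (Real.hasDerivAt_sin t).ofReal_comp.deriv
  rw [hderiv, (Real.hasDerivAt_cos t).ofReal_comp.deriv, Complex.ofReal_neg, csin]

/-- A compactly supported function which is `1` on `[0, π]`. -/
noncomputable def transverseCutoff : ContDiffBump (Real.pi / 2) where
  rIn := Real.pi / 2
  rOut := Real.pi
  rIn_pos := Real.pi_div_two_pos
  rIn_lt_rOut := half_lt_self Real.pi_pos

theorem transverseCutoff_eq_one {t : ℝ} (ht : t ∈ Icc 0 Real.pi) : transverseCutoff t = 1 :=
  transverseCutoff.one_of_mem_closedBall <| by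
    rw [Real.closedBall_eq_Icc]
    simpa [transverseCutoff] using ht

theorem contDiff_transverseCutoff : ContDiff ℝ ∞ fun t => (transverseCutoff t : ℂ) :=
  Complex.ofRealCLM.contDiff.comp transverseCutoff.contDiff

theorem hasCompactSupport_transverseCutoff :
    HasCompactSupport fun t => (transverseCutoff t : ℂ) :=
  transverseCutoff.hasCompactSupport.comp_left Complex.ofReal_zero

/-- The amplitude of a wave running inside the upper arm. -/
structure IsProfile (ρ : ℝ → ℂ) : Prop where
  smooth : ContDiff ℝ ∞ ρ
  compact : HasCompactSupport ρ
  supp : tsupport ρ ⊆ Ioi 0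

theorem IsProfile.deriv (hρ : IsProfile ρ) : IsProfile (deriv ρ) :=
  ⟨hρ.smooth.deriv' (n := ∞), hρ.compact.deriv, tsupport_deriv_subset.trans hρ.supp⟩

theorem IsProfile.eq_zero (hρ : IsProfile ρ) {s : ℝ} (hs : s ≤ 0) : ρ s = 0 :=
  image_eq_zero_of_notMem_tsupport fun hmem => (hρ.supp hmem).not_ge hs

theorem mode_cutoff_mem_formDomain (hθ : θ ∈ Ioo 0 (Real.pi / 2)) (hρ : IsProfile ρ)
    {p : L2 (halfGuide θ) × L2 (halfGuide θ) × L2 (halfGuide θ)}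
    (hp : Represents (halfGuide θ) p (mode θ ρ fun t => transverseCutoff t * csin t)) :
    p ∈ formDomain (halfGuide θ) (dirichletBoundary θ) := by
  have htest : IsTest univ (mode θ ρ fun t => transverseCutoff t) :=
    isTest_mode hρ.smooth hρ.compact contDiff_transverseCutoff hasCompactSupport_transverseCutoff
  have hmul : mode θ ρ (fun t => transverseCutoff t * csin t) = fun x =>
      mode θ ρ (fun t => transverseCutoff t) x * (Real.sin (across θ x) : ℂ) :=
    funext fun x => (mul_assoc _ _ _).symm
  rw [hmul] at hp
  exact Represents.mem_formDomain_of_mul (isOpen_halfGuide θ) htest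
    (Real.contDiff_sin.comp contDiff_across)
    (fun x hx => Real.sin_pos_of_mem_Ioo ((mem_halfGuide_iff hθ).1 hx).1)
    (fun x hx hxΓ => (sin_across_eq_zero hθ hxΓ.2
      (hρ.supp (tsupport_mode_subset _ _ hx).1)).le) hp

theorem laplacian_mode_cutoff (hρ : ContDiff ℝ ∞ ρ) {x : ℝ × ℝ}
    (hx : across θ x ∈ Ioo 0 Real.pi) :
    pd1 (pd1 (mode θ ρ fun t => transverseCutoff t * csin t)) x +
        pd2 (pd2 (mode θ ρ fun t => transverseCutoff t * csin t)) x =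
      mode θ (fun s => deriv (deriv ρ) s - ρ s) csin x := by
  have hev : (fun t => transverseCutoff t * csin t) =ᶠ[𝓝 (across θ x)] csin := by
    filter_upwards [Ioo_mem_nhds hx.1 hx.2] with t ht
    rw [transverseCutoff_eq_one (Ioo_subset_Icc_self ht), Complex.ofReal_one, one_mul]
  rw [laplacian_mode hρ (contDiff_transverseCutoff.mul contDiff_csin), mode, mode, mode,
    hev.deriv.deriv_eq, hev.eq_of_nhds, deriv_deriv_csin]
  ring

theorem IsTest.exists_represents {S : Set (ℝ × ℝ)} {φ : ℝ × ℝ → ℂ} (hφ : IsTest S φ)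
    (U : Set (ℝ × ℝ)) : ∃ p, Represents U p φ :=
  ⟨((hφ.memLp _).toLp φ, (hφ.memLp_pd (1, 0) _).toLp _, (hφ.memLp_pd (0, 1) _).toLp _),
    (hφ.memLp _).coeFn_toLp, (hφ.memLp_pd (1, 0) _).coeFn_toLp, (hφ.memLp_pd (0, 1) _).coeFn_toLp⟩

theorem exists_mem_graph_mixedLaplacian (hθ : θ ∈ Ioo 0 (Real.pi / 2)) (hρ : IsProfile ρ) :
    ∃ q ∈ (mixedLaplacian θ).graph, q.1 =ᵐ[volume.restrict (halfGuide θ)] mode θ ρ csin ∧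
      q.2 =ᵐ[volume.restrict (halfGuide θ)] mode θ (fun s => ρ s - deriv (deriv ρ) s) csin := by
  have htest : IsTest univ (mode θ ρ fun t => transverseCutoff t * csin t) :=
    isTest_mode hρ.smooth hρ.compact (contDiff_transverseCutoff.mul contDiff_csin)
      hasCompactSupport_transverseCutoff.mul_right
  have hacross : ∀ᵐ x ∂volume.restrict (halfGuide θ), across θ x ∈ Ioo 0 Real.pi :=
    (ae_restrict_mem (isOpen_halfGuide θ).measurableSet).mono
      fun x hx => ((mem_halfGuide_iff hθ).1 hx).1
  obtain ⟨p, hp⟩ := htest.exists_represents (halfGuide θ)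
  have hf : MemLp (fun x => -(pd1 (pd1 (mode θ ρ fun t => transverseCutoff t * csin t)) x +
      pd2 (pd2 (mode θ ρ fun t => transverseCutoff t * csin t)) x)) 2
      (volume.restrict (halfGuide θ)) :=
    (((htest.fderiv (1, 0)).memLp_pd (1, 0) _).add ((htest.fderiv (0, 1)).memLp_pd (0, 1) _)).neg
  refine ⟨(p.1, hf.toLp _), mixedLaplacian_graph θ ▸ mem_laplacianGraph_of_represents
    (isOpen_halfGuide θ) htest (fun x hx => mem_dirichletBoundary_of_along_pos hθ hx.2
      (hρ.supp (tsupport_mode_subset _ _ hx.1).1))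
    (mode_cutoff_mem_formDomain hθ hρ hp) hp hf.coeFn_toLp, ?_, ?_⟩
  · filter_upwards [hp.ae_fst, hacross] with x hx hIoo
    rw [hx, mode, mode, transverseCutoff_eq_one (Ioo_subset_Icc_self hIoo), Complex.ofReal_one,
      one_mul]
  · filter_upwards [hf.coeFn_toLp, hacross] with x hx hIoo
    rw [hx, laplacian_mode_cutoff hρ.smooth hIoo, mode, mode]
    ring

theorem setIntegral_Ioo_sin_sq : ∫ t in Ioo 0 Real.pi, Real.sin t ^ 2 = Real.pi / 2 := by
  rw [← integral_Ioc_eq_integral_Ioo, ← intervalIntegral.integral_of_le Real.pi_pos.le,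
    integral_sin_sq]
  simp

theorem norm_sq_of_ae_eq_mode (hθ : θ ∈ Ioo 0 (Real.pi / 2)) (hσ : ∀ s ≤ 0, σ s = 0)
    {u : L2 (halfGuide θ)} (hu : u =ᵐ[volume.restrict (halfGuide θ)] mode θ σ csin) :
    ‖u‖ ^ 2 = Real.pi / 2 * ∫ s, ‖σ s‖ ^ 2 := by
  have hrot : ∀ x, ‖mode θ σ csin x‖ ^ 2 =
      (fun y : ℝ × ℝ => ‖σ y.1‖ ^ 2 * Real.sin y.2 ^ 2) (rot θ x) := fun x => by
    simp only [rot_apply, mode, csin, norm_mul, Complex.norm_real, Real.norm_eq_abs, mul_pow,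
      sq_abs]
  calc ‖u‖ ^ 2 = ∫ x in halfGuide θ, ‖mode θ σ csin x‖ ^ 2 := by
        rw [norm_sq_eq_integral]
        exact integral_congr_ae (hu.mono fun x hx => by simp only [hx])
    _ = ∫ x in rot θ ⁻¹' (univ ×ˢ Ioo 0 Real.pi), ‖mode θ σ csin x‖ ^ 2 := by
        refine (setIntegral_eq_of_subset_of_forall_sdiff_eq_zero
          ((rot θ).continuous.measurable (MeasurableSet.univ.prod measurableSet_Ioo))
          (fun x hx => ⟨mem_univ _, ((mem_halfGuide_iff hθ).1 hx).1⟩) fun x hx => ?_).symm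
        have hzero : σ (along θ x) = 0 := hσ _ <| not_lt.1 fun halong => hx.2 <|
          (mem_halfGuide_iff hθ).2 ⟨hx.1.2, snd_pos_of_along_pos hθ halong hx.1.2.1.le⟩
        simp [mode, hzero]
    _ = Real.pi / 2 * ∫ s, ‖σ s‖ ^ 2 := by
        simp only [hrot]
        rw [measurePreserving_rot.setIntegral_preimage_emb (rot θ).measurableEmbedding
          (fun y : ℝ × ℝ => ‖σ y.1‖ ^ 2 * Real.sin y.2 ^ 2), Measure.volume_eq_prod,
          setIntegral_prod_mul (fun s => ‖σ s‖ ^ 2) (fun t => Real.sin t ^ 2),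
          Measure.restrict_univ, setIntegral_Ioo_sin_sq, mul_comm]

theorem inner_eq_zero_of_ae_eq_mode {u v : L2 (halfGuide θ)}
    (hu : u =ᵐ[volume.restrict (halfGuide θ)] mode θ ρ γ)
    (hv : v =ᵐ[volume.restrict (halfGuide θ)] mode θ σ γ) (hdisj : ∀ s, ρ s = 0 ∨ σ s = 0) :
    inner ℂ u v = 0 := by
  rw [inner_eq_integral hu hv]
  refine integral_eq_zero_of_ae (Eventually.of_forall fun x => ?_)
  rcases hdisj (along θ x) with hzero | hzero <;> simp [mode, hzero]

end Modes

section WavePackets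

variable {β : ℝ → ℂ} {k ℓ : ℝ}

theorem exists_isProfile_integral_norm_sq_eq {m : ℝ} (hm : 0 < m) :
    ∃ β, IsProfile β ∧ tsupport β ⊆ Ioo 1 2 ∧ ∫ s, ‖β s‖ ^ 2 = m := by
  obtain ⟨f, hsupp, hcompact, hsmooth, -, hone⟩ := exists_contDiff_tsupport_subset (n := ⊤)
    (Ioo_mem_nhds (by norm_num : (1 : ℝ) < 3 / 2) (by norm_num : (3 / 2 : ℝ) < 2))
  have hpos : 0 < ∫ s, f s ^ 2 := by
    refine (hsmooth.continuous.pow 2).integral_pos_of_hasCompactSupport_nonneg_nonzero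
      (hcompact.comp_left (g := fun t : ℝ => t ^ 2) (by simp)) (fun s => sq_nonneg _)
      (x := 3 / 2) ?_
    simp [hone]
  have hsub : tsupport (fun s => (√(m / ∫ s, f s ^ 2) * f s : ℂ)) ⊆ tsupport f :=
    closure_mono fun s hs => by simpa using right_ne_zero_of_mul hs
  refine ⟨fun s => √(m / ∫ s, f s ^ 2) * f s,
    ⟨contDiff_const.mul (Complex.ofRealCLM.contDiff.comp hsmooth),
      hcompact.of_isClosed_subset (isClosed_tsupport _) hsub,
      fun s hs => one_pos.trans (hsupp (hsub hs)).1⟩, hsub.trans hsupp, ?_⟩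
  simp only [norm_mul, Complex.norm_real, Real.norm_eq_abs, mul_pow, sq_abs]
  rw [integral_const_mul, Real.sq_sqrt (div_nonneg hm.le hpos.le), div_mul_cancel₀ _ hpos.ne']

/-- The plane wave of wave number `k`. -/
noncomputable def wave (k s : ℝ) : ℂ := Complex.exp (Complex.I * k * s)

theorem hasDerivAt_wave (k s : ℝ) : HasDerivAt (wave k) (Complex.I * k * wave k s) s := by
  have hlin : HasDerivAt (fun s : ℝ => Complex.I * k * (s : ℂ)) (Complex.I * k) s := by
    simpa using (Complex.ofRealCLM.hasDerivAt (x := s)).const_mul (Complex.I * k)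
  exact hlin.cexp.congr_deriv (by rw [wave]; ring)

theorem contDiff_wave (k : ℝ) : ContDiff ℝ ∞ (wave k) := by
  have hcoe : ContDiff ℝ ∞ fun s : ℝ => (s : ℂ) := Complex.ofRealCLM.contDiff
  unfold wave
  fun_prop

theorem norm_wave (k s : ℝ) : ‖wave k s‖ = 1 := by
  rw [wave, show Complex.I * k * s = ((k * s : ℝ) : ℂ) * Complex.I by push_cast; ring,
    Complex.norm_exp_ofReal_mul_I]

theorem deriv_mul_wave (hβ : Differentiable ℝ β) (k : ℝ) :
    deriv (fun s => β s * wave k s) = fun s => (deriv β s + Complex.I * k * β s) * wave k s := by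
  ext s
  refine ((hβ s).hasDerivAt.mul (hasDerivAt_wave k s)).deriv.trans ?_
  ring

theorem deriv_deriv_mul_wave (hβ : ContDiff ℝ ∞ β) (k s : ℝ) :
    deriv (deriv fun s => β s * wave k s) s =
      (deriv (deriv β) s + 2 * Complex.I * k * deriv β s - k ^ 2 * β s) * wave k s := by
  have hβd : Differentiable ℝ β := hβ.differentiable (by simp)
  have hβd' : Differentiable ℝ (deriv β) := (hβ.deriv' (n := ∞)).differentiable (by simp)
  have hsum : HasDerivAt (fun s => deriv β s + Complex.I * k * β s)
      (deriv (deriv β) s + Complex.I * k * deriv β s) s :=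
    (hβd' s).hasDerivAt.add ((hβd s).hasDerivAt.const_mul _)
  have hsumd : Differentiable ℝ fun s => deriv β s + Complex.I * k * β s :=
    hβd'.add (hβd.const_mul _)
  rw [deriv_mul_wave hβd, deriv_mul_wave hsumd]
  simp only [hsum.deriv]
  linear_combination (k ^ 2 * β s * wave k s) * Complex.I_sq

theorem deriv_const_mul_comp_mul (c : ℂ) (ℓ : ℝ) (β : ℝ → ℂ) :
    deriv (fun s => c * β (ℓ * s)) = fun s => c * ℓ * deriv β (ℓ * s) := by
  ext s
  rw [deriv_const_mul_field, deriv_comp_mul_left, Complex.real_smul, mul_assoc]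

/-- The wave packet of wave number `k` whose envelope is `β`, stretched by the factor `1 / ℓ` and
rescaled so that its `L²` norm stays the same. -/
noncomputable def packet (β : ℝ → ℂ) (k ℓ s : ℝ) : ℂ := √ℓ * β (ℓ * s) * wave k s

theorem mul_mem_tsupport_of_packet_ne_zero {s : ℝ} (hs : packet β k ℓ s ≠ 0) :
    ℓ * s ∈ tsupport β :=
  subset_tsupport β (right_ne_zero_of_mul (left_ne_zero_of_mul hs))

theorem isProfile_packet (hβ : IsProfile β) (k : ℝ) (hℓ : 0 < ℓ) : IsProfile (packet β k ℓ) := by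
  have hsub : tsupport (packet β k ℓ) ⊆ Homeomorph.mulLeft₀ ℓ hℓ.ne' ⁻¹' tsupport β :=
    closure_minimal (fun s hs => mul_mem_tsupport_of_packet_ne_zero hs)
      ((isClosed_tsupport β).preimage (Homeomorph.mulLeft₀ ℓ hℓ.ne').continuous)
  exact ⟨(contDiff_const.mul (hβ.smooth.comp (contDiff_const.mul contDiff_id))).mul
      (contDiff_wave k),
    ((Homeomorph.mulLeft₀ ℓ hℓ.ne').isCompact_preimage.2 hβ.compact).of_isClosed_subset
      (isClosed_tsupport _) hsub,
    fun s hs => pos_of_mul_pos_right (hβ.supp (hsub hs)) hℓ.le⟩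

theorem integral_comp_mul_left_of_pos (hℓ : 0 < ℓ) (g : ℝ → ℝ) :
    ∫ s, g (ℓ * s) = ℓ⁻¹ * ∫ s, g s := by
  rw [Measure.integral_comp_mul_left, abs_of_pos (inv_pos.2 hℓ), smul_eq_mul]

theorem integral_norm_packet_sq (β : ℝ → ℂ) (k : ℝ) (hℓ : 0 < ℓ) :
    ∫ s, ‖packet β k ℓ s‖ ^ 2 = ∫ s, ‖β s‖ ^ 2 := by
  have hnorm : ∀ s, ‖packet β k ℓ s‖ ^ 2 = ℓ * ‖β (ℓ * s)‖ ^ 2 := fun s => by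
    rw [packet, norm_mul, norm_mul, norm_wave, Complex.norm_real, mul_one, mul_pow,
      Real.norm_eq_abs, sq_abs, Real.sq_sqrt hℓ.le]
  simp only [hnorm]
  rw [integral_const_mul, integral_comp_mul_left_of_pos hℓ fun s => ‖β s‖ ^ 2,
    mul_inv_cancel_left₀ hℓ.ne']

theorem deriv_deriv_packet (hβ : ContDiff ℝ ∞ β) (k ℓ s : ℝ) :
    deriv (deriv (packet β k ℓ)) s + k ^ 2 * packet β k ℓ s =
      √ℓ * ℓ * (ℓ * deriv (deriv β) (ℓ * s) + 2 * Complex.I * k * deriv β (ℓ * s)) * wave k s := by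
  have hscaled : ContDiff ℝ ∞ fun s => √ℓ * β (ℓ * s) :=
    contDiff_const.mul (hβ.comp (contDiff_const.mul contDiff_id))
  have hpacket : packet β k ℓ = fun s => √ℓ * β (ℓ * s) * wave k s := rfl
  rw [hpacket, deriv_deriv_mul_wave hscaled, deriv_const_mul_comp_mul, deriv_const_mul_comp_mul]
  ring

theorem exists_integral_norm_packet_defect_le (hβ : IsProfile β) (k : ℝ) : ∃ M : ℝ, ∀ ℓ : ℝ,
    0 < ℓ → ℓ ≤ 1 → ∫ s, ‖deriv (deriv (packet β k ℓ)) s + k ^ 2 * packet β k ℓ s‖ ^ 2 ≤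
      ℓ ^ 2 * M := by
  let G : ℝ → ℝ := fun s => (‖deriv (deriv β) s‖ + 2 * |k| * ‖deriv β s‖) ^ 2
  have hβ' : ContDiff ℝ ∞ (deriv β) := hβ.smooth.deriv' (n := ∞)
  have hcont : Continuous G := by
    have hβc := hβ'.continuous
    have hβc' := (hβ'.deriv' (n := ∞)).continuous
    fun_prop
  have hcompact : HasCompactSupport G := by
    refine (hβ.compact.deriv.deriv.norm.add hβ.compact.deriv.norm.mul_left).comp_left
      (g := fun t : ℝ => t ^ 2) (by simp)
  refine ⟨∫ s, G s, fun ℓ hℓ hℓ1 => ?_⟩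
  have hpt : ∀ s, ‖deriv (deriv (packet β k ℓ)) s + k ^ 2 * packet β k ℓ s‖ ^ 2 ≤
      ℓ ^ 3 * G (ℓ * s) := fun s => by
    have hnorm : ‖(ℓ : ℂ) * deriv (deriv β) (ℓ * s) + 2 * Complex.I * k * deriv β (ℓ * s)‖ ≤
        ‖deriv (deriv β) (ℓ * s)‖ + 2 * |k| * ‖deriv β (ℓ * s)‖ := by
      refine (norm_add_le _ _).trans (add_le_add ?_ (by simp))
      rw [norm_mul, Complex.norm_real, Real.norm_eq_abs, abs_of_pos hℓ]
      exact mul_le_of_le_one_left (norm_nonneg _) hℓ1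
    rw [deriv_deriv_packet hβ.smooth, norm_mul, norm_wave, mul_one, norm_mul, norm_mul, mul_pow,
      mul_pow, Complex.norm_real, Complex.norm_real, Real.norm_eq_abs, Real.norm_eq_abs, sq_abs,
      sq_abs, Real.sq_sqrt hℓ.le, ← pow_succ' ℓ 2]
    exact mul_le_mul_of_nonneg_left (pow_le_pow_left₀ (norm_nonneg _) hnorm 2) (by positivity)
  have hint : Integrable fun s => ℓ ^ 3 * G (ℓ * s) :=
    ((hcont.integrable_of_hasCompactSupport hcompact).comp_mul_left' hℓ.ne').const_mul _
  calc _ ≤ ∫ s, ℓ ^ 3 * G (ℓ * s) :=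
        integral_mono_of_nonneg (Eventually.of_forall fun s => by positivity) hint
          (Eventually.of_forall hpt)
    _ = ℓ ^ 2 * ∫ s, G s := by
        rw [integral_const_mul, integral_comp_mul_left_of_pos hℓ G]
        field_simp

theorem eq_of_two_inv_pow_mul_mem_Ioo {i j : ℕ} {s : ℝ} (hi : (1 / 2) ^ i * s ∈ Ioo (1 : ℝ) 2)
    (hj : (1 / 2) ^ j * s ∈ Ioo (1 : ℝ) 2) : i = j := by
  wlog hij : i < j generalizing i j
  · exact (not_lt.1 hij).eq_or_lt.elim Eq.symm fun hji => (this hj hi hji).symm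
  have hs : 0 < s := pos_of_mul_pos_right (one_pos.trans hi.1) (by positivity)
  have hpow : (1 / 2 : ℝ) ^ j ≤ (1 / 2) ^ i * (1 / 2) := by
    rw [← pow_succ]
    exact pow_le_pow_of_le_one (by norm_num) (by norm_num) hij
  linarith [mul_le_mul_of_nonneg_right hpow hs.le, hi.2, hj.1]

/-- A Weyl sequence of `-d²/ds²` on the half line, for the spectral parameter `k ^ 2`. -/
theorem exists_weyl_profiles {m : ℝ} (hm : 0 < m) (k : ℝ) : ∃ ρ : ℕ → ℝ → ℂ,
    (∀ n, IsProfile (ρ n)) ∧ (∀ n, ∫ s, ‖ρ n s‖ ^ 2 = m) ∧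
      (∀ i j, i ≠ j → ∀ s, ρ i s = 0 ∨ ρ j s = 0) ∧
      Tendsto (fun n => ∫ s, ‖deriv (deriv (ρ n)) s + k ^ 2 * ρ n s‖ ^ 2) atTop (𝓝 0) := by
  obtain ⟨β, hβ, hsupp, hnorm⟩ := exists_isProfile_integral_norm_sq_eq hm
  obtain ⟨M, hM⟩ := exists_integral_norm_packet_defect_le hβ k
  have hpos : ∀ n : ℕ, (0 : ℝ) < (1 / 2) ^ n := fun n => by positivity
  have hlim : Tendsto (fun n : ℕ => (((1 / 2 : ℝ) ^ n) ^ 2) * M) atTop (𝓝 0) := by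
    have hgeom : Tendsto (fun n : ℕ => (1 / 2 : ℝ) ^ n) atTop (𝓝 0) :=
      tendsto_pow_atTop_nhds_zero_of_lt_one (by norm_num) (by norm_num)
    simpa only [ne_eq, OfNat.ofNat_ne_zero, not_false_eq_true, zero_pow, zero_mul] using
      (hgeom.pow 2).mul_const M
  refine ⟨fun n => packet β k ((1 / 2) ^ n), fun n => isProfile_packet hβ k (hpos n),
    fun n => (integral_norm_packet_sq β k (hpos n)).trans hnorm, fun i j hij s => ?_,
    squeeze_zero (fun n => by positivity)
      (fun n => hM _ (hpos n) (pow_le_one₀ (by norm_num) (by norm_num))) hlim⟩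
  by_contra! hne
  exact hij (eq_of_two_inv_pow_mul_mem_Ioo (hsupp (mul_mem_tsupport_of_packet_ne_zero hne.1))
    (hsupp (mul_mem_tsupport_of_packet_ne_zero hne.2)))

end WavePackets

section Weyl

variable {θ : ℝ}

theorem orthonormal_of_ae_eq_mode (hθ : θ ∈ Ioo 0 (Real.pi / 2)) {ρ : ℕ → ℝ → ℂ}
    (hρ : ∀ n, ∀ s ≤ 0, ρ n s = 0) (hnorm : ∀ n, ∫ s, ‖ρ n s‖ ^ 2 = 2 / Real.pi)
    (hdisj : ∀ i j, i ≠ j → ∀ s, ρ i s = 0 ∨ ρ j s = 0) {e : ℕ → L2 (halfGuide θ)}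
    (he : ∀ n, e n =ᵐ[volume.restrict (halfGuide θ)] mode θ (ρ n) csin) : Orthonormal ℂ e := by
  refine ⟨fun n => ?_, fun i j hij => inner_eq_zero_of_ae_eq_mode (he i) (he j) (hdisj i j hij)⟩
  have hsq : ‖e n‖ ^ 2 = 1 := by
    rw [norm_sq_of_ae_eq_mode hθ (hρ n) (he n), hnorm, div_mul_div_cancel₀ two_ne_zero,
      div_self Real.pi_ne_zero]
  exact (pow_eq_one_iff_of_nonneg (norm_nonneg _) two_ne_zero).1 hsq

theorem tendsto_zero_of_ae_eq_mode (hθ : θ ∈ Ioo 0 (Real.pi / 2)) {σ : ℕ → ℝ → ℂ}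
    (hσ : ∀ n, ∀ s ≤ 0, σ n s = 0)
    (hlim : Tendsto (fun n => ∫ s, ‖σ n s‖ ^ 2) atTop (𝓝 0)) {r : ℕ → L2 (halfGuide θ)}
    (hr : ∀ n, r n =ᵐ[volume.restrict (halfGuide θ)] mode θ (σ n) csin) :
    Tendsto r atTop (𝓝 0) := by
  have hsq : Tendsto (fun n => ‖r n‖ ^ 2) atTop (𝓝 0) := by
    simpa only [fun n => norm_sq_of_ae_eq_mode hθ (hσ n) (hr n), mul_zero] using
      hlim.const_mul (Real.pi / 2)
  rw [tendsto_zero_iff_norm_tendsto_zero]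
  simpa only [Real.sqrt_sq (norm_nonneg _), Real.sqrt_zero] using hsq.sqrt

theorem isClosed_mixedLaplacian (θ : ℝ) : (mixedLaplacian θ).IsClosed := by
  have hclosed := isClosed_laplacianGraph (U := halfGuide θ) (Γ := dirichletBoundary θ)
    (isOpen_halfGuide θ)
  rwa [← mixedLaplacian_graph] at hclosed

theorem not_isFredholmAt_mixedLaplacian (hθ : θ ∈ Ioo 0 (Real.pi / 2)) (k : ℝ) :
    ¬ IsFredholmAt (mixedLaplacian θ) (1 + k ^ 2) := by
  obtain ⟨ρ, hρ, hnorm, hdisj, hlim⟩ := exists_weyl_profiles (div_pos two_pos Real.pi_pos) k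
  choose q hgraph hfst hsnd using fun n => exists_mem_graph_mixedLaplacian hθ (hρ n)
  have hdefect : ∀ n, ((q n).2 - (1 + k ^ 2 : ℂ) • (q n).1 : L2 (halfGuide θ))
      =ᵐ[volume.restrict (halfGuide θ)]
        mode θ (fun s => -(deriv (deriv (ρ n)) s + k ^ 2 * ρ n s)) csin := fun n => by
    filter_upwards [hfst n, hsnd n, Lp.coeFn_sub (q n).2 ((1 + k ^ 2 : ℂ) • (q n).1),
      Lp.coeFn_smul (1 + k ^ 2 : ℂ) (q n).1] with x hx₁ hx₂ hsub hsmul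
    rw [hsub, Pi.sub_apply, hsmul, Pi.smul_apply, hx₁, hx₂, smul_eq_mul, mode, mode, mode]
    ring
  exact not_isFredholmAt_of_orthonormal (isClosed_mixedLaplacian θ)
    (orthonormal_of_ae_eq_mode hθ (fun n s => (hρ n).eq_zero) hnorm hdisj hfst)
    (fun n => by simpa only [sub_add_cancel] using hgraph n)
    (tendsto_zero_of_ae_eq_mode hθ
      (fun n s hs => by rw [(hρ n).deriv.deriv.eq_zero hs, (hρ n).eq_zero hs]; simp)
      (by simpa only [norm_neg] using hlim) hdefect)

theorem im_ne_zero_or_re_lt_one_of_isFredholmAt (hθ : θ ∈ Ioo 0 (Real.pi / 2)) {z : ℂ}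
    (hz : IsFredholmAt (mixedLaplacian θ) z) : z.im ≠ 0 ∨ z.re < 1 := by
  by_contra! hreal
  have hsq : z = 1 + (√(z.re - 1) : ℂ) ^ 2 := by
    rw [← Complex.ofReal_pow, Real.sq_sqrt (sub_nonneg.2 hreal.2)]
    exact Complex.ext (by simp) (by simpa using hreal.1)
  exact not_isFredholmAt_mixedLaplacian hθ (√(z.re - 1)) (hsq ▸ hz)

end Weyl

end BrokenGuide

theorem proposition2p2 (θ : ℝ) (hθ : θ ∈ Set.Ioo 0 (Real.pi / 2)) :
    BrokenGuide.discreteSpectrum (BrokenGuide.dirichletLaplacian (BrokenGuide.guide θ)) =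
      BrokenGuide.discreteSpectrum (BrokenGuide.mixedLaplacian θ) ∧
    ∀ (z : ℝ), z < 1 →
      ∀ ψ : (BrokenGuide.dirichletLaplacian (BrokenGuide.guide θ)).domain,
        BrokenGuide.dirichletLaplacian (BrokenGuide.guide θ) ψ =
            (z : ℂ) • (ψ : BrokenGuide.L2 (BrokenGuide.guide θ)) →
          ∀ᵐ x ∂(MeasureTheory.volume.restrict (BrokenGuide.guide θ)),
            (ψ : BrokenGuide.L2 (BrokenGuide.guide θ)) (x.1, -x.2) =
              (ψ : BrokenGuide.L2 (BrokenGuide.guide θ)) x := by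
  have h := BrokenGuide.isSymmetricDomain_guide θ
  have hm := BrokenGuide.isFormLowerBound_formDomain_frontier (BrokenGuide.isOpen_halfGuide θ)
    fun x hx => ((BrokenGuide.mem_halfGuide_iff hθ).1 hx).1
  refine ⟨h.isSummand.discreteSpectrum_eq fun z hz => h.regularOnKer_evenPart zero_le_one hm
    (BrokenGuide.im_ne_zero_or_re_lt_one_of_isFredholmAt hθ hz), fun z hz ψ hψ => ?_⟩
  have hgraph : ((ψ : BrokenGuide.L2 (BrokenGuide.guide θ)),
      (z : ℂ) • (ψ : BrokenGuide.L2 (BrokenGuide.guide θ))) ∈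
        (BrokenGuide.dirichletLaplacian (BrokenGuide.guide θ)).graph :=
    (LinearPMap.mem_graph_iff _).2 ⟨ψ, rfl, hψ⟩
  have heven : h.reflectL2 (ψ : BrokenGuide.L2 (BrokenGuide.guide θ)) = ψ :=
    h.reflectL2_eq_of_mem_graph (h.regularOnKer_evenPart zero_le_one hm (Or.inr hz)) hgraph
  filter_upwards [h.reflectL2_ae (MeasureTheory.ae_eq_refl _)] with x hx
  rw [heven] at hx
  exact hx.symm
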